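/- Let $G$ be a discrete group acting by homeomorphisms on a locally compact Hausdorff space $X$, and let $\mathcal G=G\ltimes X$ be the transformation groupoid, in which $(g,x)$ is an arrow from $x$ to $gx$. Let $\mathcal Z$ be the $\mathcal G$-sheaf of locally constant $\mathbb Z$-valued functions on $X$. Let $0\to\mathcal Z\to\mathcal S^0\to\mathcal S^1\to\cdots$ be a resolution of $\mathcal Z$ by $c$-soft $\mathcal G$-sheaves, and let $\cdots\to P_1\to P_0\to\mathbb Z\to 0$ be a resolution of the trivial $\mathbb ZG$-module $\mathbb Z$ by projective modules. * The Crainic–Moerdijk homology $H_n(\mathcal G)$, $n\in\mathbb Z$, is the homology of the direct sum total complex of the double complex $\Gamma_c(\mathcal G^{(p)};\tau_p^*\mathcal S^q)$, $p,q\ge 0$, in total degree $p-q$. Here $\mathcal G^{(p)}$ is the space of composable strings $x_0\leftarrow x_1\leftarrow\cdots\leftarrow x_p$ of arrows, $\tau_p$ sends such a string to $x_0$, and $\Gamma_c$ denotes compactly supported sections. The vertical differentials are induced by the resolution. The horizontal differential is $\delta=\sum_{i=0}^{p}(-1)^i\delta_i$, where $\delta_i$ is summation over the fibres of the $i$-th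 face map (omit $x_i$), combined, if $i=0$, with transport of germs from $x_0$ to $x_1$ by the inverse of the arrow $x_0\leftarrow x_1$. * The group hyperhomology $\mathbb H_n(G;X)=\mathbb H_n(G;\Gamma_c(X;\mathcal S^{-\bullet}))$ is the homology of the direct sum total complex of the double complex $P_p\otimes_{\mathbb ZG}\Gamma_c(X;\mathcal S^q)$, in total degree $p-q$. Then there are isomorphisms of abelian groups $$\Phi_{\mathcal S,P,n}\colon H_n(\mathcal G)\;\cong\;\mathbb H_n(G;X)$$ for all such $\mathcal S$ and $P$ and all $n\in\mathbb Z$, which are canonical in the following sense. They are natural for morphisms of complexes of $\mathcal G$-sheaves $\mathcal S^\bullet\to\mathcal S'^\bullet$ between such resolutions. They are natural for chain maps $P\to P'$ over the identity of $\mathbb Z$. For $a\in\Gamma_c(\mathcal G^{(0)};\mathcal S^q)=\Gamma_c(X;\mathcal S^q)$ with $da=0$, and $e\in P_0$ with image $1$ in $\mathbb Z$, the class of $a$ (in bidegree $(0,q)$) is sent to the class of $e\otimes a$. Moreover, the isomorphism is compatible with the pairings with invariant probability measures. Let $X$ be compact, and let $\mu$ be an invariant Borel probability measure on $X$, that is,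 one with $\mu(s(B))=\mu(r(B))$ for all open bisections $B$ of $\mathcal G$. Let the resolution be Borel: $\mathcal S^0$ is a $\mathcal G$-subsheaf, containing $\mathcal Z$, of the $\mathcal G$-sheaf of complex-valued Borel functions that are bounded on compact sets, and $\mathcal Z\to\mathcal S^0$ is the inclusion. Let $P_0\cong\mathbb ZG$ in such a way that $P_0\to\mathbb Z$ is the standard augmentation, so that $P_0\otimes_{\mathbb ZG}\Gamma_c(X;\mathcal S^0)=\Gamma_c(X;\mathcal S^0)$. Then $[(a_p)_{p\ge0}]\mapsto\int_X a_0\,d\mu$ and $[(x_p)_{p\ge0}]\mapsto\int_X x_0\,d\mu$ give well-defined homomorphisms $H_0(\mathcal G)\to\mathbb C$ and $\mathbb H_0(G;X)\to\mathbb C$, where $a_0$ and $x_0$ denote the components in bidegree $(0,0)$ of a cycle, and $\Phi_{\mathcal S,P,0}$ carries the first to the second. -/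

import Mathlib

open CategoryTheory Topology

universe u

namespace CrainicMoerdijk

/-! ### Sheaves of abelian groups as étale spaces -/

/-- A point of the étale space of a family of stalks. -/
@[ext]
structure EtalePoint {X : Type u} (stalk : X → Type u) where
  base : X
  germ : stalk base

/-- A sheaf of abelian groups on `X`, given by its étale space: a family of abelian groups, with a
topology on the disjoint union of the stalks for which the projection to `X` is a local
homeomorphism and subtraction is continuous on the fibre product of the étale space with itself
over `X` (given the subspace topology). -/
structure EtaleSheaf (X : Type u) [TopologicalSpace X] where
  stalk : X → Type u
  [grp : ∀ x, AddCommGroup (stalk x)]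
  [top : TopologicalSpace (EtalePoint stalk)]
  isLocalHomeomorph_base : IsLocalHomeomorph (EtalePoint.base : EtalePoint stalk → X)
  continuous_sub : Continuous[TopologicalSpace.induced
      (fun p : (x : X) × (stalk x × stalk x) =>
        ((⟨p.1, p.2.1⟩, ⟨p.1, p.2.2⟩) : EtalePoint stalk × EtalePoint stalk)) inferInstance, top]
    (fun p : (x : X) × (stalk x × stalk x) => (⟨p.1, p.2.1 - p.2.2⟩ : EtalePoint stalk))

attribute [instance] EtaleSheaf.grp EtaleSheaf.top

namespace EtaleSheaf

variable {X Y Z : Type u} [TopologicalSpace X] [TopologicalSpace Y] [TopologicalSpace Z]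

/-- The lift to the étale space of a family of germs of the pullback sheaf `τ^*S`: the stalk of
`τ^*S` at `y` is the stalk of `S` at `τ y`, and the sections of `τ^*S` are the continuous lifts of
`τ` to the étale space of `S`. -/
def lift (S : EtaleSheaf X) (τ : Y → X) (s : ∀ y, S.stalk (τ y)) (y : Y) : EtalePoint S.stalk :=
  ⟨τ y, s y⟩

theorem continuousAt_lift_sub (S : EtaleSheaf X) (τ : Y → X) {s t : ∀ y, S.stalk (τ y)} {y : Y}
    (hs : ContinuousAt (S.lift τ s) y) (ht : ContinuousAt (S.lift τ t) y) :
    ContinuousAt (S.lift τ (s - t)) y := by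
  let _ : TopologicalSpace ((x : X) × (S.stalk x × S.stalk x)) := TopologicalSpace.induced
      (fun p => ((⟨p.1, p.2.1⟩, ⟨p.1, p.2.2⟩) : EtalePoint S.stalk × EtalePoint S.stalk))
      inferInstance
  have h1 : ContinuousAt (fun y => (⟨τ y, s y, t y⟩ : (x : X) × (S.stalk x × S.stalk x))) y := by
    have hind : IsInducing (fun p : (x : X) × (S.stalk x × S.stalk x) =>
        ((⟨p.1, p.2.1⟩, ⟨p.1, p.2.2⟩) : EtalePoint S.stalk × EtalePoint S.stalk)) := ⟨rfl⟩
    rw [hind.continuousAt_iff]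
    exact hs.prodMk ht
  exact (S.continuous_sub.continuousAt).comp h1

theorem continuousAt_lift_zero (S : EtaleSheaf X) {τ : Y → X} {y : Y} (hτ : ContinuousAt τ y) :
    ContinuousAt (S.lift τ 0) y := by
  classical
  obtain ⟨e, he, hbase⟩ := S.isLocalHomeomorph_base ⟨τ y, 0⟩
  have hb : ∀ p, e p = p.base := fun p => by rw [← hbase]
  have hsrc : τ y ∈ e.target := by
    have := e.map_source he
    rwa [hb] at this
  -- near `τ y` there is some local section `σ`, and `0 = σ - σ`
  let σ : ∀ y, S.stalk (τ y) := fun y =>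
    if h : (e.symm (τ y)).base = τ y then h ▸ (e.symm (τ y)).germ else 0
  have hσ : ContinuousAt (S.lift τ σ) y := by
    have h1 : ContinuousAt (fun y => e.symm (τ y)) y :=
      ContinuousAt.comp (g := e.symm) (e.symm.continuousAt (by simpa using hsrc)) hτ
    refine h1.congr ?_
    have : ∀ᶠ z in 𝓝 y, τ z ∈ e.target := hτ.eventually (e.open_target.mem_nhds hsrc)
    filter_upwards [this] with z hz
    have hbz : (e.symm (τ z)).base = τ z := by rw [← hb, e.right_inv hz]
    have : ∀ (p : EtalePoint S.stalk) (x : X) (h : p.base = x),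
        p = (⟨x, if h : p.base = x then h ▸ p.germ else 0⟩ : EtalePoint S.stalk) := by
      rintro p x rfl
      simp
    exact this _ _ hbz
  have := S.continuousAt_lift_sub τ hσ hσ
  rwa [sub_self] at this

/-- The germs of families of elements of the stalks of `τ^*S` that are continuous at `y`. -/
def continuousAtSubgroup (S : EtaleSheaf X) {τ : Y → X} {y : Y} (hτ : ContinuousAt τ y) :
    AddSubgroup (∀ y, S.stalk (τ y)) :=
  AddSubgroup.ofSub {s | ContinuousAt (S.lift τ s) y} ⟨0, S.continuousAt_lift_zero hτ⟩
    (fun s hs t ht => by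
      have := S.continuousAt_lift_sub τ hs ht
      rwa [sub_eq_add_neg] at this)

/-- `Γ_c(Y; τ^*S)`, the group of compactly supported sections of the pullback of `S` along
a continuous map `τ : Y → X`. -/
def Γc (S : EtaleSheaf X) (τ : C(Y, X)) : AddSubgroup (∀ y, S.stalk (τ y)) :=
  AddSubgroup.ofSub
    {s | Continuous (S.lift τ s) ∧ ∃ K : Set Y, IsCompact K ∧ ∀ y, y ∉ K → s y = 0}
    ⟨0, continuous_iff_continuousAt.2 fun _ => S.continuousAt_lift_zero τ.continuous.continuousAt,
      ∅, isCompact_empty, fun _ _ => rfl⟩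
    (fun s hs t ht => by
      obtain ⟨hs, K, hK, hsK⟩ := hs
      obtain ⟨ht, L, hL, htL⟩ := ht
      refine ⟨?_, K ∪ L, hK.union hL, fun y hy => ?_⟩
      · rw [← sub_eq_add_neg]
        exact continuous_iff_continuousAt.2 fun y =>
          S.continuousAt_lift_sub τ hs.continuousAt ht.continuousAt
      · simp only [Set.mem_union, not_or] at hy
        simp [hsK y hy.1, htL y hy.2])

/-- A family `s` of germs restricts to a section of `S` over `U`. -/
def IsSectionOn (S : EtaleSheaf X) (U : Set X) (s : ∀ x, S.stalk x) : Prop :=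
  ContinuousOn (S.lift id s) U

/-- `S` is `c`-soft: any section over an open neighbourhood of a compact set agrees, near that
compact set, with a global section. -/
def IsCSoft (S : EtaleSheaf X) : Prop :=
  ∀ (K U : Set X) (s : ∀ x, S.stalk x), IsCompact K → IsOpen U → K ⊆ U → S.IsSectionOn U s →
    ∃ (V : Set X) (t : ∀ x, S.stalk x), IsOpen V ∧ K ⊆ V ∧ V ⊆ U ∧ S.IsSectionOn Set.univ t ∧
      ∀ x ∈ V, s x = t x

theorem finite_fiber_inter [T2Space Z] {φ : Y → Z} (hφ : IsLocalHomeomorph φ)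
    {K : Set Y} (hK : IsCompact K) (z : Z) : (φ ⁻¹' {z} ∩ K).Finite := by
  have hc : IsCompact (φ ⁻¹' {z} ∩ K) :=
    hK.inter_left (isClosed_singleton.preimage hφ.continuous)
  have hsub : (φ '' (φ ⁻¹' {z} ∩ K)).Subsingleton := by
    rintro _ ⟨a, ha, rfl⟩ _ ⟨b, hb, rfl⟩
    rw [show φ a = z from ha.1, show φ b = z from hb.1]
  have : IsDiscrete (φ ⁻¹' {z} ∩ K) := by
    apply (hφ.isLocalHomeomorphOn (s := φ ⁻¹' {z} ∩ K)).isDiscrete_of_image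
    exact hsub.isDiscrete
  exact hc.finite this

/-- The sum over the fibres of a local homeomorphism of a continuous family of germs with compact
support is continuous. -/
theorem continuous_lift_finsum [T2Space Y] [T2Space Z] (S : EtaleSheaf X) {φ : Y → Z}
    (hφ : IsLocalHomeomorph φ) {τ : Z → X} (hτ : Continuous τ)
    (r : ∀ (y : Y) (z : Z), φ y = z → S.stalk (τ z))
    (hr : Continuous (S.lift (fun y => τ (φ y)) fun y => r y (φ y) rfl))
    {K : Set Y} (hK : IsCompact K) (hrK : ∀ y z h, y ∉ K → r y z h = 0) :
    Continuous (S.lift τ fun z => ∑ᶠ y : {y // φ y = z}, r y.1 z y.2) := by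
  classical
  rw [continuous_iff_continuousAt]
  intro z₀
  have hfin := finite_fiber_inter hφ hK z₀
  obtain ⟨U, hU, hdisj⟩ := hfin.t2_separation
  choose e he heφ using hφ
  have heφ' : ∀ y y', e y y' = φ y' := fun y y' => by rw [← heφ y]
  let V : Y → Set Y := fun y => U y ∩ (e y).source
  have hV : ∀ y, IsOpen (V y) := fun y => (hU y).2.inter (e y).open_source
  let F := hfin.toFinset
  have hF : ∀ y ∈ F, φ y = z₀ := fun y hy => ((hfin.mem_toFinset).1 hy).1
  let K' : Set Y := K \ ⋃ y ∈ F, V y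
  have hK' : IsCompact K' := hK.diff (isOpen_biUnion fun y _ => hV y)
  have hcont : Continuous φ := IsLocalHomeomorph.continuous (fun y => ⟨e y, he y, heφ y⟩)
  have hz : z₀ ∉ φ '' K' := by
    rintro ⟨y, hy, hyz⟩
    refine hy.2 (Set.mem_iUnion₂.2 ⟨y, (hfin.mem_toFinset).2 ⟨hyz, hy.1⟩, (hU y).1, he y⟩)
  have hW1 : (φ '' K')ᶜ ∈ 𝓝 z₀ := (hK'.image hcont).isClosed.isOpen_compl.mem_nhds hz
  have hW2 : ∀ᶠ z in 𝓝 z₀, ∀ y ∈ F, z ∈ (e y) '' V y := by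
    rw [Filter.eventually_all_finset]
    intro y hy
    refine ((e y).isOpen_image_of_subset_source (hV y) Set.inter_subset_right).mem_nhds ?_
    exact ⟨y, ⟨(hU y).1, he y⟩, by rw [heφ', hF y hy]⟩
  let σ : Y → ∀ z, S.stalk (τ z) := fun y z =>
    if h : φ ((e y).symm z) = z then r ((e y).symm z) z h else 0
  have hσ : ∀ y ∈ F, σ y ∈ S.continuousAtSubgroup (hτ.continuousAt (x := z₀)) := by
    intro y hy
    change ContinuousAt (S.lift τ (σ y)) z₀
    have hz₀ : z₀ ∈ (e y).target := by
      have := (e y).map_source (he y)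
      rwa [heφ', hF y hy] at this
    have h1 : ContinuousAt ((e y).symm) z₀ := (e y).symm.continuousAt (by simpa using hz₀)
    refine (ContinuousAt.comp (g := S.lift (fun y => τ (φ y)) fun y => r y (φ y) rfl)
      hr.continuousAt h1).congr ?_
    filter_upwards [(e y).open_target.mem_nhds hz₀] with z hz
    have hzz : φ ((e y).symm z) = z := by rw [← heφ' y, (e y).right_inv hz]
    have : ∀ (y' : Y) (z : Z) (h : φ y' = z),
        (S.lift (fun y => τ (φ y)) fun y => r y (φ y) rfl) y' =
          (⟨τ z, if h : φ y' = z then r y' z h else 0⟩ : EtalePoint S.stalk) := by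
      rintro y' z rfl
      simp [lift]
    exact this _ _ hzz
  have hsum : ContinuousAt (S.lift τ (∑ y ∈ F, σ y)) z₀ :=
    (S.continuousAtSubgroup (hτ.continuousAt (x := z₀))).sum_mem hσ
  refine hsum.congr ?_
  filter_upwards [hW1, hW2] with z hz1 hz2
  have key : (∑ y ∈ F, σ y) z = ∑ᶠ y : {y // φ y = z}, r y.1 z y.2 := by
    have hinv : ∀ y ∈ F, (e y).symm z ∈ V y ∧ φ ((e y).symm z) = z := by
      intro y hy
      obtain ⟨y', hy', hyz⟩ := hz2 y hy
      rw [← hyz, (e y).left_inv hy'.2]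
      exact ⟨hy', by rw [heφ' y]⟩
    let g : {y // y ∈ F} → {y // φ y = z} := fun y => ⟨(e y.1).symm z, (hinv y.1 y.2).2⟩
    have hg : Function.Injective g := by
      intro a b hab
      by_contra hne
      have hab' : (e a.1).symm z = (e b.1).symm z := congrArg Subtype.val hab
      have hd := hdisj ((hfin.mem_toFinset).1 a.2) ((hfin.mem_toFinset).1 b.2)
        (fun h => hne (Subtype.ext h))
      exact Set.disjoint_left.1 hd (hinv a.1 a.2).1.1 (hab' ▸ (hinv b.1 b.2).1.1)
    rw [finsum_eq_sum_of_support_subset (s := F.attach.image g), Finset.sum_image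
      (fun a _ b _ h => hg h), Finset.sum_apply, ← Finset.sum_attach]
    · refine Finset.sum_congr rfl fun y _ => ?_
      simp only [σ, g]
      rw [dif_pos (hinv y.1 y.2).2]
    · intro y hy
      have hyK : y.1 ∈ K := by
        by_contra h
        exact hy (hrK _ _ _ h)
      have : y.1 ∈ ⋃ y ∈ F, V y := by
        by_contra h
        exact hz1 ⟨y.1, ⟨hyK, h⟩, y.2⟩
      obtain ⟨y', hy', hyV⟩ := Set.mem_iUnion₂.1 this
      simp only [Finset.coe_image, Set.mem_image, Finset.mem_coe, Finset.mem_attach, true_and]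
      refine ⟨⟨y', hy'⟩, Subtype.ext ?_⟩
      change (e y').symm z = y.1
      have hzy : (e y').symm z = (e y').symm (e y' y.1) := by rw [heφ', y.2]
      rw [hzy, (e y').left_inv hyV.2]
  simp only [lift, key]

end EtaleSheaf

/-! ### Étale groupoids, their nerves and their sheaves -/

/-- An étale topological groupoid with space of objects `O` and space of arrows `A`. An arrow `g`
goes from `src g` to `rng g`; the product `mul g h` is meaningful only if `src g = rng h`. -/
structure EtaleGroupoid (O A : Type u) [TopologicalSpace O] [TopologicalSpace A] where
  rng : A → O
  src : A → O
  unit : O → A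
  mul : A → A → A
  inv : A → A
  rng_unit : ∀ x, rng (unit x) = x
  src_unit : ∀ x, src (unit x) = x
  rng_mul : ∀ g h, src g = rng h → rng (mul g h) = rng g
  src_mul : ∀ g h, src g = rng h → src (mul g h) = src h
  mul_assoc : ∀ g h k, src g = rng h → src h = rng k → mul (mul g h) k = mul g (mul h k)
  unit_mul : ∀ g, mul (unit (rng g)) g = g
  mul_unit : ∀ g, mul g (unit (src g)) = g
  rng_inv : ∀ g, rng (inv g) = src g
  src_inv : ∀ g, src (inv g) = rng g
  inv_mul : ∀ g, mul (inv g) g = unit (src g)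
  mul_inv : ∀ g, mul g (inv g) = unit (rng g)
  continuous_unit : Continuous unit
  continuous_inv : Continuous inv
  continuous_mul : Continuous fun p : {p : A × A // src p.1 = rng p.2} => mul p.1.1 p.1.2
  isLocalHomeomorph_rng : IsLocalHomeomorph rng
  isLocalHomeomorph_src : IsLocalHomeomorph src

namespace EtaleGroupoid

variable {O A : Type u} [TopologicalSpace O] [TopologicalSpace A] (𝒢 : EtaleGroupoid O A)

/-- A `𝒢`-sheaf: a sheaf on the object space with a continuous action of `𝒢` by group
homomorphisms on its étale space. An arrow `g : x → y` acts as a map from the stalk at `x` to the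
stalk at `y`; continuity is continuity on the fibre product of `A` and the étale space over `O`
(given the subspace topology). -/
structure Sheaf extends EtaleSheaf O where
  act : ∀ (g : A) {x y : O}, 𝒢.src g = x → 𝒢.rng g = y → stalk x →+ stalk y
  act_unit : ∀ (x : O) (e : stalk x), act (𝒢.unit x) (𝒢.src_unit x) (𝒢.rng_unit x) e = e
  act_mul : ∀ (g h : A) {x y z : O} (hx : 𝒢.src h = x) (hy : 𝒢.rng h = y) (hy' : 𝒢.src g = y)
    (hz : 𝒢.rng g = z) (e : stalk x),
    act (𝒢.mul g h) ((𝒢.src_mul g h (hy'.trans hy.symm)).trans hx)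
      ((𝒢.rng_mul g h (hy'.trans hy.symm)).trans hz) e = act g hy' hz (act h hx hy e)
  continuous_act : Continuous[TopologicalSpace.induced
      (fun p : (g : A) × stalk (𝒢.src g) => ((p.1, ⟨𝒢.src p.1, p.2⟩) : A × EtalePoint stalk))
      inferInstance, top]
    (fun p : (g : A) × stalk (𝒢.src g) =>
      (⟨𝒢.rng p.1, act p.1 rfl rfl p.2⟩ : EtalePoint stalk))

/-- The space `𝒢^(n)` of composable strings `x₀ ← x₁ ← ⋯ ← xₙ`, with the subspace topology;
`p.1.1 i` is the object `xᵢ` and `p.1.2 i` is the arrow `xᵢ ← xᵢ₊₁`. -/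
def Strings (n : ℕ) : Type u :=
  {p : (Fin (n + 1) → O) × (Fin n → A) //
    ∀ i : Fin n, 𝒢.rng (p.2 i) = p.1 i.castSucc ∧ 𝒢.src (p.2 i) = p.1 i.succ}

instance (n : ℕ) : TopologicalSpace (𝒢.Strings n) := inferInstanceAs (TopologicalSpace (Subtype _))

instance (n : ℕ) [T2Space O] [T2Space A] : T2Space (𝒢.Strings n) :=
  inferInstanceAs (T2Space (Subtype _))

variable {𝒢}

namespace Strings

variable {n : ℕ}

/-- The objects of a composable string. -/
def obj (σ : 𝒢.Strings n) (i : Fin (n + 1)) : O := σ.1.1 i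

/-- The arrows of a composable string. -/
def arr (σ : 𝒢.Strings n) (i : Fin n) : A := σ.1.2 i

theorem rng_arr (σ : 𝒢.Strings n) (i : Fin n) : 𝒢.rng (σ.arr i) = σ.obj i.castSucc := (σ.2 i).1

theorem src_arr (σ : 𝒢.Strings n) (i : Fin n) : 𝒢.src (σ.arr i) = σ.obj i.succ := (σ.2 i).2

theorem rng_arr' (σ : 𝒢.Strings n) (j : ℕ) (hj : j < n) :
    𝒢.rng (σ.arr ⟨j, hj⟩) = σ.obj ⟨j, by omega⟩ := σ.rng_arr _

theorem src_arr' (σ : 𝒢.Strings n) (j : ℕ) (hj : j < n) :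
    𝒢.src (σ.arr ⟨j, hj⟩) = σ.obj ⟨j + 1, by omega⟩ := σ.src_arr _

theorem continuous_obj (i : Fin (n + 1)) : Continuous fun σ : 𝒢.Strings n => σ.obj i :=
  (continuous_apply i).comp (continuous_fst.comp continuous_subtype_val)

theorem continuous_arr (i : Fin n) : Continuous fun σ : 𝒢.Strings n => σ.arr i :=
  (continuous_apply i).comp (continuous_snd.comp continuous_subtype_val)

@[ext]
theorem ext {σ σ' : 𝒢.Strings n} (h : ∀ i, σ.obj i = σ'.obj i) (h' : ∀ i, σ.arr i = σ'.arr i) :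
    σ = σ' := Subtype.ext (Prod.ext (funext h) (funext h'))

/-- The face map `dᵢ : 𝒢^(n+1) → 𝒢^(n)`: it omits `xᵢ`, and composes the two arrows adjacent to
`xᵢ` if `0 < i < n + 1`. -/
def face (i : Fin (n + 2)) (σ : 𝒢.Strings (n + 1)) : 𝒢.Strings n :=
  ⟨(fun j => σ.obj (i.succAbove j), fun j =>
      if (j : ℕ) + 1 < i then σ.arr j.castSucc
      else if (j : ℕ) + 1 = i then 𝒢.mul (σ.arr j.castSucc) (σ.arr j.succ)
      else σ.arr j.succ), by
    intro j
    have hc : 𝒢.src (σ.arr j.castSucc) = 𝒢.rng (σ.arr j.succ) := by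
      rw [σ.src_arr, σ.rng_arr, Fin.succ_castSucc]
    dsimp only
    split_ifs with h1 h2
    · rw [σ.rng_arr, σ.src_arr, Fin.succAbove_of_castSucc_lt, Fin.succAbove_of_castSucc_lt]
      · exact ⟨rfl, by rw [Fin.succ_castSucc]⟩
      · simpa [Fin.lt_def] using h1
      · simp only [Fin.lt_def, Fin.val_castSucc]; omega
    · rw [𝒢.rng_mul _ _ hc, 𝒢.src_mul _ _ hc, σ.rng_arr, σ.src_arr,
        Fin.succAbove_of_castSucc_lt, Fin.succAbove_of_le_castSucc]
      · exact ⟨rfl, rfl⟩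
      · simp only [Fin.le_def, Fin.val_castSucc, Fin.val_succ]; omega
      · simp only [Fin.lt_def, Fin.val_castSucc]; omega
    · rw [σ.rng_arr, σ.src_arr, Fin.succAbove_of_le_castSucc, Fin.succAbove_of_le_castSucc]
      · exact ⟨by rw [Fin.succ_castSucc], rfl⟩
      · simp only [Fin.le_def, Fin.val_castSucc, Fin.val_succ]; omega
      · simp only [Fin.le_def, Fin.val_castSucc]; omega⟩

theorem obj_face (i : Fin (n + 2)) (σ : 𝒢.Strings (n + 1)) (j : Fin (n + 1)) :
    (face i σ).obj j = σ.obj (i.succAbove j) := rfl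

theorem arr_face (i : Fin (n + 2)) (σ : 𝒢.Strings (n + 1)) (j : Fin n) :
    (face i σ).arr j = if (j : ℕ) + 1 < i then σ.arr j.castSucc
      else if (j : ℕ) + 1 = i then 𝒢.mul (σ.arr j.castSucc) (σ.arr j.succ)
      else σ.arr j.succ := rfl

theorem continuous_face (i : Fin (n + 2)) : Continuous (face i : 𝒢.Strings (n + 1) → _) := by
  refine Continuous.subtype_mk (Continuous.prodMk ?_ ?_) _
  · exact continuous_pi fun j => continuous_obj _
  · refine continuous_pi fun j => ?_
    split_ifs
    · exact continuous_arr _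
    · have hc : ∀ σ : 𝒢.Strings (n + 1),
          𝒢.src (σ.arr j.castSucc) = 𝒢.rng (σ.arr j.succ) := fun σ => by
        rw [σ.src_arr, σ.rng_arr, Fin.succ_castSucc]
      exact 𝒢.continuous_mul.comp
        (((continuous_arr j.castSucc).prodMk (continuous_arr j.succ)).subtype_mk hc)
    · exact continuous_arr _

/-- The map `τₙ : 𝒢^(n) → 𝒢^(0)` sending `x₀ ← ⋯ ← xₙ` to `x₀`. -/
def τ (𝒢 : EtaleGroupoid O A) (n : ℕ) : C(𝒢.Strings n, O) := ⟨fun σ => σ.obj 0, continuous_obj 0⟩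

/-- A point of the object space, as a string of length zero. -/
def ofObj (𝒢 : EtaleGroupoid O A) (x : O) : 𝒢.Strings 0 :=
  ⟨(fun _ => x, fun i => i.elim0), fun i => i.elim0⟩

end Strings

/-- The projection of a fibre product along a local homeomorphism is a local homeomorphism. -/
theorem isLocalHomeomorph_pullback {B Y Z W : Type*} [TopologicalSpace B] [TopologicalSpace Y]
    [TopologicalSpace Z] [TopologicalSpace W] {f : Y → B} {h : Z → B} {p : W → Y} {q : W → Z}
    (hf : Continuous f) (hh : IsLocalHomeomorph h)
    (hpq : IsInducing fun w => (p w, q w)) (hcomm : ∀ w, f (p w) = h (q w))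
    (hex : ∀ y z, f y = h z → ∃ w, p w = y ∧ q w = z)
    (hinj : ∀ w w', p w = p w' → q w = q w' → w = w') : IsLocalHomeomorph p := by
  have hp : Continuous p := continuous_fst.comp hpq.continuous
  have hq : Continuous q := continuous_snd.comp hpq.continuous
  intro w
  obtain ⟨e, he, rfl⟩ := hh (q w)
  have hk : ∀ y : Y, f y ∈ e.target → ∃ w, p w = y ∧ q w = e.symm (f y) := fun y hy =>
    hex y _ (e.right_inv hy).symm
  classical
  let k : Y → W := fun y => if hy : f y ∈ e.target then (hk y hy).choose else w
  have hk1 : ∀ y, f y ∈ e.target → p (k y) = y ∧ q (k y) = e.symm (f y) := fun y hy => by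
    simp only [k, dif_pos hy]
    exact (hk y hy).choose_spec
  refine ⟨{ toFun := p
            invFun := k
            source := q ⁻¹' e.source
            target := f ⁻¹' e.target
            map_source' := ?_
            map_target' := ?_
            left_inv' := ?_
            right_inv' := ?_
            open_source := e.open_source.preimage hq
            open_target := e.open_target.preimage hf
            continuousOn_toFun := hp.continuousOn
            continuousOn_invFun := ?_ }, he, rfl⟩
  · intro w' hw'
    change f (p w') ∈ e.target
    rw [hcomm]
    exact e.map_source hw'
  · intro y hy
    change q (k y) ∈ e.source
    rw [(hk1 y hy).2]
    exact e.map_target hy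
  · intro w' hw'
    have hy : f (p w') ∈ e.target := by
      rw [hcomm]
      exact e.map_source hw'
    refine hinj _ _ (hk1 _ hy).1 ?_
    rw [(hk1 _ hy).2, hcomm, e.left_inv hw']
  · intro y hy
    exact (hk1 y hy).1
  · rw [hpq.continuousOn_iff]
    have h1 : ContinuousOn (fun y => (y, e.symm (f y))) (f ⁻¹' e.target) :=
      continuousOn_id.prodMk (e.continuousOn_symm.comp hf.continuousOn fun y hy => hy)
    refine h1.congr fun y hy => ?_
    simp only [Function.comp]
    rw [(hk1 y hy).1, (hk1 y hy).2]

namespace Strings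

variable {n : ℕ}

/-- Prepend an arrow to a composable string. -/
def cons (g : A) (σ : 𝒢.Strings n) (h : 𝒢.src g = σ.obj 0) : 𝒢.Strings (n + 1) :=
  ⟨(Fin.cons (𝒢.rng g) σ.obj, Fin.cons g σ.arr), by
    intro i
    refine Fin.cases ?_ (fun j => ?_) i
    · exact ⟨rfl, by simpa using h⟩
    · have := σ.rng_arr j
      have := σ.src_arr j
      simp only [Fin.cons_succ, ← Fin.succ_castSucc]
      exact ⟨σ.rng_arr j, σ.src_arr j⟩⟩

theorem obj_face_zero (σ : 𝒢.Strings (n + 1)) (i : Fin (n + 1)) :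
    (face 0 σ).obj i = σ.obj i.succ := by
  rw [obj_face, Fin.succAbove_zero]

theorem arr_face_zero (σ : 𝒢.Strings (n + 1)) (i : Fin n) :
    (face 0 σ).arr i = σ.arr i.succ := by
  rw [arr_face]
  simp

theorem isInducing_arr_face :
    IsInducing fun σ : 𝒢.Strings (n + 1) => (σ.arr 0, face 0 σ) := by
  refine ⟨le_antisymm (Continuous.prodMk (continuous_arr 0) (continuous_face 0)).le_induced ?_⟩
  let t : TopologicalSpace (𝒢.Strings (n + 1)) :=
    TopologicalSpace.induced (fun σ => (σ.arr 0, face 0 σ)) inferInstance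
  have h0 : Continuous[t, _] fun σ : 𝒢.Strings (n + 1) => (σ.arr 0, face 0 σ) :=
    continuous_induced_dom
  have h1 : Continuous[t, _] fun σ : 𝒢.Strings (n + 1) => σ.arr 0 :=
    @Continuous.fst _ _ _ t _ _ _ h0
  have h2 : Continuous[t, _] fun σ : 𝒢.Strings (n + 1) => face 0 σ :=
    @Continuous.snd _ _ _ t _ _ _ h0
  have hobj : ∀ i, Continuous[t, _] fun σ : 𝒢.Strings (n + 1) => σ.obj i := by
    intro i
    refine Fin.cases ?_ (fun j => ?_) i
    · have : (fun σ : 𝒢.Strings (n + 1) => σ.obj 0) = fun σ => 𝒢.rng (σ.arr 0) :=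
        funext fun σ => (σ.rng_arr 0).symm
      rw [this]
      exact @Continuous.comp _ _ _ t _ _ _ _ 𝒢.isLocalHomeomorph_rng.continuous h1
    · have : (fun σ : 𝒢.Strings (n + 1) => σ.obj j.succ) = fun σ => (face 0 σ).obj j :=
        funext fun σ => (obj_face_zero σ j).symm
      rw [this]
      exact @Continuous.comp _ _ _ t _ _ _ _ (continuous_obj j) h2
  have harr : ∀ i, Continuous[t, _] fun σ : 𝒢.Strings (n + 1) => σ.arr i := by
    intro i
    refine Fin.cases h1 (fun j => ?_) i
    have : (fun σ : 𝒢.Strings (n + 1) => σ.arr j.succ) = fun σ => (face 0 σ).arr j :=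
      funext fun σ => (arr_face_zero σ j).symm
    rw [this]
    exact @Continuous.comp _ _ _ t _ _ _ _ (continuous_arr j) h2
  have hval : Continuous[t, _] fun σ : 𝒢.Strings (n + 1) => σ.1 :=
    @Continuous.prodMk _ _ _ _ _ t _ _ (@continuous_pi _ _ _ t _ _ hobj)
      (@continuous_pi _ _ _ t _ _ harr)
  exact continuous_iff_le_induced.1 hval

theorem eq_of_arr_face {σ σ' : 𝒢.Strings (n + 1)} (h : σ.arr 0 = σ'.arr 0)
    (h' : face 0 σ = face 0 σ') : σ = σ' := by
  ext i
  · refine Fin.cases ?_ (fun j => ?_) i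
    · rw [← Fin.castSucc_zero, ← σ.rng_arr, ← σ'.rng_arr, h]
    · rw [← obj_face_zero, ← obj_face_zero, h']
  · refine Fin.cases h (fun j => ?_) i
    rw [← arr_face_zero, ← arr_face_zero, h']

theorem exists_arr_face (g : A) (σ : 𝒢.Strings n) (h : 𝒢.src g = σ.obj 0) :
    ∃ σ' : 𝒢.Strings (n + 1), σ'.arr 0 = g ∧ face 0 σ' = σ := by
  refine ⟨cons g σ h, rfl, ?_⟩
  ext i
  · rw [obj_face_zero]; rfl
  · rw [arr_face_zero]; rfl

theorem obj_zero_face_zero (σ : 𝒢.Strings (n + 1)) : 𝒢.src (σ.arr 0) = (face 0 σ).obj 0 := by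
  rw [obj_face_zero, σ.src_arr]

theorem isLocalHomeomorph_τ (n : ℕ) : IsLocalHomeomorph (τ 𝒢 n) := by
  induction n with
  | zero =>
    have hinj : Function.Injective (τ 𝒢 0) := fun σ σ' h => by
      ext i
      · rw [show i = 0 from Fin.fin_one_eq_zero i]; exact h
      · exact i.elim0
    have hofObj : Continuous (ofObj 𝒢) := by
      refine Continuous.subtype_mk (Continuous.prodMk ?_ ?_) _
      · exact continuous_pi fun _ => continuous_id
      · exact continuous_pi fun i => i.elim0
    let e : 𝒢.Strings 0 ≃ₜ O :=
      { toFun := τ 𝒢 0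
        invFun := ofObj 𝒢
        left_inv := fun σ => hinj rfl
        right_inv := fun _ => rfl
        continuous_toFun := (τ 𝒢 0).continuous
        continuous_invFun := hofObj }
    exact e.isLocalHomeomorph
  | succ n ih =>
    have h1 : IsLocalHomeomorph fun σ : 𝒢.Strings (n + 1) => σ.arr 0 :=
      isLocalHomeomorph_pullback 𝒢.isLocalHomeomorph_src.continuous ih isInducing_arr_face
        obj_zero_face_zero exists_arr_face fun _ _ => eq_of_arr_face
    have h2 : (τ 𝒢 (n + 1) : 𝒢.Strings (n + 1) → O) = 𝒢.rng ∘ fun σ => σ.arr 0 :=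
      funext fun σ => (σ.rng_arr 0).symm
    rw [h2]
    exact 𝒢.isLocalHomeomorph_rng.comp h1

theorem isLocalHomeomorph_face (i : Fin (n + 2)) :
    IsLocalHomeomorph (face i : 𝒢.Strings (n + 1) → 𝒢.Strings n) := by
  by_cases hi : i = 0
  · subst hi
    have hind : IsInducing fun σ : 𝒢.Strings (n + 1) => (face 0 σ, σ.arr 0) :=
      (Homeomorph.prodComm _ _).isInducing.comp isInducing_arr_face
    exact isLocalHomeomorph_pullback (f := τ 𝒢 n) (h := 𝒢.src) (continuous_obj 0)
      𝒢.isLocalHomeomorph_src hind (fun σ => (obj_zero_face_zero σ).symm)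
      (fun σ g h => by
        obtain ⟨σ', h1, h2⟩ := exists_arr_face g σ h.symm
        exact ⟨σ', h2, h1⟩) fun _ _ h h' => eq_of_arr_face h' h
  · refine IsLocalHomeomorph.of_comp (g := τ 𝒢 n) ?_ (isLocalHomeomorph_τ n) (continuous_face i)
    have : (τ 𝒢 n ∘ face i : 𝒢.Strings (n + 1) → O) = τ 𝒢 (n + 1) := by
      funext σ
      change σ.obj (i.succAbove 0) = σ.obj 0
      rw [Fin.succAbove_ne_zero_zero hi]
    rw [this]
    exact isLocalHomeomorph_τ _

/-- The arrow from `x₀` to the initial object of `dᵢ(x₀ ← ⋯ ← xₙ₊₁)` by which germs at `x₀` are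
transported: the inverse of the first arrow `x₀ ← x₁` if `i = 0`, and the unit at `x₀` if `i ≠ 0`. -/
def carrier (i : Fin (n + 2)) (σ : 𝒢.Strings (n + 1)) : A :=
  if i = 0 then 𝒢.inv (σ.arr 0) else 𝒢.unit (σ.obj 0)

theorem src_carrier (i : Fin (n + 2)) (σ : 𝒢.Strings (n + 1)) :
    𝒢.src (carrier i σ) = τ 𝒢 (n + 1) σ := by
  unfold carrier
  split_ifs with h
  · rw [𝒢.src_inv, σ.rng_arr]; rfl
  · exact 𝒢.src_unit _

theorem rng_carrier (i : Fin (n + 2)) (σ : 𝒢.Strings (n + 1)) :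
    𝒢.rng (carrier i σ) = τ 𝒢 n (face i σ) := by
  unfold carrier
  split_ifs with h
  · subst h
    rw [𝒢.rng_inv, obj_zero_face_zero]; rfl
  · rw [𝒢.rng_unit]
    change σ.obj 0 = σ.obj (i.succAbove 0)
    rw [Fin.succAbove_ne_zero_zero h]

theorem continuous_carrier (i : Fin (n + 2)) :
    Continuous (carrier i : 𝒢.Strings (n + 1) → A) := by
  unfold carrier
  split_ifs
  · exact 𝒢.continuous_inv.comp (continuous_arr 0)
  · exact 𝒢.continuous_unit.comp (continuous_obj 0)

/-- The simplicial identity for the face maps. -/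
theorem face_face {i j : Fin (n + 2)} (h : i ≤ j) (σ : 𝒢.Strings (n + 2)) :
    face i (face j.succ σ) = face j (face i.castSucc σ) := by
  ext k
  · simp only [obj_face]
    congr 1
    rcases i with ⟨i, _⟩
    rcases j with ⟨j, _⟩
    rcases k with ⟨k, _⟩
    simp only [Fin.succAbove]
    split_ifs <;> · simp at * <;> lia
  · have hc : 𝒢.src (σ.arr k.castSucc.castSucc) = 𝒢.rng (σ.arr k.castSucc.succ) := by
      rw [σ.src_arr, σ.rng_arr, Fin.succ_castSucc]
    have hc' : 𝒢.src (σ.arr k.castSucc.succ) = 𝒢.rng (σ.arr k.succ.succ) := by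
      rw [σ.src_arr, σ.rng_arr, Fin.succ_castSucc, Fin.succ_castSucc]
    have hm := 𝒢.mul_assoc _ _ _ hc hc'
    have hs : k.succ.castSucc = k.castSucc.succ := (Fin.succ_castSucc k).symm
    have h' : (i : ℕ) ≤ j := h
    simp only [arr_face, Fin.val_castSucc, Fin.val_succ, hs]
    split_ifs <;> first | rfl | exact hm | exact hm.symm | (exfalso; omega)

end Strings
end EtaleGroupoid

/-! ### Integration along the fibres and the Crainic–Moerdijk bar complex -/

theorem finsum_fiberwise {α β M : Type*} [AddCommMonoid M] {f : α → M}
    (hf : (Function.support f).Finite) (p : α → β) :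
    ∑ᶠ a, f a = ∑ᶠ b, ∑ᶠ a : {a // p a = b}, f a.1 := by
  classical
  have hin : ∀ b, ∑ᶠ a : {a // p a = b}, f a.1 = ∑ a ∈ hf.toFinset with p a = b, f a := by
    intro b
    rw [finsum_subtype_eq_finsum_cond (f := f) (fun a => p a = b)]
    refine finsum_cond_eq_sum_of_cond_iff _ fun {a} ha => ?_
    simp [ha]
  simp_rw [hin]
  rw [finsum_eq_sum_of_support_subset (s := hf.toFinset.image p)]
  · rw [finsum_eq_sum _ hf]
    exact (Finset.sum_fiberwise_of_maps_to (fun a ha => Finset.mem_image_of_mem p ha) _).symm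
  · intro b hb
    by_contra hcon
    refine hb (Finset.sum_eq_zero fun a ha => ?_)
    rw [Finset.mem_filter] at ha
    exact absurd (Finset.mem_coe.2 (ha.2 ▸ Finset.mem_image_of_mem p ha.1)) hcon

namespace EtaleGroupoid

variable {O A : Type u} [TopologicalSpace O] [TopologicalSpace A] {𝒢 : EtaleGroupoid O A}

theorem eq_inv_of_mul_eq_unit {a b : A} (h : 𝒢.src a = 𝒢.rng b)
    (hab : 𝒢.mul a b = 𝒢.unit (𝒢.src b)) : a = 𝒢.inv b := by
  rw [← 𝒢.mul_unit a, h, ← 𝒢.mul_inv b, ← 𝒢.mul_assoc _ _ _ h (𝒢.rng_inv b).symm, hab,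
    ← 𝒢.rng_inv b, 𝒢.unit_mul]

theorem inv_mul_rev {g h : A} (hgh : 𝒢.src g = 𝒢.rng h) :
    𝒢.mul (𝒢.inv h) (𝒢.inv g) = 𝒢.inv (𝒢.mul g h) := by
  have h1 : 𝒢.src (𝒢.inv h) = 𝒢.rng (𝒢.inv g) := by rw [𝒢.src_inv, 𝒢.rng_inv, hgh]
  apply eq_inv_of_mul_eq_unit
  · rw [𝒢.src_mul _ _ h1, 𝒢.src_inv, 𝒢.rng_mul _ _ hgh]
  · rw [𝒢.mul_assoc _ _ _ h1 (by rw [𝒢.src_inv, 𝒢.rng_mul _ _ hgh]),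
      ← 𝒢.mul_assoc _ _ _ (𝒢.src_inv g) hgh, 𝒢.inv_mul, hgh, 𝒢.unit_mul, 𝒢.inv_mul,
      𝒢.src_mul _ _ hgh]

namespace Sheaf

variable {Y Z W : Type u} [TopologicalSpace Y] [TopologicalSpace Z] [TopologicalSpace W]
  (S : 𝒢.Sheaf)

/-- Summation over the fibres of `φ : Y → Z`, where the germ at `τY y` is transported to a germ at
`τZ (φ y)` by the action of the arrow `κ y`. -/
noncomputable def pushFun (φ : Y → Z) (κ : Y → A) (τY : Y → O) (τZ : Z → O)
    (hs : ∀ y, 𝒢.src (κ y) = τY y) (hr : ∀ y, 𝒢.rng (κ y) = τZ (φ y))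
    (t : ∀ y, S.stalk (τY y)) (z : Z) : S.stalk (τZ z) :=
  ∑ᶠ y : {y // φ y = z}, S.act (κ y.1) (hs y.1) ((hr y.1).trans (congrArg τZ y.2)) (t y.1)

theorem finite_support_push [T2Space Z] {φ : Y → Z} (hφ : IsLocalHomeomorph φ) (τY : C(Y, O))
    {t : ∀ y, S.stalk (τY y)} (ht : t ∈ S.Γc τY) (z : Z) {M : Type*} [AddCommMonoid M]
    (f : ∀ y, S.stalk (τY y) → φ y = z → M) (hf : ∀ y h, f y 0 h = 0) :
    (Function.support fun y : {y // φ y = z} => f y.1 (t y.1) y.2).Finite := by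
  obtain ⟨-, K, hK, htK⟩ := ht
  refine ((EtaleSheaf.finite_fiber_inter hφ hK z).preimage
    (f := (Subtype.val : {y // φ y = z} → Y)) Subtype.val_injective.injOn).subset ?_
  intro y hy
  refine ⟨y.2, ?_⟩
  by_contra h
  exact hy (by simp only [htK y.1 h, hf])

theorem continuous_lift_act (κ : Y → A) (hκ : Continuous κ) (τY τY' : Y → O)
    (hs : ∀ y, 𝒢.src (κ y) = τY y) (hr : ∀ y, 𝒢.rng (κ y) = τY' y) {t : ∀ y, S.stalk (τY y)}
    (ht : Continuous (S.lift τY t)) :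
    Continuous (S.lift τY' fun y => S.act (κ y) (hs y) (hr y) (t y)) := by
  obtain rfl : (fun y => 𝒢.src (κ y)) = τY := funext hs
  obtain rfl : (fun y => 𝒢.rng (κ y)) = τY' := funext hr
  let _ : TopologicalSpace ((g : A) × S.stalk (𝒢.src g)) := TopologicalSpace.induced
      (fun p : (g : A) × S.stalk (𝒢.src g) =>
        ((p.1, ⟨𝒢.src p.1, p.2⟩) : A × EtalePoint S.stalk)) inferInstance
  have h1 : Continuous fun y => (⟨κ y, t y⟩ : (g : A) × S.stalk (𝒢.src g)) :=
    continuous_induced_rng.2 (hκ.prodMk ht)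
  exact S.continuous_act.comp h1

/-- The map on compactly supported sections given by `pushFun`, for a local homeomorphism `φ`. -/
noncomputable def push [T2Space Y] [T2Space Z] {φ : Y → Z} (hφ : IsLocalHomeomorph φ)
    {κ : Y → A} (hκ : Continuous κ) (τY : C(Y, O)) (τZ : C(Z, O))
    (hs : ∀ y, 𝒢.src (κ y) = τY y) (hr : ∀ y, 𝒢.rng (κ y) = τZ (φ y)) :
    S.Γc τY →+ S.Γc τZ where
  toFun t := ⟨S.pushFun φ κ τY τZ hs hr t, by
    obtain ⟨ht, K, hK, htK⟩ := t.2
    refine ⟨?_, φ '' K, hK.image hφ.continuous, fun z hz => ?_⟩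
    · refine S.continuous_lift_finsum hφ τZ.continuous
        (fun y z h => S.act (κ y) (hs y) ((hr y).trans (congrArg τZ h)) (t.1 y)) ?_ hK ?_
      · exact S.continuous_lift_act κ hκ τY _ hs hr ht
      · intro y z h hy
        rw [htK y hy, map_zero]
    · refine finsum_eq_zero_of_forall_eq_zero fun y => ?_
      rw [htK y.1 (fun h => hz ⟨y.1, h, y.2⟩), map_zero]⟩
  map_zero' := by
    ext z
    refine finsum_eq_zero_of_forall_eq_zero fun y => ?_
    exact map_zero _
  map_add' t t' := by
    ext z
    refine (finsum_congr fun y => map_add _ _ _).trans (finsum_add_distrib ?_ ?_)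
    · exact S.finite_support_push hφ τY t.2 z (fun y e h =>
        S.act (κ y) (hs y) ((hr y).trans (congrArg τZ h)) e) fun _ _ => map_zero _
    · exact S.finite_support_push hφ τY t'.2 z (fun y e h =>
        S.act (κ y) (hs y) ((hr y).trans (congrArg τZ h)) e) fun _ _ => map_zero _

set_option linter.unusedSectionVars false in
theorem pushFun_congr {φ φ' : Y → Z} {κ κ' : Y → A} (hφ : φ = φ') (hκ : κ = κ') (τY : Y → O)
    (τZ : Z → O) (hs : ∀ y, 𝒢.src (κ y) = τY y) (hr : ∀ y, 𝒢.rng (κ y) = τZ (φ y))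
    (hs' : ∀ y, 𝒢.src (κ' y) = τY y) (hr' : ∀ y, 𝒢.rng (κ' y) = τZ (φ' y)) :
    S.pushFun φ κ τY τZ hs hr = S.pushFun φ' κ' τY τZ hs' hr' := by
  subst hφ hκ
  rfl

theorem pushFun_pushFun [T2Space Z] [T2Space W] {φ : Y → Z} (hφ : IsLocalHomeomorph φ)
    {κ : Y → A} (τY : C(Y, O)) (τZ : C(Z, O)) (hs : ∀ y, 𝒢.src (κ y) = τY y)
    (hr : ∀ y, 𝒢.rng (κ y) = τZ (φ y)) {ψ : Z → W} (hψ : IsLocalHomeomorph ψ) {lam : Z → A}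
    (τW : C(W, O)) (hs' : ∀ z, 𝒢.src (lam z) = τZ z) (hr' : ∀ z, 𝒢.rng (lam z) = τW (ψ z))
    (hs'' : ∀ y, 𝒢.src (𝒢.mul (lam (φ y)) (κ y)) = τY y)
    (hr'' : ∀ y, 𝒢.rng (𝒢.mul (lam (φ y)) (κ y)) = τW (ψ (φ y)))
    {t : ∀ y, S.stalk (τY y)} (ht : t ∈ S.Γc τY) :
    S.pushFun ψ lam τZ τW hs' hr' (S.pushFun φ κ τY τZ hs hr t) =
      S.pushFun (fun y => ψ (φ y)) (fun y => 𝒢.mul (lam (φ y)) (κ y)) τY τW hs'' hr'' t := by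
  funext w
  let p : {y // ψ (φ y) = w} → {z // ψ z = w} := fun y => ⟨φ y.1, y.2⟩
  refine Eq.trans ?_ (Eq.symm (finsum_fiberwise (S.finite_support_push (hψ.comp hφ) τY ht w (fun y e h =>
        S.act (𝒢.mul (lam (φ y)) (κ y)) (hs'' y) ((hr'' y).trans (congrArg τW h)) e)
        fun _ _ => map_zero _) p))
  refine finsum_congr fun z => ?_
  unfold pushFun
  rw [AddMonoidHom.map_finsum _ (S.finite_support_push hφ τY ht z.1 (fun y e h =>
        S.act (κ y) (hs y) ((hr y).trans (congrArg τZ h)) e) fun _ _ => map_zero _)]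
  let e : {y : {y // ψ (φ y) = w} // p y = z} ≃ {y // φ y = z.1} :=
    { toFun := fun y => ⟨y.1.1, congrArg Subtype.val y.2⟩
      invFun := fun y => ⟨⟨y.1, by rw [y.2, z.2]⟩, Subtype.ext y.2⟩
      left_inv := fun _ => rfl
      right_inv := fun _ => rfl }
  rw [← finsum_comp_equiv e]
  refine finsum_congr fun y => ?_
  obtain ⟨⟨y, hy⟩, rfl⟩ := y
  exact (S.act_mul (lam (φ y)) (κ y) (hs y) (hr y) (hs' _) ((hr' _).trans (congrArg τW hy)) _).symm

/-- The map `δᵢ` induced by the face map `dᵢ` on compactly supported sections: it sums over the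
fibres of `dᵢ`. If `i = 0`, then germs at `x₀` are transported to germs at `x₁` by the inverse of
the first arrow `x₀ ← x₁`. -/
noncomputable def δ [T2Space O] [T2Space A] (n : ℕ) (i : Fin (n + 2)) :
    S.Γc (Strings.τ 𝒢 (n + 1)) →+ S.Γc (Strings.τ 𝒢 n) :=
  S.push (Strings.isLocalHomeomorph_face i) (Strings.continuous_carrier i) _ _
    (Strings.src_carrier i) (Strings.rng_carrier i)

theorem coe_δ [T2Space O] [T2Space A] (n : ℕ) (i : Fin (n + 2))
    (t : S.Γc (Strings.τ 𝒢 (n + 1))) :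
    (S.δ n i t).1 = S.pushFun (Strings.face i) (Strings.carrier i) (Strings.τ 𝒢 (n + 1))
      (Strings.τ 𝒢 n) (Strings.src_carrier i) (Strings.rng_carrier i) t.1 := rfl

theorem carrier_carrier {n : ℕ} {i j : Fin (n + 2)} (h : i ≤ j) (σ : 𝒢.Strings (n + 2)) :
    𝒢.mul (Strings.carrier i (Strings.face j.succ σ)) (Strings.carrier j.succ σ) =
      𝒢.mul (Strings.carrier j (Strings.face i.castSucc σ)) (Strings.carrier i.castSucc σ) := by
  have hobj : ∀ k : Fin (n + 3), k ≠ 0 → (Strings.face k σ).obj 0 = σ.obj 0 := by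
    intro k hk
    rw [Strings.obj_face, Fin.succAbove_ne_zero_zero hk]
  have hj0 : j.succ ≠ 0 := Fin.succ_ne_zero j
  by_cases hi : i = 0
  · subst hi
    have e1 : Strings.carrier (0 : Fin (n + 2)).castSucc σ = 𝒢.inv (σ.arr 0) := if_pos rfl
    have e2 : Strings.carrier j.succ σ = 𝒢.unit (σ.obj 0) := if_neg hj0
    have e3 : Strings.carrier 0 (Strings.face j.succ σ) =
      𝒢.inv ((Strings.face j.succ σ).arr 0) := if_pos rfl
    have e4 : 𝒢.mul (Strings.carrier 0 (Strings.face j.succ σ)) (𝒢.unit (σ.obj 0)) =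
        Strings.carrier 0 (Strings.face j.succ σ) := by
      have : 𝒢.src (Strings.carrier 0 (Strings.face j.succ σ)) = σ.obj 0 := by
        rw [Strings.src_carrier]
        exact hobj _ hj0
      rw [← this, 𝒢.mul_unit]
    rw [e1, e2, e4, e3, Strings.arr_face]
    by_cases hj : j = 0
    · subst hj
      have e5 : Strings.carrier 0 (Strings.face (0 : Fin (n + 2)).castSucc σ) =
        𝒢.inv ((Strings.face 0 σ).arr 0) := if_pos rfl
      rw [e5, Strings.arr_face_zero, inv_mul_rev]
      · rfl
      · rw [σ.src_arr, σ.rng_arr]; rfl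
    · have e5 : Strings.carrier j (Strings.face (0 : Fin (n + 2)).castSucc σ) =
        𝒢.unit ((Strings.face 0 σ).obj 0) := if_neg hj
      have hj' : (j : ℕ) ≠ 0 := fun h => hj (Fin.ext h)
      rw [e5, if_pos (by simp only [Fin.val_zero, Fin.val_succ]; omega),
        ← Strings.obj_zero_face_zero, ← 𝒢.rng_inv, 𝒢.unit_mul]
      rfl
  · have hj : j ≠ 0 := fun hj => hi (Fin.le_zero_iff.1 (hj ▸ h))
    have hi' : i.castSucc ≠ 0 := fun h' => hi (Fin.castSucc_eq_zero_iff.1 h')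
    have e1 : Strings.carrier i.castSucc σ = 𝒢.unit (σ.obj 0) := if_neg hi'
    have e2 : Strings.carrier j.succ σ = 𝒢.unit (σ.obj 0) := if_neg hj0
    have e3 : Strings.carrier i (Strings.face j.succ σ) = 𝒢.unit (σ.obj 0) :=
      (if_neg hi).trans (congrArg _ (hobj _ hj0))
    have e4 : Strings.carrier j (Strings.face i.castSucc σ) = 𝒢.unit (σ.obj 0) :=
      (if_neg hj).trans (congrArg _ (hobj _ hi'))
    rw [e1, e2, e3, e4]

theorem δ_δ [T2Space O] [T2Space A] {n : ℕ} {i j : Fin (n + 2)} (h : i ≤ j)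
    (t : S.Γc (Strings.τ 𝒢 (n + 2))) :
    S.δ n i (S.δ (n + 1) j.succ t) = S.δ n j (S.δ (n + 1) i.castSucc t) := by
  have key : ∀ (a : Fin (n + 2)) (b : Fin (n + 3)), ∀ σ : 𝒢.Strings (n + 2),
      𝒢.src (Strings.carrier a (Strings.face b σ)) = 𝒢.rng (Strings.carrier b σ) := by
    intro a b σ
    rw [Strings.src_carrier, Strings.rng_carrier]
  have hs : ∀ (a : Fin (n + 2)) (b : Fin (n + 3)), ∀ σ : 𝒢.Strings (n + 2),
      𝒢.src (𝒢.mul (Strings.carrier a (Strings.face b σ)) (Strings.carrier b σ)) =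
        Strings.τ 𝒢 (n + 2) σ := by
    intro a b σ
    rw [𝒢.src_mul _ _ (key a b σ), Strings.src_carrier]
  have hr : ∀ (a : Fin (n + 2)) (b : Fin (n + 3)), ∀ σ : 𝒢.Strings (n + 2),
      𝒢.rng (𝒢.mul (Strings.carrier a (Strings.face b σ)) (Strings.carrier b σ)) =
        Strings.τ 𝒢 n (Strings.face a (Strings.face b σ)) := by
    intro a b σ
    rw [𝒢.rng_mul _ _ (key a b σ), Strings.rng_carrier]
  apply Subtype.ext
  rw [coe_δ, coe_δ, coe_δ, coe_δ,
    S.pushFun_pushFun (Strings.isLocalHomeomorph_face _) _ _ _ _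
      (Strings.isLocalHomeomorph_face _) _ _ _ (hs _ _) (hr _ _) t.2,
    S.pushFun_pushFun (Strings.isLocalHomeomorph_face _) _ _ _ _
      (Strings.isLocalHomeomorph_face _) _ _ _ (hs _ _) (hr _ _) t.2]
  exact congrFun (S.pushFun_congr (funext fun σ => Strings.face_face h σ)
    (funext fun σ => carrier_carrier h σ) _ _ _ _ _ _) t.1

/-- The horizontal differential `δ = ∑ᵢ (-1)ⁱ δᵢ` of the bar complex. -/
noncomputable def barD [T2Space O] [T2Space A] (n : ℕ) :
    S.Γc (Strings.τ 𝒢 (n + 1)) →+ S.Γc (Strings.τ 𝒢 n) :=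
  ∑ i : Fin (n + 2), (-1 : ℤ) ^ (i : ℕ) • S.δ n i

theorem barD_barD [T2Space O] [T2Space A] (n : ℕ) (t : S.Γc (Strings.τ 𝒢 (n + 2))) :
    S.barD n (S.barD (n + 1) t) = 0 := by
  have h1 : S.barD n (S.barD (n + 1) t) = ∑ x : Fin (n + 2) × Fin (n + 3),
      ((-1 : ℤ) ^ (x.1 : ℕ) * (-1 : ℤ) ^ (x.2 : ℕ)) • S.δ n x.1 (S.δ (n + 1) x.2 t) := by
    rw [Fintype.sum_prod_type]
    simp only [barD, AddMonoidHom.finsetSum_apply, AddMonoidHom.coe_smul, Pi.smul_apply, map_sum,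
      map_zsmul, Finset.smul_sum, smul_smul]
    rw [Finset.sum_comm]
    simp only [mul_comm]
  rw [h1]
  let P : Finset (Fin (n + 2) × Fin (n + 3)) := {x | (x.2 : ℕ) ≤ (x.1 : ℕ)}
  rw [← Finset.sum_add_sum_compl P, ← eq_neg_iff_add_eq_zero, ← Finset.sum_neg_distrib]
  refine Finset.sum_bij (fun x hx => (Fin.castLT x.2
    (lt_of_le_of_lt (Finset.mem_filter.mp hx).right (Fin.is_lt x.1)), x.1.succ)) ?_ ?_ ?_ ?_
  · intro x hx
    simp only [P, Finset.compl_filter, Finset.mem_filter_univ, Fin.val_succ,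
      Fin.val_castLT] at hx ⊢
    omega
  · rintro ⟨i, j⟩ hij ⟨i', j'⟩ hij' h
    simp only [Prod.mk.injEq, Fin.succ_inj] at h
    have h1 := congrArg Fin.val h.1
    simp only [Fin.val_castLT] at h1
    rw [h.2, Fin.ext h1]
  · rintro ⟨i', j'⟩ hij'
    simp only [P, Finset.compl_filter, Finset.mem_filter_univ, not_le] at hij'
    have hj0 : j' ≠ 0 := by
      rintro rfl
      simp at hij'
    refine ⟨(j'.pred hj0, Fin.castSucc i'), ?_, ?_⟩
    · simp only [P, Finset.mem_filter_univ, Fin.val_castSucc, Fin.val_pred]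
      omega
    · simp
  · rintro ⟨i, j⟩ hij
    have hij' : (j : ℕ) ≤ i := by simpa [P] using hij
    have hlt : (j : ℕ) < n + 2 := lt_of_le_of_lt hij' i.2
    have hd := S.δ_δ (i := j.castLT hlt) (j := i) (Fin.le_def.2 hij') t
    simp only [Fin.castSucc_castLT] at hd
    simp only [hd, Fin.val_castLT, Fin.val_succ]
    rw [← neg_smul]
    congr 1
    ring

end Sheaf
end EtaleGroupoid

/-! ### Morphisms of sheaves, complexes of sheaves and resolutions -/

theorem isLocalHomeomorph_fst_of_discrete {Y Z : Type*} [TopologicalSpace Y] [TopologicalSpace Z]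
    [DiscreteTopology Z] : IsLocalHomeomorph (Prod.fst : Y × Z → Y) :=
  EtaleGroupoid.isLocalHomeomorph_pullback (f := fun _ : Y => PUnit.unit.{1})
    (h := fun _ : Z => PUnit.unit.{1}) (q := Prod.snd) continuous_const
    (IsCoveringMap.of_discreteTopology _).isLocalHomeomorph Topology.IsInducing.id (fun _ => rfl)
    (fun y z _ => ⟨(y, z), rfl, rfl⟩) fun _ _ h h' => Prod.ext h h'

namespace EtaleGroupoid

variable {O A : Type u} [TopologicalSpace O] [TopologicalSpace A] {𝒢 : EtaleGroupoid O A}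

namespace Sheaf

/-- A morphism of `𝒢`-sheaves. -/
structure Hom (S T : 𝒢.Sheaf) where
  app : ∀ x, S.stalk x →+ T.stalk x
  continuous_app : Continuous fun p : EtalePoint S.stalk =>
    (⟨p.base, app p.base p.germ⟩ : EtalePoint T.stalk)
  app_act : ∀ (g : A) {x y : O} (hx : 𝒢.src g = x) (hy : 𝒢.rng g = y) (e : S.stalk x),
    app y (S.act g hx hy e) = T.act g hx hy (app x e)

namespace Hom

variable {S T : 𝒢.Sheaf} (f : S.Hom T)

/-- The map on compactly supported sections of `τ^*S` induced by a morphism of sheaves. -/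
def mapΓc {Y : Type u} [TopologicalSpace Y] (τ : C(Y, O)) : S.Γc τ →+ T.Γc τ where
  toFun s := ⟨fun y => f.app (τ y) (s.1 y), by
    obtain ⟨hs, K, hK, hsK⟩ := s.2
    refine ⟨f.continuous_app.comp hs, K, hK, fun y hy => ?_⟩
    change f.app (τ y) (s.1 y) = 0
    rw [hsK y hy, map_zero]⟩
  map_zero' := Subtype.ext (funext fun y => map_zero (f.app (τ y)))
  map_add' s t := Subtype.ext (funext fun y => map_add (f.app (τ y)) (s.1 y) (t.1 y))

theorem coe_mapΓc {Y : Type u} [TopologicalSpace Y] (τ : C(Y, O)) (s : S.Γc τ) (y : Y) :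
    (f.mapΓc τ s).1 y = f.app (τ y) (s.1 y) := rfl

theorem mapΓc_δ [T2Space O] [T2Space A] (n : ℕ) (i : Fin (n + 2))
    (t : S.Γc (Strings.τ 𝒢 (n + 1))) :
    f.mapΓc _ (S.δ n i t) = T.δ n i (f.mapΓc _ t) := by
  apply Subtype.ext
  funext z
  rw [coe_mapΓc, coe_δ, coe_δ]
  unfold pushFun
  rw [AddMonoidHom.map_finsum _ (S.finite_support_push (Strings.isLocalHomeomorph_face i)
    (Strings.τ 𝒢 (n + 1)) t.2 z (fun y e h => S.act (Strings.carrier i y)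
      (Strings.src_carrier i y) ((Strings.rng_carrier i y).trans (congrArg (Strings.τ 𝒢 n) h)) e)
      fun _ _ => map_zero _)]
  exact finsum_congr fun y => f.app_act _ _ _ _

theorem mapΓc_barD [T2Space O] [T2Space A] (n : ℕ) (t : S.Γc (Strings.τ 𝒢 (n + 1))) :
    f.mapΓc _ (S.barD n t) = T.barD n (f.mapΓc _ t) := by
  simp only [barD, AddMonoidHom.finsetSum_apply, AddMonoidHom.coe_smul, Pi.smul_apply, map_sum,
    map_zsmul, mapΓc_δ]

end Hom
end Sheaf

variable (𝒢)

/-- A cochain complex of `𝒢`-sheaves in nonnegative degrees. -/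
structure SheafComplex where
  obj : ℕ → 𝒢.Sheaf
  d : ∀ q, (obj q).Hom (obj (q + 1))
  d_d : ∀ q x e, (d (q + 1)).app x ((d q).app x e) = 0

/-- A morphism of cochain complexes of `𝒢`-sheaves. -/
structure SheafComplex.Hom {𝒢 : EtaleGroupoid O A} (S T : 𝒢.SheafComplex) where
  f : ∀ q, (S.obj q).Hom (T.obj q)
  comm : ∀ q x e, (f (q + 1)).app x ((S.d q).app x e) = (T.d q).app x ((f q).app x e)

/-- The constant sheaf `𝒵` on the object space, with stalks `ℤ`: its étale space is `O × ℤ`, and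
the arrows act by the identity. -/
def constSheaf : 𝒢.Sheaf where
  stalk _ := ULift.{u} ℤ
  top := TopologicalSpace.induced (fun p => (p.base, p.germ.down)) inferInstance
  isLocalHomeomorph_base := by
    let _ : TopologicalSpace (EtalePoint fun _ : O => ULift.{u} ℤ) :=
      TopologicalSpace.induced (fun p => (p.base, p.germ.down)) inferInstance
    let e : EtalePoint (fun _ : O => ULift.{u} ℤ) ≃ₜ O × ℤ :=
      { toFun := fun p => (p.base, p.germ.down)
        invFun := fun p => ⟨p.1, ⟨p.2⟩⟩
        left_inv := fun _ => rfl
        right_inv := fun _ => rfl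
        continuous_toFun := continuous_induced_dom
        continuous_invFun := continuous_induced_rng.2 continuous_id }
    have h1 : IsLocalHomeomorph (Prod.fst : O × ℤ → O) :=
      isLocalHomeomorph_fst_of_discrete
    exact h1.comp e.isLocalHomeomorph
  continuous_sub := by
    refine continuous_induced_rng.2 ?_
    let _ : TopologicalSpace (EtalePoint fun _ : O => ULift.{u} ℤ) :=
      TopologicalSpace.induced (fun p => (p.base, p.germ.down)) inferInstance
    let _ : TopologicalSpace ((_ : O) × (ULift.{u} ℤ × ULift.{u} ℤ)) :=
      TopologicalSpace.induced (fun p => ((⟨p.1, p.2.1⟩, ⟨p.1, p.2.2⟩) :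
        EtalePoint (fun _ : O => ULift.{u} ℤ) × EtalePoint (fun _ : O => ULift.{u} ℤ)))
        inferInstance
    have h0 : Continuous fun p : (_ : O) × (ULift.{u} ℤ × ULift.{u} ℤ) =>
        ((⟨p.1, p.2.1⟩, ⟨p.1, p.2.2⟩) :
          EtalePoint (fun _ : O => ULift.{u} ℤ) × EtalePoint (fun _ : O => ULift.{u} ℤ)) :=
      continuous_induced_dom
    have h1 : Continuous fun p : EtalePoint (fun _ : O => ULift.{u} ℤ) => (p.base, p.germ.down) :=
      continuous_induced_dom
    have ha := h1.comp (continuous_fst.comp h0)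
    have hb := h1.comp (continuous_snd.comp h0)
    exact (continuous_fst.comp ha).prodMk
      (Continuous.sub (continuous_snd.comp ha) (continuous_snd.comp hb))
  act _ _ _ _ _ := AddMonoidHom.id _
  act_unit _ _ := rfl
  act_mul _ _ _ _ _ _ _ _ _ _ := rfl
  continuous_act := by
    refine continuous_induced_rng.2 ?_
    let _ : TopologicalSpace (EtalePoint fun _ : O => ULift.{u} ℤ) :=
      TopologicalSpace.induced (fun p => (p.base, p.germ.down)) inferInstance
    let _ : TopologicalSpace ((_ : A) × ULift.{u} ℤ) := TopologicalSpace.induced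
      (fun p => ((p.1, ⟨𝒢.src p.1, p.2⟩) : A × EtalePoint (fun _ : O => ULift.{u} ℤ)))
        inferInstance
    have h0 : Continuous fun p : (_ : A) × ULift.{u} ℤ =>
        ((p.1, ⟨𝒢.src p.1, p.2⟩) : A × EtalePoint (fun _ : O => ULift.{u} ℤ)) :=
      continuous_induced_dom
    have h1 : Continuous fun p : EtalePoint (fun _ : O => ULift.{u} ℤ) => (p.base, p.germ.down) :=
      continuous_induced_dom
    exact (𝒢.isLocalHomeomorph_rng.continuous.comp (continuous_fst.comp h0)).prodMk
      (continuous_snd.comp (h1.comp (continuous_snd.comp h0)))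

/-- A resolution `0 → A → S⁰ → S¹ → ⋯` of a `𝒢`-sheaf by `c`-soft `𝒢`-sheaves; exactness is
exactness on stalks. -/
structure CSoftResolution (F : 𝒢.Sheaf) extends 𝒢.SheafComplex where
  isCSoft : ∀ q, (obj q).IsCSoft
  ε : F.Hom (obj 0)
  injective_ε : ∀ x, Function.Injective (ε.app x)
  exact_zero : ∀ x, Function.Exact (ε.app x) ((d 0).app x)
  exact_succ : ∀ q x, Function.Exact ((d q).app x) ((d (q + 1)).app x)

end EtaleGroupoid

/-! ### Homology of étale groupoids -/

/-- Total complexes of bicomplexes with homological first index `p ≥ 0` and cohomological second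
index `q ≥ 0`, graded homologically by `p - q`; the vertical differentials have signs `(-1)ᵖ`. -/
instance totalComplexShape :
    TotalComplexShape (ComplexShape.down ℕ) (ComplexShape.up ℕ) (ComplexShape.down ℤ) where
  π i := (i.1 : ℤ) - (i.2 : ℤ)
  ε₁ _ := 1
  ε₂ i := (-1) ^ i.1
  rel₁ := by
    rintro i i' h j
    have h' : i' + 1 = i := h
    change (i' : ℤ) - j + 1 = i - j
    rw [← h']
    push_cast
    ring
  rel₂ := by
    rintro i j j' h
    have h' : j + 1 = j' := h
    change (i : ℤ) - j' + 1 = i - j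
    rw [← h']
    push_cast
    ring
  ε₂_ε₁ := by
    rintro i i' j j' h -
    have h' : i' + 1 = i := h
    rw [← h', pow_succ]
    simp

/-- The component in bidegree `(0, 0)` of an element of total degree `0`. -/
noncomputable def totalProj {k : Type} [CommRing k]
    (K : HomologicalComplex₂ (ModuleCat.{u} k) (ComplexShape.down ℕ) (ComplexShape.up ℕ)) :
    (K.total (ComplexShape.down ℤ)).X 0 ⟶ (K.X 0).X 0 :=
  K.totalDesc fun p q _ => if h : p = 0 ∧ q = 0 then (K.XXIsoOfEq _ _ _ h.1 h.2).hom else 0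

/-- The inclusion of the groups in bidegrees `(0, q)` in the total complex. -/
noncomputable def edge {k : Type} [CommRing k]
    (K : HomologicalComplex₂ (ModuleCat.{u} k) (ComplexShape.down ℕ) (ComplexShape.up ℕ))
    (q : ℕ) : (K.X 0).X q ⟶ (K.total (ComplexShape.down ℤ)).X (-(q : ℤ)) :=
  K.ιTotal (ComplexShape.down ℤ) 0 q _ (zero_sub (q : ℤ))

namespace EtaleGroupoid

variable {O A : Type u} [TopologicalSpace O] [TopologicalSpace A] {𝒢 : EtaleGroupoid O A}

namespace SheafComplex

variable [T2Space O] [T2Space A] (S T : 𝒢.SheafComplex) (f : S.Hom T)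

/-- The vertical differential `Γ_c(𝒢^(p); τ_p^*S^q) → Γ_c(𝒢^(p); τ_p^*S^(q+1))`. -/
def vert (p q : ℕ) : ModuleCat.of ℤ ((S.obj q).Γc (Strings.τ 𝒢 p)) ⟶
    ModuleCat.of ℤ ((S.obj (q + 1)).Γc (Strings.τ 𝒢 p)) :=
  ModuleCat.ofHom ((S.d q).mapΓc (Strings.τ 𝒢 p)).toIntLinearMap

/-- The horizontal differential `Γ_c(𝒢^(p+1); τ_(p+1)^*S^q) → Γ_c(𝒢^(p); τ_p^*S^q)`. -/
noncomputable def horiz (p q : ℕ) : ModuleCat.of ℤ ((S.obj q).Γc (Strings.τ 𝒢 (p + 1))) ⟶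
    ModuleCat.of ℤ ((S.obj q).Γc (Strings.τ 𝒢 p)) :=
  ModuleCat.ofHom ((S.obj q).barD p).toIntLinearMap

/-- The cochain complex `Γ_c(𝒢^(p); τ_p^*S^•)`. -/
noncomputable def column (p : ℕ) : CochainComplex (ModuleCat.{u} ℤ) ℕ :=
  CochainComplex.of (fun q => ModuleCat.of ℤ ((S.obj q).Γc (Strings.τ 𝒢 p))) (S.vert p)
    (fun q => ModuleCat.hom_ext (LinearMap.ext fun _ =>
      Subtype.ext (funext fun _ => S.d_d q _ _)))

set_option linter.unusedSectionVars false in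
theorem column_d (p q : ℕ) : (S.column p).d q (q + 1) = S.vert p q :=
  CochainComplex.of_d (fun q => ModuleCat.of ℤ ((S.obj q).Γc (Strings.τ 𝒢 p))) (S.vert p) q

/-- The horizontal differentials form a morphism of complexes. -/
noncomputable def columnD (p : ℕ) : S.column (p + 1) ⟶ S.column p :=
  CochainComplex.ofHom (X := S.column (p + 1)) (Y := S.column p) (S.horiz p) fun q => by
    rw [column_d, column_d]
    have : S.horiz p q ≫ S.vert p q = S.vert (p + 1) q ≫ S.horiz p (q + 1) :=
      ModuleCat.hom_ext (LinearMap.ext fun s => (S.d q).mapΓc_barD p s)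
    exact this

/-- The double complex `Γ_c(𝒢^(p); τ_p^*S^q)`. -/
noncomputable def barBicomplex :
    HomologicalComplex₂ (ModuleCat.{u} ℤ) (ComplexShape.down ℕ) (ComplexShape.up ℕ) :=
  ChainComplex.of S.column S.columnD (fun p => HomologicalComplex.hom_ext _ _ fun q => by
    have : S.horiz (p + 1) q ≫ S.horiz p q = 0 :=
      ModuleCat.hom_ext (LinearMap.ext fun s => (S.obj q).barD_barD p s)
    exact this)

theorem barBicomplex_d (p : ℕ) : S.barBicomplex.d (p + 1) p = S.columnD p :=
  ChainComplex.of_d S.column S.columnD p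

/-- The Crainic–Moerdijk chain complex with coefficients in a complex of sheaves `S`: the (direct
sum) total complex of the double complex `Γ_c(𝒢^(p); τ_p^*S^q)`, in degree `p - q`. -/
noncomputable def chains : ChainComplex (ModuleCat.{u} ℤ) ℤ :=
  S.barBicomplex.total (ComplexShape.down ℤ)

variable {S T}

/-- The map on `Γ_c(𝒢^(p); τ_p^*S^q)` induced by a morphism of complexes of sheaves. -/
def bidegreeMap (p q : ℕ) : ModuleCat.of ℤ ((S.obj q).Γc (Strings.τ 𝒢 p)) ⟶
    ModuleCat.of ℤ ((T.obj q).Γc (Strings.τ 𝒢 p)) :=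
  ModuleCat.ofHom ((f.f q).mapΓc (Strings.τ 𝒢 p)).toIntLinearMap

/-- The map on `Γ_c(𝒢^(p); τ_p^*S^•)` induced by a morphism of complexes of sheaves. -/
noncomputable def columnMap (p : ℕ) : S.column p ⟶ T.column p :=
  CochainComplex.ofHom (X := S.column p) (Y := T.column p) (bidegreeMap f p) fun q => by
    rw [column_d, column_d]
    have : bidegreeMap f p q ≫ T.vert p q = S.vert p q ≫ bidegreeMap f p (q + 1) :=
      ModuleCat.hom_ext (LinearMap.ext fun _ =>
        Subtype.ext (funext fun _ => (f.comm q _ _).symm))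
    exact this

/-- The morphism of double complexes induced by a morphism of complexes of sheaves. -/
noncomputable def barMap : S.barBicomplex ⟶ T.barBicomplex :=
  ChainComplex.ofHom (X := S.barBicomplex) (Y := T.barBicomplex) (columnMap f) fun p => by
    rw [barBicomplex_d, barBicomplex_d]
    refine HomologicalComplex.hom_ext _ _ fun q => ?_
    have : bidegreeMap f (p + 1) q ≫ T.horiz p q = S.horiz p q ≫ bidegreeMap f p q :=
      ModuleCat.hom_ext (LinearMap.ext fun s => ((f.f q).mapΓc_barD p s).symm)
    exact this

/-- The chain map induced by a morphism of complexes of sheaves. -/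
noncomputable def chainsMap : S.chains ⟶ T.chains :=
  HomologicalComplex₂.total.map (barMap f) (ComplexShape.down ℤ)

end SheafComplex
end EtaleGroupoid

/-! ### Transformation groupoids -/

section Transformation

variable (G X : Type u) [Group G] [TopologicalSpace G] [DiscreteTopology G] [TopologicalSpace X]
  [MulAction G X] [ContinuousConstSMul G X]

theorem continuous_smul_of_discrete : Continuous fun p : G × X => p.1 • p.2 :=
  continuous_prod_of_discrete_left.2 fun g => continuous_const_smul g

/-- The transformation groupoid `G ⋉ X` of an action of a discrete group `G`: the pair `(g, x)` is
an arrow from `x` to `g • x`. -/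
def transformationGroupoid : EtaleGroupoid X (G × X) where
  rng p := p.1 • p.2
  src p := p.2
  unit x := (1, x)
  mul p q := (p.1 * q.1, q.2)
  inv p := (p.1⁻¹, p.1 • p.2)
  rng_unit x := one_smul G x
  src_unit _ := rfl
  rng_mul p q h := by
    change p.2 = q.1 • q.2 at h
    change (p.1 * q.1) • q.2 = p.1 • p.2
    rw [h, mul_smul]
  src_mul _ _ _ := rfl
  mul_assoc p q r _ _ := Prod.ext (mul_assoc p.1 q.1 r.1) rfl
  unit_mul p := Prod.ext (one_mul p.1) rfl
  mul_unit p := Prod.ext (mul_one p.1) rfl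
  rng_inv p := inv_smul_smul p.1 p.2
  src_inv _ := rfl
  inv_mul p := Prod.ext (inv_mul_cancel p.1) rfl
  mul_inv p := Prod.ext (mul_inv_cancel p.1) rfl
  continuous_unit := by fun_prop
  continuous_inv :=
    (continuous_of_discreteTopology.comp continuous_fst).prodMk (continuous_smul_of_discrete G X)
  continuous_mul := by
    have h : Continuous fun p : G × G => p.1 * p.2 := continuous_of_discreteTopology
    fun_prop
  isLocalHomeomorph_rng := by
    let e : G × X ≃ₜ X × G :=
      { toFun := fun p => (p.1 • p.2, p.1)
        invFun := fun p => (p.2, p.2⁻¹ • p.1)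
        left_inv := fun p => Prod.ext rfl (inv_smul_smul p.1 p.2)
        right_inv := fun p => Prod.ext (smul_inv_smul p.2 p.1) rfl
        continuous_toFun := (continuous_smul_of_discrete G X).prodMk continuous_fst
        continuous_invFun := continuous_snd.prodMk ((continuous_smul_of_discrete G X).comp
          ((continuous_of_discreteTopology.comp continuous_snd).prodMk continuous_fst)) }
    exact isLocalHomeomorph_fst_of_discrete.comp e.isLocalHomeomorph
  isLocalHomeomorph_src :=
    isLocalHomeomorph_fst_of_discrete.comp (Homeomorph.prodComm G X).isLocalHomeomorph

variable {G X}

namespace EtaleGroupoid.Sheaf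

variable (S : (transformationGroupoid G X).Sheaf)

/-- The action of `g : G` on the étale space of a `G ⋉ X`-sheaf, from the stalk at `x` to the stalk
at `y = g • x`. -/
def gact (g : G) {x y : X} (h : g • x = y) : S.stalk x →+ S.stalk y := S.act (g, x) rfl h

theorem gact_section (s : ∀ x, S.stalk x) {g : G} {x x' y : X} (hx : x = x') (h : g • x = y)
    (h' : g • x' = y) : S.gact g h (s x) = S.gact g h' (s x') := by
  subst hx
  rfl

theorem gact_one {x : X} (e : S.stalk x) : S.gact 1 (one_smul G x) e = e := S.act_unit x e

theorem gact_gact (g h : G) {x y z : X} (hxy : h • x = y) (hyz : g • y = z)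
    (hxz : (g * h) • x = z) (e : S.stalk x) :
    S.gact (g * h) hxz e = S.gact g hyz (S.gact h hxy e) :=
  S.act_mul (g, y) (h, x) rfl hxy rfl hyz e

/-- The action of `g : G` on compactly supported sections:
`(g • s)(x) = g • (s (g⁻¹ • x))`. -/
def smulΓc (g : G) : S.Γc (ContinuousMap.id X) →+ S.Γc (ContinuousMap.id X) where
  toFun s := ⟨fun x => S.gact g (smul_inv_smul g x) (s.1 (g⁻¹ • x)), by
    obtain ⟨hs, K, hK, hsK⟩ := s.2
    refine ⟨?_, (fun x => g • x) '' K, hK.image (continuous_const_smul g), fun x hx => ?_⟩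
    · exact S.continuous_lift_act (fun x => (g, g⁻¹ • x))
        (continuous_const.prodMk (continuous_const_smul g⁻¹)) (fun x => g⁻¹ • x) id
        (fun _ => rfl) (fun x => smul_inv_smul g x) (t := fun x => s.1 (g⁻¹ • x))
        (hs.comp (continuous_const_smul g⁻¹))
    · have h0 : s.1 (g⁻¹ • x) = 0 := hsK _ fun h => hx ⟨_, h, smul_inv_smul g x⟩
      exact (congrArg (S.gact g (smul_inv_smul g x)) h0).trans (map_zero _)⟩
  map_zero' := Subtype.ext (funext fun x => map_zero (S.gact g (smul_inv_smul g x)))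
  map_add' s t := Subtype.ext (funext fun x =>
    map_add (S.gact g (smul_inv_smul g x)) (s.1 (g⁻¹ • x)) (t.1 (g⁻¹ • x)))

/-- The representation of `G` on `Γ_c(X; S)`, for a `G ⋉ X`-sheaf `S`. -/
def rep : Representation ℤ G (S.Γc (ContinuousMap.id X)) where
  toFun g := (S.smulΓc g).toIntLinearMap
  map_one' := by
    refine LinearMap.ext fun s => Subtype.ext (funext fun x => ?_)
    have h : (1 : G)⁻¹ • x = x := by rw [inv_one, one_smul]
    exact (S.gact_section s.1 h (smul_inv_smul 1 x) (one_smul G x)).trans (S.gact_one (s.1 x))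
  map_mul' g h := by
    refine LinearMap.ext fun s => Subtype.ext (funext fun x => ?_)
    have hx : (g * h)⁻¹ • x = h⁻¹ • g⁻¹ • x := by rw [mul_inv_rev, mul_smul]
    have hx' : (g * h) • h⁻¹ • g⁻¹ • x = x := by rw [mul_smul, smul_inv_smul, smul_inv_smul]
    exact (S.gact_section s.1 hx (smul_inv_smul (g * h) x) hx').trans
      (S.gact_gact g h (smul_inv_smul h _) (smul_inv_smul g x) hx' _)

/-- A morphism of `G ⋉ X`-sheaves induces a `G`-equivariant map on compactly supported sections. -/
def Hom.mapRep {S T : (transformationGroupoid G X).Sheaf} (f : S.Hom T) :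
    Rep.of S.rep ⟶ Rep.of T.rep :=
  Rep.ofHom ⟨(f.mapΓc (ContinuousMap.id X)).toIntLinearMap, fun _ =>
    LinearMap.ext fun _ => Subtype.ext (funext fun _ => f.app_act _ _ _ _)⟩

end EtaleGroupoid.Sheaf

namespace EtaleGroupoid.SheafComplex

variable (S T : (transformationGroupoid G X).SheafComplex) (f : S.Hom T)

/-- The cochain complex `Γ_c(X; S^•)` of representations of `G`. -/
noncomputable def repComplex : CochainComplex (Rep.{u} ℤ G) ℕ :=
  CochainComplex.of (fun q => Rep.of (S.obj q).rep) (fun q => (S.d q).mapRep) fun q =>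
    Rep.hom_ext (Representation.IntertwiningMap.ext <| LinearMap.ext fun _ =>
      Subtype.ext (funext fun _ => S.d_d q _ _))

theorem repComplex_d (q : ℕ) : S.repComplex.d q (q + 1) = (S.d q).mapRep :=
  CochainComplex.of_d (fun q => Rep.of (S.obj q).rep) (fun q => (S.d q).mapRep) q

variable {S T}

/-- The map on `Γ_c(X; S^•)` induced by a morphism of complexes of sheaves. -/
noncomputable def repMap : S.repComplex ⟶ T.repComplex :=
  CochainComplex.ofHom (X := S.repComplex) (Y := T.repComplex) (fun q => (f.f q).mapRep)
    fun q => by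
      rw [repComplex_d, repComplex_d]
      have : (f.f q).mapRep ≫ (T.d q).mapRep = (S.d q).mapRep ≫ (f.f (q + 1)).mapRep :=
        Rep.hom_ext (Representation.IntertwiningMap.ext <| LinearMap.ext fun _ =>
          Subtype.ext (funext fun _ => (f.comm q _ _).symm))
      exact this

end EtaleGroupoid.SheafComplex

end Transformation

/-! ### Group hyperhomology -/

section Hyperhomology

open Representation

variable (k : Type) [CommRing k] (G : Type u) [Group G]

/-- The tensor product over `ℤG` of two left `G`-modules `M` and `N`, where `M` is regarded as a
right module by `m g = g⁻¹ m`: it is the group of coinvariants of the diagonal action of `G` on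
`M ⊗ N`, that is the quotient of `M ⊗ N` by the relations `m g ⊗ n = m ⊗ g n`. -/
noncomputable def tensorG : Rep.{u} k G ⥤ Rep.{u} k G ⥤ ModuleCat.{u} k where
  obj M :=
    { obj := fun N => ModuleCat.of k (M.ρ.tprod N.ρ).Coinvariants
      map := fun f => ModuleCat.ofHom (Coinvariants.map _ _ (f.hom.lTensor M.ρ))
      map_id := fun N => by
        refine ModuleCat.hom_ext (Coinvariants.hom_ext (TensorProduct.ext' fun m n => ?_))
        simp
      map_comp := fun f g => by
        refine ModuleCat.hom_ext (Coinvariants.hom_ext (TensorProduct.ext' fun m n => ?_))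
        simp }
  map f :=
    { app := fun N => ModuleCat.ofHom (Coinvariants.map _ _ (f.hom.rTensor N.ρ))
      naturality := fun N N' g => by
        refine ModuleCat.hom_ext (Coinvariants.hom_ext (TensorProduct.ext' fun m n => ?_))
        simp }
  map_id M := by
    ext N : 2
    refine ModuleCat.hom_ext (Coinvariants.hom_ext (TensorProduct.ext' fun m n => ?_))
    simp
  map_comp f g := by
    ext N : 2
    refine ModuleCat.hom_ext (Coinvariants.hom_ext (TensorProduct.ext' fun m n => ?_))
    simp

instance : (tensorG k G).PreservesZeroMorphisms where
  map_zero M M' := by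
    ext N : 2
    refine ModuleCat.hom_ext (Coinvariants.hom_ext (ρ := M.ρ.tprod N.ρ)
      (TensorProduct.ext' fun m n => ?_))
    change Coinvariants.mk (M'.ρ.tprod N.ρ) ((0 : M') ⊗ₜ n) = 0
    rw [TensorProduct.zero_tmul, map_zero]

instance (M : Rep.{u} k G) : ((tensorG k G).obj M).PreservesZeroMorphisms where
  map_zero N N' := by
    refine ModuleCat.hom_ext (Coinvariants.hom_ext (ρ := M.ρ.tprod N.ρ)
      (TensorProduct.ext' fun m n => ?_))
    change Coinvariants.mk (M.ρ.tprod N'.ρ) (m ⊗ₜ (0 : N')) = 0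
    rw [TensorProduct.tmul_zero, map_zero]

/-- The trivial `G`-module `ℤ`. -/
noncomputable abbrev trivialRep : Rep.{u} k G := Rep.trivial k G (ULift.{u} k)

/-- The standard augmentation `ℤG → ℤ`, the sum of the coefficients. -/
noncomputable def augmentation : Rep.leftRegular k G ⟶ trivialRep k G :=
  Rep.ofHom ⟨(Finsupp.linearCombination k fun _ : G => (ULift.up 1 : ULift.{u} k)) ∘ₗ
    (MonoidAlgebra.coeffLinearEquiv k).toLinearMap, fun g => by ext; simp⟩

variable {k G}

/-- The identification `ℤG ⊗_{ℤG} M = M`. As `ℤG` is regarded as a right module by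
`a g = g⁻¹ a`, the class of `g ⊗ m` is sent to `g⁻¹ m`. -/
noncomputable def leftRegularTensor (M : Rep.{u} k G) :
    ((tensorG k G).obj (Rep.leftRegular k G)).obj M ⟶ ModuleCat.of k M :=
  ModuleCat.ofHom (Coinvariants.lift _ (TensorProduct.lift
    ((Finsupp.linearCombination k fun g : G => M.ρ g⁻¹) ∘ₗ
      (MonoidAlgebra.coeffLinearEquiv k).toLinearMap)) fun g => TensorProduct.ext (by ext; simp))

theorem leftRegularTensor_apply (M : Rep.{u} k G) (g : G) (m : M) :
    (leftRegularTensor M).hom (Coinvariants.mk ((Rep.leftRegular k G).ρ.tprod M.ρ) (MonoidAlgebra.single g (1 : k) ⊗ₜ m)) =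
      M.ρ g⁻¹ m := by
  change (Finsupp.linearCombination k (fun g : G => M.ρ g⁻¹)
    (MonoidAlgebra.coeffLinearEquiv k (MonoidAlgebra.single g (1 : k)))) m = M.ρ g⁻¹ m
  simp

theorem augmentation_apply (g : G) (r : k) :
    (augmentation k G).hom (MonoidAlgebra.single g r) = ULift.up r := by
  change Finsupp.linearCombination k (fun _ : G => (ULift.up 1 : ULift.{u} k))
    (MonoidAlgebra.coeffLinearEquiv k (MonoidAlgebra.single g r)) = ULift.up r
  ext
  simp

/-- For a chain complex `P` and a cochain complex `C` of `G`-modules (the latter regarded as the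
chain complex that is `C^q` in degree `-q`), this is the (direct sum) total complex of the double
complex `P_p ⊗_{ℤG} C^q`, in degree `p - q`. -/
noncomputable def hyperChains (P : ChainComplex (Rep.{u} k G) ℕ)
    (C : CochainComplex (Rep.{u} k G) ℕ) : ChainComplex (ModuleCat.{u} k) ℤ :=
  HomologicalComplex.mapBifunctor P C (tensorG k G) (ComplexShape.down ℤ)

/-- The chain map induced by morphisms of complexes. -/
noncomputable def hyperChainsMap {P P' : ChainComplex (Rep.{u} k G) ℕ}
    {C C' : CochainComplex (Rep.{u} k G) ℕ} (f : P ⟶ P') (φ : C ⟶ C') :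
    hyperChains P C ⟶ hyperChains P' C' :=
  HomologicalComplex.mapBifunctorMap f φ (tensorG k G) (ComplexShape.down ℤ)

/-- The hyperhomology `ℍ_n(G; C)`, computed with a projective resolution `P` of the trivial
module `ℤ`. -/
noncomputable abbrev hyperhomology (P : ProjectiveResolution (trivialRep k G))
    (C : CochainComplex (Rep.{u} k G) ℕ) (n : ℤ) : ModuleCat.{u} k :=
  (hyperChains P.complex C).homology n

/-- The component `x₀ ∈ P_0 ⊗_{ℤG} C^0 = C^0` of a chain of degree `0`, if `P_0` is identified with
`ℤG`. -/
noncomputable def hyperComponent {P : ChainComplex (Rep.{u} k G) ℕ}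
    (e : P.X 0 ≅ Rep.leftRegular k G) (C : CochainComplex (Rep.{u} k G) ℕ) :
    (hyperChains P C).X 0 ⟶ ModuleCat.of k (C.X 0) :=
  totalProj _ ≫ ((tensorG k G).map e.hom).app (C.X 0) ≫ leftRegularTensor (C.X 0)

/-- The chain `p ⊗ c` of degree `-q`, for `p ∈ P_0` and `c ∈ C^q`. -/
noncomputable def edgeTensor {P : ChainComplex (Rep.{u} k G) ℕ}
    {C : CochainComplex (Rep.{u} k G) ℕ} {q : ℕ} (p : P.X 0) (c : C.X q) :
    (hyperChains P C).X (-(q : ℤ)) :=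
  (edge ((((tensorG k G).mapBifunctorHomologicalComplex _ _).obj P).obj C) q).hom
    (Representation.Coinvariants.mk ((P.X 0).ρ.tprod (C.X q).ρ) (p ⊗ₜ c))

end Hyperhomology

/-! ### Invariant measures -/

namespace EtaleGroupoid

open MeasureTheory

variable {O A : Type u} [TopologicalSpace O] [TopologicalSpace A]

/-- A measure on the object space is invariant if the source and the range of every open bisection
have the same measure. -/
def IsInvariant (𝒢 : EtaleGroupoid O A) [MeasurableSpace O] (μ : Measure O) : Prop :=
  ∀ B : Set A, IsOpen B → Set.InjOn 𝒢.src B → Set.InjOn 𝒢.rng B → μ (𝒢.src '' B) = μ (𝒢.rng '' B)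

/-- A realization of a `𝒢`-sheaf `S` as a subsheaf of the `𝒢`-sheaf whose sections over `U` are the
complex-valued Borel functions on `U` that are bounded on compact subsets of `U`: a section `s` of
`S` over `U` corresponds to the function `x ↦ ev x (s x)` on `U`. -/
structure BorelRealization {𝒢 : EtaleGroupoid O A} [MeasurableSpace O] (S : 𝒢.Sheaf) where
  ev : ∀ x, S.stalk x →+ ℂ
  measurable : ∀ (U : Set O) (s : ∀ x, S.stalk x), IsOpen U → S.IsSectionOn U s →
    Measurable fun x : U => ev x (s x)
  bounded : ∀ (U : Set O) (s : ∀ x, S.stalk x), IsOpen U → S.IsSectionOn U s →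
    ∀ K ⊆ U, IsCompact K → ∃ c : ℝ, ∀ x ∈ K, ‖ev x (s x)‖ ≤ c
  injective : ∀ (U : Set O) (s : ∀ x, S.stalk x), IsOpen U → S.IsSectionOn U s →
    (∀ x ∈ U, ev x (s x) = 0) → ∀ x ∈ U, s x = 0
  equivariant : ∀ (g : A) {x y : O} (hx : 𝒢.src g = x) (hy : 𝒢.rng g = y) (e : S.stalk x),
    ev y (S.act g hx hy e) = ev x e

/-- A Borel structure on a resolution of the constant sheaf `𝒵`: the sheaf `S⁰` is realized as
a sheaf of Borel functions in such a way that the map `𝒵 → S⁰` is the inclusion of the locally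
constant integer-valued functions. -/
structure BorelStructure {𝒢 : EtaleGroupoid O A} [MeasurableSpace O]
    (S : 𝒢.CSoftResolution 𝒢.constSheaf) extends BorelRealization (S.obj 0) where
  ev_ε : ∀ (x : O) (n : ULift.{u} ℤ), ev x (S.ε.app x n) = (n.down : ℂ)

/-- The Crainic–Moerdijk homology group with coefficients in a complex of sheaves; for
a resolution of `𝒵` by `c`-soft sheaves, it is the homology `H_n(𝒢)` of the groupoid `𝒢`. -/
noncomputable abbrev SheafComplex.homology [T2Space O] [T2Space A] {𝒢 : EtaleGroupoid O A}
    (S : 𝒢.SheafComplex) (n : ℤ) : ModuleCat.{u} ℤ :=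
  S.chains.homology n

/-- The pairing `∫ a₀ dμ` of a measure `μ` with a chain `(a_p)_p` of degree `0`, where
`a₀ ∈ Γ_c(𝒢^(0); S⁰)` is its component in bidegree `(0, 0)`. -/
noncomputable def BorelStructure.pairing [T2Space O] [T2Space A] {𝒢 : EtaleGroupoid O A}
    [MeasurableSpace O] {S : 𝒢.CSoftResolution 𝒢.constSheaf} (β : BorelStructure S)
    (μ : Measure O) (a : S.chains.X 0) : ℂ :=
  let a₀ : (S.obj 0).Γc (Strings.τ 𝒢 0) := (totalProj S.barBicomplex).hom a
  ∫ x, β.ev x (a₀.1 (Strings.ofObj 𝒢 x)) ∂μ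

end EtaleGroupoid

section Transformation

open MeasureTheory EtaleGroupoid

variable {G X : Type u} [Group G] [TopologicalSpace G] [DiscreteTopology G] [TopologicalSpace X]
  [MulAction G X] [ContinuousConstSMul G X] [MeasurableSpace X]

/-- The pairing `∫ x₀ dμ` of a measure `μ` with a hyperhomology chain of degree `0`, where
`x₀ ∈ P_0 ⊗_{ℤG} Γ_c(X; S⁰) = Γ_c(X; S⁰)` is its component in bidegree `(0, 0)`. -/
noncomputable def hyperPairing
    {S : (transformationGroupoid G X).CSoftResolution (transformationGroupoid G X).constSheaf}
    (β : BorelStructure S) {P : ChainComplex (Rep.{u} ℤ G) ℕ} (e : P.X 0 ≅ Rep.leftRegular ℤ G)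
    (μ : Measure X) (a : (hyperChains P S.repComplex).X 0) : ℂ :=
  let x₀ : (S.obj 0).Γc (ContinuousMap.id X) := (hyperComponent e S.repComplex).hom a
  ∫ x, β.ev x (x₀.1 x) ∂μ

end Transformation

end CrainicMoerdijk

open CrainicMoerdijk

/-! For a transformation groupoid, the bar complex of the groupoid already is a group hyperhomology
complex. In a string `x₀ ← ⋯ ← xₚ` of `G ⋉ X` each arrow carries a group element, and these labels
together with `x₀` determine the string. Labels vary in the discrete set `G^p`, so the space of
strings is `G^p × X`, with `τ_p` the projection to `X`. A compactly supported section meets finitely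
many sheets, whence `Γ_c(𝒢^(p); τ_p^*S) = ⨁_{G^p} Γ_c(X; S)` (`bijective_sumLabels`). The right-hand
side is `B_p ⊗_{ℤG} Γ_c(X; S)` for the bar resolution `B`, because `B_p` is free on `G^p`
(`tensorFreeEquiv`).

The differentials agree (`barIso_hom_d`). The positive faces multiply neighbouring labels or drop
the last one. The zeroth face drops the first label `g₀` and transports germs by `g₀⁻¹`; this is the
term `g₀[g₁|⋯] ⊗ c = [g₁|⋯] ⊗ g₀⁻¹c` of the bar differential. Hence the double complexes, and so
their total complexes, are isomorphic, naturally in the sheaves (`chainsIso`).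

To pass from `B` to an arbitrary projective resolution `P`, lift the identity of `ℤ` to a chain map.
Two such lifts are homotopic, and the homotopy survives tensoring and totalization
(`homologyMap_hyperChainsMap_eq`). This gives both the isomorphism and its naturality in `P`.

On a vertical cocycle `a` the comparison yields `p₀ ⊗ a`, where `p₀` is the image of the empty
symbol and has augmentation `1`. If `p` also has augmentation `1`, then `p₀ - p = dy`, and `y ⊗ a`
bounds the difference because `da = 0` (`exists_edgeTensor_sub_eq_d`).

Integration against an invariant measure is a `G`-invariant functional on `Γ_c(X; S⁰)`, so it
factors through `ℤ ⊗_{ℤG} Γ_c(X; S⁰)`. Composed with `P₀ → ℤ` it gives a functional on chains of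
degree zero that kills boundaries and is compatible with comparison maps (`d_hyperDesc`,
`hyperChainsMap_hyperDesc`). For the bar resolution it is `∫ a₀ dμ`, and for `P₀ = ℤG` it is `∫ x₀
dμ`. -/

namespace CrainicMoerdijk
-- The bar resolution of the trivial module.
namespace GroupBar

open Finsupp

variable (k : Type) [CommRing k] (G : Type u) [Group G]

/-- The differential `kG[Gⁿ⁺¹] → kG[Gⁿ]` of the bar resolution. -/
noncomputable def d (n : ℕ) :
    (Rep.free k G (Fin (n + 1) → G) : Rep.{u} k G) ⟶ Rep.free k G (Fin n → G) :=
  Rep.freeLift k G _ fun g => single (fun i => g i.succ) (.single (g 0) 1) +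
    ∑ j : Fin (n + 1), single (j.contractNth (· * ·) g) (.single (1 : G) ((-1 : k) ^ ((j : ℕ) + 1)))

variable {k G}

theorem d_single {n : ℕ} (x : Fin (n + 1) → G) (g : G) (r : k) :
    (d k G n).hom (single x (.single g r)) = single (fun i => x i.succ) (.single (g * x 0) r) +
      ∑ j : Fin (n + 1),
        single (j.contractNth (· * ·) x) (.single g (r * (-1 : k) ^ ((j : ℕ) + 1))) := by
  simp [d, map_add, map_sum, Representation.freeLift_single_single, smul_add, Finset.smul_sum]

theorem lhom_ext {α : Type u} {M : Type*} [AddCommGroup M] [Module k M]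
    {f f' : (α →₀ MonoidAlgebra k G) →ₗ[k] M}
    (h : ∀ a g, f (single a (.single g 1)) = f' (single a (.single g 1))) : f = f' :=
  Finsupp.lhom_ext' fun a => MonoidAlgebra.lhom_ext' fun g => LinearMap.ext_ring (h a g)

/-- The contracting homotopy `g[g₁|…|gₙ] ↦ [g|g₁|…|gₙ]` of the bar resolution. -/
noncomputable def s (n : ℕ) :
    ((Fin n → G) →₀ MonoidAlgebra k G) →ₗ[k] ((Fin (n + 1) → G) →₀ MonoidAlgebra k G) :=
  Finsupp.lsum k fun x => (Finsupp.lsum k fun g =>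
    (Finsupp.lsingle (Fin.cons g x : Fin (n + 1) → G)) ∘ₗ MonoidAlgebra.lsingle (1 : G)) ∘ₗ
      (MonoidAlgebra.coeffLinearEquiv k).toLinearMap

theorem s_single {n : ℕ} (x : Fin n → G) (g : G) (r : k) :
    s n (single x (.single g r)) = single (Fin.cons g x : Fin (n + 1) → G) (.single 1 r) := by
  simp [s]

theorem contractNth_zero_cons {n : ℕ} (g : G) (x : Fin (n + 1) → G) :
    (0 : Fin (n + 2)).contractNth (· * ·) (Fin.cons g x : Fin (n + 2) → G) =
      Fin.cons (g * x 0) fun i => x i.succ := by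
  funext i
  refine Fin.cases ?_ (fun i => ?_) i <;> simp [Fin.contractNth]

theorem contractNth_succ_cons {n : ℕ} (j : Fin (n + 1)) (g : G) (x : Fin (n + 1) → G) :
    j.succ.contractNth (· * ·) (Fin.cons g x : Fin (n + 2) → G) =
      Fin.cons g (j.contractNth (· * ·) x) := by
  funext i
  refine Fin.cases ?_ (fun i => ?_) i
  · simp [Fin.contractNth]
  · simp [Fin.contractNth]

/-- Prepending `g` makes the leading term of the differential return `g[x]` itself. The remaining
terms are those of `-s(d(g[x]))`: multiplying `g` into `x₀` matches the leading term of `d(g[x])`,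
and each later contraction leaves `g` in front while its index, hence its sign, shifts by one. -/
theorem d_s {n : ℕ} (y : (Fin (n + 1) → G) →₀ MonoidAlgebra k G) :
    (d k G (n + 1)).hom (s (n + 1) y) = y - s n ((d k G n).hom y) := by
  have : (d k G (n + 1)).hom.toLinearMap ∘ₗ s (n + 1) =
      LinearMap.id - s n ∘ₗ (d k G n).hom.toLinearMap := by
    refine lhom_ext fun x g => ?_
    change (d k G (n + 1)).hom (s (n + 1) (single x (.single g 1))) =
      single x (.single g 1) - s n ((d k G n).hom (single x (.single g 1)))
    rw [s_single, d_single, d_single, map_add, map_sum, s_single]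
    simp only [s_single]
    rw [Fin.sum_univ_succ, contractNth_zero_cons]
    simp only [contractNth_succ_cons, Fin.cons_succ, Fin.cons_zero, one_mul, Fin.val_zero,
      zero_add, pow_one, Fin.val_succ, pow_succ _ (_ + 1), mul_neg, mul_one]
    simp only [MonoidAlgebra.single_neg, Finsupp.single_neg, Finset.sum_neg_distrib]
    abel
  exact LinearMap.congr_fun this y

variable (k G) in
/-- The sum of the coefficients, on the degree zero part of the bar resolution. -/
noncomputable def coeffSum : ((Fin 0 → G) →₀ MonoidAlgebra k G) →ₗ[k] k :=
  (Finsupp.linearCombination k (fun _ : G => (1 : k))) ∘ₗ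
    (MonoidAlgebra.coeffLinearEquiv k).toLinearMap ∘ₗ Finsupp.lapply ![]

theorem coeffSum_single (x : Fin 0 → G) (g : G) (r : k) :
    coeffSum k G (single x (.single g r)) = r := by
  obtain rfl : x = ![] := Subsingleton.elim _ _
  simp [coeffSum]

theorem coeffSum_d (y : (Fin 1 → G) →₀ MonoidAlgebra k G) :
    coeffSum k G ((d k G 0).hom y) = 0 := by
  have : coeffSum k G ∘ₗ (d k G 0).hom.toLinearMap = 0 := by
    refine lhom_ext fun x g => ?_
    change coeffSum k G ((d k G 0).hom (single x (.single g 1))) = _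
    rw [d_single, map_add, map_sum]
    simp [coeffSum_single]
  exact LinearMap.congr_fun this y

/-- In degree zero the homotopy identity is corrected by the augmentation, followed by the section
`r ↦ r[]`. -/
theorem d_s_zero (y : (Fin 0 → G) →₀ MonoidAlgebra k G) :
    (d k G 0).hom (s 0 y) = y - single ![] (.single 1 (coeffSum k G y)) := by
  have : (d k G 0).hom.toLinearMap ∘ₗ s 0 =
      LinearMap.id - Finsupp.lsingle ![] ∘ₗ MonoidAlgebra.lsingle (1 : G) ∘ₗ coeffSum k G := by
    refine lhom_ext fun x g => ?_
    change (d k G 0).hom (s 0 (single x (.single g 1))) =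
      single x (.single g 1) - single ![] (.single 1 (coeffSum k G (single x (.single g 1))))
    rw [s_single, d_single, coeffSum_single]
    obtain rfl : x = ![] := Subsingleton.elim _ _
    simp [Subsingleton.elim _ (![] : Fin 0 → G)]
    abel
  exact LinearMap.congr_fun this y

theorem d_s_of_d_eq_zero {n : ℕ} {y : (Fin (n + 1) → G) →₀ MonoidAlgebra k G}
    (hy : (d k G n).hom y = 0) : (d k G (n + 1)).hom (s (n + 1) y) = y := by
  rw [d_s, hy, map_zero, sub_zero]

/-- The contracting homotopy spares a check of the simplicial identities. The module generators lie
in the image of `s`, so it is enough to know `d d s = 0`; the homotopy identity reduces this to `d s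
d = d`, which holds in degree zero because `d` has augmentation zero, and in higher degrees by
induction. -/
theorem d_d {n : ℕ} : d k G (n + 1) ≫ d k G n = 0 := by
  have key : ∀ m (z : (Fin (m + 1) → G) →₀ MonoidAlgebra k G),
      (∀ y : (Fin (m + 1) → G) →₀ MonoidAlgebra k G,
        (d k G m).hom (s m ((d k G m).hom y)) = (d k G m).hom y) → 
      (d k G m).hom ((d k G (m + 1)).hom (s (m + 1) z)) = 0 := by
    intro m z h
    rw [d_s, map_sub, h, sub_self]
  have gen : ∀ m, (∀ z : (Fin (m + 1) → G) →₀ MonoidAlgebra k G,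
      (d k G m).hom ((d k G (m + 1)).hom (s (m + 1) z)) = 0) → d k G (m + 1) ≫ d k G m = 0 := by
    intro m h
    refine Rep.free_ext _ _ _ _ _ fun x => ?_
    -- The generator `[x₀|x₁|⋯]` is `s` of `x₀[x₁|⋯]`.
    have hx : (single x (.single 1 1) : (Fin (m + 2) → G) →₀ MonoidAlgebra k G) =
        s (m + 1) (single (fun i => x i.succ) (.single (x 0) 1)) := by
      rw [s_single]
      congr
      exact (Fin.cons_self_tail x).symm
    rw [hx]
    exact h _
  induction n with
  | zero =>
    refine gen 0 fun z => key 0 z fun y => ?_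
    rw [d_s_zero]
    rw [coeffSum_d]
    simp
  | succ n ih =>
    refine gen _ fun z => key _ z fun y => ?_
    rw [d_s]
    have : (d k G n).hom ((d k G (n + 1)).hom y) = 0 := by
      rw [← Representation.IntertwiningMap.comp_apply, ← Rep.hom_comp, ih]; rfl
    rw [this, map_zero, sub_zero]

variable (k G)

/-- The bar resolution, as a complex. -/
noncomputable def complex : ChainComplex (Rep.{u} k G) ℕ :=
  ChainComplex.of (fun n => Rep.free k G (Fin n → G)) (d k G) fun _ => d_d

theorem complex_d (n : ℕ) : (complex k G).d (n + 1) n = d k G n :=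
  ChainComplex.of_d (fun n => Rep.free k G (Fin n → G)) (d k G) n

/-- The augmentation of the bar resolution. -/
noncomputable def ε : (Rep.free k G (Fin 0 → G) : Rep.{u} k G) ⟶ trivialRep k G :=
  Rep.freeLift k G _ fun _ => (ULift.up 1 : ULift.{u} k)

variable {k G}

theorem ε_single (x : Fin 0 → G) (g : G) (r : k) :
    (ε k G).hom (single x (.single g r)) = ULift.up r := by
  refine (Representation.freeLift_single_single (trivialRep k G).ρ x g r
    fun _ => (ULift.up 1 : ULift.{u} k)).trans ?_
  exact congrArg ULift.up (mul_one r)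

theorem ε_apply (y : (Fin 0 → G) →₀ MonoidAlgebra k G) :
    ((ε k G).hom y) = ULift.up (coeffSum k G y) := by
  have : (ε k G).hom.toLinearMap = ULift.moduleEquiv.symm.toLinearMap ∘ₗ coeffSum k G :=
    lhom_ext fun x g => (ε_single _ _ _).trans (congrArg ULift.up (coeffSum_single x g 1).symm)
  exact LinearMap.congr_fun this y

theorem d_ε : d k G 0 ≫ ε k G = 0 := by
  refine Rep.free_ext _ _ _ _ _ fun x => ?_
  exact (ε_apply _).trans (congrArg ULift.up (coeffSum_d _))

instance projective_free (α : Type u) : Projective (Rep.free k G α : Rep.{u} k G) where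
  factors f e he := by
    have hs := (Rep.epi_iff_surjective e).1 he
    choose σ hσ using hs
    refine ⟨Rep.freeLift k G _ fun a => σ (f.hom (single a (.single 1 1))), ?_⟩
    refine Rep.free_ext _ _ _ _ _ fun a => ?_
    refine (congrArg e.hom (Representation.freeLift_single_single _ _ _ _ _)).trans ?_
    simp [hσ]

/-- Exactness of representations can be tested on elements, as the forgetful functor to modules is
faithful and compatible with homology. -/
theorem exact_of_function_exact (S : ShortComplex (Rep.{u} k G))
    (h : ∀ x : S.X₂, S.g.hom x = 0 → ∃ y : S.X₁, S.f.hom y = x) : S.Exact := by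
  rw [← ShortComplex.exact_map_iff_of_faithful S (forget₂ (Rep.{u} k G) (ModuleCat.{u} k)),
    ShortComplex.moduleCat_exact_iff]
  exact h

variable (k G)

/-- The bar resolution of the trivial module. -/
noncomputable def resolution : ProjectiveResolution (trivialRep.{u} k G) where
  complex := complex k G
  projective n := projective_free (Fin n → G)
  π := (ChainComplex.toSingle₀Equiv _ _).symm ⟨ε k G, by rw [complex_d]; exact d_ε⟩
  quasiIso := ⟨fun n => by
    cases n
    -- In degree zero the condition is exactness of `B₁ → B₀ → ℤ` together with surjectivity of the
    -- augmentation; both are read off from the contracting homotopy.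
    · rw [ChainComplex.quasiIsoAt₀_iff, ShortComplex.quasiIso_iff_of_zeros']
      · refine (ShortComplex.exact_and_epi_g_iff_of_iso
          (S₁ := ShortComplex.mk (d k G 0) (ε k G) d_ε)
          ?_).1 ⟨exact_of_function_exact _ fun x hx => ?_, ?_⟩
        · exact ShortComplex.isoMk (Iso.refl _) (Iso.refl _) (Iso.refl _)
            ((Category.id_comp _).trans ((complex_d k G 0).trans (Category.comp_id _).symm))
            ((Category.id_comp _).trans
              ((ChainComplex.toSingle₀Equiv_symm_apply_f_zero _ _).trans (Category.comp_id _).symm))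
        · have hx' : coeffSum k G x = 0 := congrArg ULift.down ((ε_apply x).symm.trans hx)
          refine ⟨s 0 x, (d_s_zero x).trans ?_⟩
          rw [hx']
          simp
        · refine (Rep.epi_iff_surjective (ε k G)).2 fun r => ⟨single ![] (.single 1 r.down), ?_⟩
          exact ε_single _ _ _
      all_goals rfl
    · rw [quasiIsoAt_iff_exactAt']
      · rename_i n
        rw [HomologicalComplex.exactAt_iff' _ (n + 1 + 1) (n + 1) n (by simp) (by simp)]
        refine exact_of_function_exact _ fun x hx => ⟨s (n + 1) x, ?_⟩
        change ((complex k G).d (n + 1) n).hom x = 0 at hx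
        change ((complex k G).d (n + 1 + 1) (n + 1)).hom (s (n + 1) x) = x
        rw [complex_d] at hx ⊢
        exact d_s_of_d_eq_zero hx
      · apply ChainComplex.exactAt_succ_single_obj⟩

end GroupBar

/-! ### Functoriality of hyperhomology chains and independence of the resolution. -/

section Hyper

open HomologicalComplex

variable {k : Type} [CommRing k] {G : Type u} [Group G]

theorem tensorG_map_app_mk {M M' : Rep.{u} k G} (f : M ⟶ M') (N : Rep.{u} k G) (m : M) (n : N) :
    (((tensorG k G).map f).app N).hom
        (Representation.Coinvariants.mk (M.ρ.tprod N.ρ) (m ⊗ₜ n)) =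
      Representation.Coinvariants.mk (M'.ρ.tprod N.ρ) (f.hom m ⊗ₜ n) := rfl

theorem tensorG_obj_map_mk (M : Rep.{u} k G) {N N' : Rep.{u} k G} (f : N ⟶ N') (m : M) (n : N) :
    (((tensorG k G).obj M).map f).hom
        (Representation.Coinvariants.mk (M.ρ.tprod N.ρ) (m ⊗ₜ n)) =
      Representation.Coinvariants.mk (M.ρ.tprod N'.ρ) (m ⊗ₜ f.hom n) := rfl

theorem tensorG_hom_ext {M N : Rep.{u} k G} {A : ModuleCat.{u} k}
    {f g : ((tensorG k G).obj M).obj N ⟶ A}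
    (h : ∀ m n, f.hom (Representation.Coinvariants.mk (M.ρ.tprod N.ρ) (m ⊗ₜ n)) =
      g.hom (Representation.Coinvariants.mk (M.ρ.tprod N.ρ) (m ⊗ₜ n))) : f = g :=
  ModuleCat.hom_ext (Representation.Coinvariants.hom_ext (TensorProduct.ext' h))

/-- Additivity is needed to push chain homotopies through the tensor product. -/
instance : (tensorG k G).Additive where
  map_add {M M'} f g := by
    ext N : 2
    refine tensorG_hom_ext fun m n => ?_
    change Representation.Coinvariants.mk (M'.ρ.tprod N.ρ) ((f.hom m + g.hom m) ⊗ₜ n) = _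
    rw [TensorProduct.add_tmul, map_add]
    rfl

instance (M : Rep.{u} k G) : ((tensorG k G).obj M).Additive where
  map_add {N N'} f g := by
    refine tensorG_hom_ext fun m n => ?_
    change Representation.Coinvariants.mk (M.ρ.tprod N'.ρ) (m ⊗ₜ (f.hom n + g.hom n)) = _
    rw [TensorProduct.tmul_add, map_add]
    rfl

variable {P P' P'' : ChainComplex (Rep.{u} k G) ℕ} {C C' C'' : CochainComplex (Rep.{u} k G) ℕ}

/-- The inclusion of a summand of the hyperhomology chains. -/
noncomputable abbrev ιHyper (P : ChainComplex (Rep.{u} k G) ℕ) (C : CochainComplex (Rep.{u} k G) ℕ)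
    (p q : ℕ) (n : ℤ) (h : (p : ℤ) - q = n) :
    ((tensorG k G).obj (P.X p)).obj (C.X q) ⟶ (hyperChains P C).X n :=
  ιMapBifunctor P C (tensorG k G) (ComplexShape.down ℤ) p q n h

theorem hyperChains_hom_ext {n : ℤ} {A : ModuleCat.{u} k} {f g : (hyperChains P C).X n ⟶ A}
    (h : ∀ (p q : ℕ) (hpq : (p : ℤ) - q = n), ιHyper P C p q n hpq ≫ f = ιHyper P C p q n hpq ≫ g) :
    f = g :=
  mapBifunctor.hom_ext h

theorem ι_hyperChainsMap (f : P ⟶ P') (φ : C ⟶ C') (p q : ℕ) (n : ℤ) (h : (p : ℤ) - q = n) :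
    ιHyper P C p q n h ≫ (hyperChainsMap f φ).f n =
      (((tensorG k G).map (f.f p)).app (C.X q) ≫ ((tensorG k G).obj (P'.X p)).map (φ.f q)) ≫
        ιHyper P' C' p q n h :=
  (ι_mapBifunctorMap f φ (tensorG k G) (ComplexShape.down ℤ) p q n h).trans
    (Category.assoc _ _ _).symm

theorem hyperChainsMap_id : hyperChainsMap (𝟙 P) (𝟙 C) = 𝟙 _ := by
  refine HomologicalComplex.hom_ext _ _ fun n => hyperChains_hom_ext fun p q h => ?_
  rw [ι_hyperChainsMap, id_f, id_f, id_f, CategoryTheory.Functor.map_id,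
    NatTrans.id_app, CategoryTheory.Functor.map_id,
    Category.id_comp, Category.id_comp, Category.comp_id]

theorem hyperChainsMap_comp (f : P ⟶ P') (f' : P' ⟶ P'') (φ : C ⟶ C') (φ' : C' ⟶ C'') :
    hyperChainsMap (f ≫ f') (φ ≫ φ') = hyperChainsMap f φ ≫ hyperChainsMap f' φ' := by
  refine HomologicalComplex.hom_ext _ _ fun n => hyperChains_hom_ext fun p q h => ?_
  rw [comp_f, ← Category.assoc, ι_hyperChainsMap, ι_hyperChainsMap,
    Category.assoc _ (ιHyper _ _ _ _ _ _),
    ι_hyperChainsMap, ← Category.assoc]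
  congr 1
  refine tensorG_hom_ext fun m n => ?_
  rfl

/-- Both maps lift the identity of `Z`, so the comparison theorem for projective resolutions
supplies a homotopy between them, which passes to the total complex. -/
theorem homologyMap_hyperChainsMap_eq {Z : Rep.{u} k G} {P P' : ProjectiveResolution Z}
    (f g : P.complex ⟶ P'.complex) (h : f ≫ P'.π = g ≫ P'.π) (φ : C ⟶ C')
    (hf : f ≫ P'.π = P.π) (n : ℤ) :
    homologyMap (hyperChainsMap f φ) n = homologyMap (hyperChainsMap g φ) n := by
  have H : Homotopy f g := ProjectiveResolution.liftHomotopy (𝟙 Z) f g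
    (by rw [hf, CategoryTheory.Functor.map_id, Category.comp_id])
    (by rw [← h, hf, CategoryTheory.Functor.map_id, Category.comp_id])
  exact (mapBifunctorMapHomotopy₁ H φ (tensorG k G) (ComplexShape.down ℤ)).homologyMap_eq n

/-- The comparison isomorphism between the hyperhomology groups computed with two projective
resolutions of the same module. -/
noncomputable def hyperhomologyIso {Z : Rep.{u} k G} (P P' : ProjectiveResolution Z)
    (C : CochainComplex (Rep.{u} k G) ℕ) (n : ℤ) :
    (hyperChains P.complex C).homology n ≅ (hyperChains P'.complex C).homology n where
  hom := homologyMap (hyperChainsMap (ProjectiveResolution.lift (𝟙 Z) P P') (𝟙 C)) n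
  inv := homologyMap (hyperChainsMap (ProjectiveResolution.lift (𝟙 Z) P' P) (𝟙 C)) n
  hom_inv_id := by
    rw [← homologyMap_comp, ← hyperChainsMap_comp, Category.comp_id,
      homologyMap_hyperChainsMap_eq (P := P) (P' := P) _ (𝟙 _) (by simp) _ (by simp),
      hyperChainsMap_id, homologyMap_id]
  inv_hom_id := by
    rw [← homologyMap_comp, ← hyperChainsMap_comp, Category.comp_id,
      homologyMap_hyperChainsMap_eq (P := P') (P' := P') _ (𝟙 _) (by simp) _ (by simp),
      hyperChainsMap_id, homologyMap_id]

end Hyper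

/-! ### Tensor products with free `kG`-modules. -/

section Free

open Finsupp Representation

variable {k : Type} [CommRing k] {G : Type u} [Group G] (α : Type u) (N : Rep.{u} k G)

/-- The left tensor is the translate by `g` of `[a] ⊗ r g⁻¹n` under the diagonal action, so the two
have the same class among the coinvariants. -/
theorem mk_single_tmul (a : α) (g : G) (r : k) (n : N) :
    Coinvariants.mk ((Rep.free k G α).ρ.tprod N.ρ) (single a (.single g r) ⊗ₜ n) =
      Coinvariants.mk ((Rep.free k G α).ρ.tprod N.ρ)
        (single a (.single 1 1) ⊗ₜ (r • N.ρ g⁻¹ n)) := by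
  have h := Coinvariants.mk_self_apply ((Rep.free k G α).ρ.tprod N.ρ) g
    (single a (.single 1 1) ⊗ₜ (r • N.ρ g⁻¹ n))
  rw [← h]
  congr 1
  rw [Representation.tprod_apply, TensorProduct.map_tmul, Representation.free_single_single, mul_one,
    map_smul,
    ← Module.End.mul_apply, ← map_mul, mul_inv_cancel, map_one, Module.End.one_apply,
    ← TensorProduct.smul_tmul]
  simp

/-- The map `kG[α] ⊗_{kG} N → N[α]` sending the class of `g[a] ⊗ n` to `[a] g⁻¹n`. -/
noncomputable def ofTensorFree :
    ((Rep.free k G α).ρ.tprod N.ρ).Coinvariants →ₗ[k] (α →₀ N) :=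
  Coinvariants.lift _ (TensorProduct.lift (Finsupp.lsum k fun a =>
      (Finsupp.lsum k fun g => (LinearMap.toSpanSingleton k _ (Finsupp.lsingle a ∘ₗ N.ρ g⁻¹))) ∘ₗ
        (MonoidAlgebra.coeffLinearEquiv k).toLinearMap)) fun g =>
    TensorProduct.ext (GroupBar.lhom_ext fun a h => LinearMap.ext fun n => by simp)

theorem ofTensorFree_mk (a : α) (g : G) (r : k) (n : N) :
    ofTensorFree α N (Coinvariants.mk _ (single a (.single g r) ⊗ₜ n)) =
      single a (r • N.ρ g⁻¹ n) := by
  simp [ofTensorFree]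

/-- The map `N[α] → kG[α] ⊗_{kG} N` sending `[a] n` to the class of `[a] ⊗ n`. -/
noncomputable def toTensorFree :
    (α →₀ N) →ₗ[k] ((Rep.free k G α).ρ.tprod N.ρ).Coinvariants :=
  Finsupp.lsum k fun a => Coinvariants.mk ((Rep.free k G α).ρ.tprod N.ρ) ∘ₗ
      TensorProduct.mk k _ _ (single a (.single 1 1))

theorem toTensorFree_single (a : α) (n : N) :
    toTensorFree α N (single a n) =
      Coinvariants.mk ((Rep.free k G α).ρ.tprod N.ρ) (single a (.single 1 1) ⊗ₜ n) := by
  simp [toTensorFree]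

/-- The identification `kG[α] ⊗_{kG} N = N[α]`. -/
noncomputable def tensorFreeEquiv :
    (α →₀ N) ≃ₗ[k] ((tensorG k G).obj (Rep.free k G α)).obj N :=
  LinearEquiv.ofLinearMap (toTensorFree α N) (ofTensorFree α N)
    (Coinvariants.hom_ext (TensorProduct.ext (GroupBar.lhom_ext fun a g => LinearMap.ext fun n => by
      refine (congrArg (toTensorFree α N) (ofTensorFree_mk α N a g 1 n)).trans ?_
      rw [toTensorFree_single, ← mk_single_tmul]
      rfl)))
    (Finsupp.lhom_ext fun a n => by
      refine (congrArg (ofTensorFree α N) (toTensorFree_single α N a n)).trans ?_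
      rw [ofTensorFree_mk, inv_one, map_one, one_smul]
      rfl)

theorem tensorFreeEquiv_single (a : α) (n : N) :
    tensorFreeEquiv α N (single a n) =
      Coinvariants.mk ((Rep.free k G α).ρ.tprod N.ρ) (single a (.single 1 1) ⊗ₜ n) :=
  toTensorFree_single α N a n

end Free

/-! ### Strings of the transformation groupoid as labelled points, and sections over them. -/

section TransformationStrings

open EtaleGroupoid

variable {G X : Type u} [Group G] [TopologicalSpace G] [DiscreteTopology G] [TopologicalSpace X]
  [MulAction G X] [ContinuousConstSMul G X] {n : ℕ}

namespace EtaleGroupoid.Strings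

/-- The group elements of a composable string of the transformation groupoid. -/
def labels (σ : (transformationGroupoid G X).Strings n) (i : Fin n) : G := (σ.arr i).1

theorem continuous_labels :
    Continuous (labels : (transformationGroupoid G X).Strings n → (Fin n → G)) :=
  continuous_pi fun i => continuous_fst.comp (continuous_arr i)

theorem labels_smul_obj (σ : (transformationGroupoid G X).Strings n) (i : Fin n) :
    σ.labels i • σ.obj i.succ = σ.obj i.castSucc := by
  rw [← σ.src_arr, ← σ.rng_arr]
  rfl

/-- Since `gᵢ xᵢ₊₁ = xᵢ`, the labels successively recover all objects from `x₀`. -/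
theorem ext_labels {σ σ' : (transformationGroupoid G X).Strings n}
    (h : τ _ n σ = τ _ n σ') (h' : σ.labels = σ'.labels) : σ = σ' := by
  have hobj : ∀ i, σ.obj i = σ'.obj i := by
    intro i
    induction i using Fin.induction with
    | zero => exact h
    | succ i ih =>
      rw [← σ.labels_smul_obj, ← σ'.labels_smul_obj, h'] at ih
      exact smul_left_cancel _ ih
  refine Strings.ext hobj fun i => Prod.ext (congrFun h' i) ?_
  exact (σ.src_arr i).trans ((hobj _).trans (σ'.src_arr i).symm)

/-- The string with given labels that ends at a given point. -/
def ofLabels (g : Fin n → G) (x : X) : (transformationGroupoid G X).Strings n :=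
  ⟨(Fin.cases x fun i => (Fin.partialProd g i.succ)⁻¹ • x,
    fun i => (g i, (Fin.partialProd g i.succ)⁻¹ • x)), fun i => by
    refine ⟨?_, rfl⟩
    change g i • (Fin.partialProd g i.succ)⁻¹ • x = _
    -- The formula `xⱼ = (g₀⋯gⱼ₋₁)⁻¹ x` includes `j = 0`, where the product is empty; the definition
    -- separates that case so that the endpoint is `x` on the nose.
    have h : ∀ j : Fin (n + 1), (Fin.cases x (fun i => (Fin.partialProd g i.succ)⁻¹ • x) j : X) =
        (Fin.partialProd g j)⁻¹ • x := by
      intro j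
      refine Fin.cases ?_ (fun _ => rfl) j
      simp
    refine Eq.trans ?_ (h i.castSucc).symm
    rw [Fin.partialProd_succ, mul_inv_rev, mul_smul, smul_inv_smul]⟩

theorem labels_ofLabels (g : Fin n → G) (x : X) : (ofLabels g x).labels = g := rfl

theorem continuous_ofLabels (g : Fin n → G) :
    Continuous (ofLabels g : X → (transformationGroupoid G X).Strings n) := by
  refine Continuous.subtype_mk (Continuous.prodMk (continuous_pi fun i => ?_)
    (continuous_pi fun i => continuous_const.prodMk (continuous_const_smul _))) _
  exact Fin.cases continuous_id (fun i => continuous_const_smul _) i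

theorem labels_face_zero (σ : (transformationGroupoid G X).Strings (n + 1)) :
    (face 0 σ).labels = fun i => σ.labels i.succ := by
  funext i
  exact congrArg Prod.fst (σ.arr_face_zero i)

/-- Composing arrows multiplies labels. The shift by one arises because omitting `xⱼ₊₁` merges the
arrows numbered `j` and `j + 1`, while for the last object there is no second arrow and the label is
dropped. -/
theorem labels_face_succ (j : Fin (n + 1)) (σ : (transformationGroupoid G X).Strings (n + 1)) :
    (face j.succ σ).labels = j.contractNth (· * ·) σ.labels := by
  funext i
  refine (congrArg Prod.fst (arr_face j.succ σ i)).trans ?_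
  simp only [Fin.contractNth, Fin.val_succ, add_lt_add_iff_right, add_left_inj]
  split_ifs <;> rfl

theorem τ_face_zero (σ : (transformationGroupoid G X).Strings (n + 1)) :
    τ _ (n + 1) σ = σ.labels 0 • τ _ n (face 0 σ) := by
  refine (σ.labels_smul_obj 0).symm.trans ?_
  exact congrArg _ (σ.obj_face_zero 0).symm

theorem τ_face_succ (j : Fin (n + 1)) (σ : (transformationGroupoid G X).Strings (n + 1)) :
    τ _ (n + 1) σ = τ _ n (face j.succ σ) := by
  change σ.obj 0 = σ.obj (j.succ.succAbove 0)
  rw [Fin.succAbove_ne_zero_zero (Fin.succ_ne_zero j)]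

end EtaleGroupoid.Strings

namespace EtaleGroupoid.Sheaf

open Strings

variable (S : (transformationGroupoid G X).Sheaf)

open Classical in
/-- The extension by zero of a section to the strings with other labels than `g`. -/
noncomputable def extendLabels (g : Fin n → G) :
    S.Γc (ContinuousMap.id X) →+ S.Γc (τ (transformationGroupoid G X) n) where
  toFun c := ⟨fun σ => if σ.labels = g then c.1 (τ _ n σ) else 0, by
    obtain ⟨hc, K, hK, hcK⟩ := c.2
    refine ⟨continuous_iff_continuousAt.2 fun σ => ?_, ofLabels g '' K,
      hK.image (continuous_ofLabels g), fun σ hσ => ?_⟩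
    · have hopen : ∀ᶠ σ' in 𝓝 σ, labels σ' = labels σ :=
        continuous_labels.continuousAt.eventually
          ((isOpen_discrete {g' | g' = labels σ}).mem_nhds rfl)
      by_cases h : σ.labels = g
      · refine (hc.comp (τ _ n).continuous).continuousAt.congr ?_
        filter_upwards [hopen] with σ' hσ'
        simp only [EtaleSheaf.lift, Function.comp, hσ', h]
        rfl
      · refine (S.continuousAt_lift_zero (τ _ n).continuous.continuousAt).congr ?_
        filter_upwards [hopen] with σ' hσ'
        simp only [EtaleSheaf.lift, hσ', h]
        rfl
    · by_cases h : σ.labels = g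
      · refine (if_pos h).trans (hcK _ fun hK => hσ ⟨_, hK, ext_labels rfl h.symm⟩)
      · exact if_neg h⟩
  map_zero' := by
    ext σ
    exact ite_self _
  map_add' c c' := by
    ext σ
    change (if σ.labels = g then c.1 _ + c'.1 _ else 0) =
      (if σ.labels = g then c.1 _ else 0) + (if σ.labels = g then c'.1 _ else 0)
    split_ifs
    · rfl
    · exact (add_zero 0).symm

variable {S} in
theorem extendLabels_of_eq {g : Fin n → G} (c : S.Γc (ContinuousMap.id X))
    {σ : (transformationGroupoid G X).Strings n} (h : σ.labels = g) :
    (S.extendLabels g c).1 σ = c.1 (τ _ n σ) := if_pos h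

variable {S} in
theorem extendLabels_of_ne {g : Fin n → G} (c : S.Γc (ContinuousMap.id X))
    {σ : (transformationGroupoid G X).Strings n} (h : σ.labels ≠ g) :
    (S.extendLabels g c).1 σ = 0 := if_neg h

/-- The restriction of a section to the strings with labels `g`. -/
def restrictLabels (g : Fin n → G) :
    S.Γc (τ (transformationGroupoid G X) n) →+ S.Γc (ContinuousMap.id X) where
  toFun s := ⟨fun x => s.1 (ofLabels g x), by
    obtain ⟨hs, K, hK, hsK⟩ := s.2
    exact ⟨hs.comp (continuous_ofLabels g), τ _ n '' K, hK.image (τ _ n).continuous,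
      fun x hx => hsK _ fun h => hx ⟨_, h, rfl⟩⟩⟩
  map_zero' := rfl
  map_add' _ _ := rfl

theorem restrictLabels_extendLabels_self (g : Fin n → G) (c : S.Γc (ContinuousMap.id X)) :
    S.restrictLabels g (S.extendLabels g c) = c := by
  ext x
  exact extendLabels_of_eq c rfl

theorem restrictLabels_extendLabels_of_ne {g g' : Fin n → G} (h : g ≠ g')
    (c : S.Γc (ContinuousMap.id X)) : S.restrictLabels g (S.extendLabels g' c) = 0 := by
  ext x
  exact extendLabels_of_ne c h

/-- The labels occurring on a compact set of strings form a compact subset of a discrete space. -/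
theorem finite_restrictLabels_ne_zero (s : S.Γc (τ (transformationGroupoid G X) n)) :
    {g : Fin n → G | S.restrictLabels g s ≠ 0}.Finite := by
  obtain ⟨-, K, hK, hsK⟩ := s.2
  refine (hK.image continuous_labels).finite_of_discrete.subset fun g hg => ?_
  by_contra hcon
  refine hg (Subtype.ext (funext fun x => hsK _ fun h => hcon ⟨_, h, rfl⟩))

/-- Sections over the space of strings are finite sums of sections over `X`, indexed by the
labels. -/
noncomputable def sumLabels :
    ((Fin n → G) →₀ S.Γc (ContinuousMap.id X)) →+ S.Γc (τ (transformationGroupoid G X) n) :=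
  Finsupp.liftAddHom fun g => S.extendLabels g

theorem sumLabels_single (g : Fin n → G) (c : S.Γc (ContinuousMap.id X)) :
    S.sumLabels (Finsupp.single g c) = S.extendLabels g c :=
  Finsupp.liftAddHom_apply_single _ _ _

theorem restrictLabels_sumLabels (f : (Fin n → G) →₀ S.Γc (ContinuousMap.id X)) (g : Fin n → G) :
    S.restrictLabels g (S.sumLabels f) = f g := by
  induction f using Finsupp.induction_linear with
  | zero => rw [map_zero, map_zero]; rfl
  | add f f' h h' => rw [map_add, map_add, h, h']; rfl
  | single g' c =>
    rw [sumLabels_single]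
    by_cases h : g = g'
    · subst h
      rw [restrictLabels_extendLabels_self, Finsupp.single_eq_same]
    · rw [restrictLabels_extendLabels_of_ne _ h, Finsupp.single_eq_of_ne h]

/-- Every string lies on the sheet indexed by its own labels. -/
theorem eq_of_restrictLabels {s s' : S.Γc (τ (transformationGroupoid G X) n)}
    (h : ∀ g, S.restrictLabels g s = S.restrictLabels g s') : s = s' := by
  ext σ
  have hσ : σ = ofLabels σ.labels (τ _ n σ) := ext_labels rfl rfl
  rw [hσ]
  exact congrFun (congrArg Subtype.val (h σ.labels)) (τ _ n σ)

theorem bijective_sumLabels : Function.Bijective (S.sumLabels (n := n)) := by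
  refine ⟨fun f f' h => Finsupp.ext fun g => ?_, fun s => ?_⟩
  · rw [← restrictLabels_sumLabels, h, restrictLabels_sumLabels]
  · refine ⟨Finsupp.onFinset (S.finite_restrictLabels_ne_zero s).toFinset
      (fun g => S.restrictLabels g s) fun g hg => by simpa using hg, ?_⟩
    refine S.eq_of_restrictLabels fun g => ?_
    rw [restrictLabels_sumLabels]
    rfl

/-- Transporting the germs of a section along arrows with a fixed group element produces the germs
of the translated section. This is how the action on `Γ_c(X; S)` enters the face maps. -/
theorem act_section (c : S.Γc (ContinuousMap.id X)) (κ : G × X) {x y : X}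
    (hx : (transformationGroupoid G X).src κ = x) (hy : (transformationGroupoid G X).rng κ = y) :
    S.act κ hx hy (c.1 x) = (S.rep κ.1 c).1 y := by
  obtain ⟨g, z⟩ := κ
  obtain rfl : z = x := hx
  obtain rfl : g • z = y := hy
  exact S.gact_section c.1 (inv_smul_smul g z).symm rfl (smul_inv_smul g _)

theorem Hom.mapΓc_extendLabels {S T : (transformationGroupoid G X).Sheaf} (f : S.Hom T)
    (g : Fin n → G) (c : S.Γc (ContinuousMap.id X)) :
    f.mapΓc _ (S.extendLabels g c) = T.extendLabels g (f.mapΓc _ c) := by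
  ext σ
  rw [Hom.coe_mapΓc]
  by_cases h : σ.labels = g
  · rw [extendLabels_of_eq _ h, extendLabels_of_eq _ h]
    rfl
  · rw [extendLabels_of_ne _ h, extendLabels_of_ne _ h, map_zero]

variable [T2Space X]

/-- A common pattern for all face maps: the `i`-th face carries the sheet with labels `g`
bijectively to the sheet with labels `g'`, and the germs are transported by the constant group
element `h`. The function `x` describes the inverse: the string of the first sheet over a string
ending at `y` ends at `x y`. Each fibre sum thus has at most one nonzero term. -/
theorem δ_extendLabels (i : Fin (n + 2)) (g : Fin (n + 1) → G) (g' : Fin n → G) (h : G)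
    (hg : ∀ σ : (transformationGroupoid G X).Strings (n + 1),
      σ.labels = g → (face i σ).labels = g' ∧ (carrier i σ).1 = h)
    (x : X → X)
    (hτ : ∀ σ : (transformationGroupoid G X).Strings (n + 1), σ.labels = g →
      τ _ (n + 1) σ = x (τ _ n (face i σ)))
    (hx : ∀ y, τ _ n (face i (ofLabels g (x y))) = y)
    (c : S.Γc (ContinuousMap.id X)) :
    S.δ n i (S.extendLabels g c) = S.extendLabels g' (S.rep h c) := by
  ext z
  rw [coe_δ]
  by_cases hz : z.labels = g'
  · rw [extendLabels_of_eq _ hz]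
    have hy : face i (ofLabels g (x (τ _ n z))) = z :=
      ext_labels (hx _) ((hg _ rfl).1.trans hz.symm)
    -- A string in the fibre with labels `g` has its endpoint prescribed by `x`, so it is the one
    -- already found; all others contribute zero.
    refine (finsum_eq_single _ ⟨_, hy⟩ fun y hne => ?_).trans ?_
    · refine (congrArg _ (extendLabels_of_ne c fun hl => hne ?_)).trans (map_zero _)
      refine Subtype.ext (ext_labels ?_ hl)
      rw [hτ _ hl, y.2]
      rfl
    · refine (congrArg _ (extendLabels_of_eq c (labels_ofLabels g _))).trans ?_
      refine (S.act_section c _ _ _).trans ?_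
      rw [(hg _ rfl).2]
  · rw [extendLabels_of_ne _ hz]
    refine finsum_eq_zero_of_forall_eq_zero fun y => ?_
    refine (congrArg _ (extendLabels_of_ne c fun hl => hz ?_)).trans (map_zero _)
    rw [← y.2, (hg _ hl).1]

/-- The preimage of a string ending at `y` ends at `g₀y`, and the transporting arrow is the inverse
of the first arrow, with group element `g₀⁻¹`. -/
theorem δ_zero_extendLabels (g : Fin (n + 1) → G) (c : S.Γc (ContinuousMap.id X)) :
    S.δ n 0 (S.extendLabels g c) = S.extendLabels (fun i => g i.succ) (S.rep (g 0)⁻¹ c) := by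
  refine S.δ_extendLabels 0 g _ _ (fun σ hσ => ⟨?_, ?_⟩) (fun y => g 0 • y) (fun σ hσ => ?_)
    (fun y => ?_) c
  · rw [labels_face_zero, hσ]
  · subst hσ
    rfl
  · rw [τ_face_zero, hσ]
  · exact smul_left_cancel (g 0) (τ_face_zero (ofLabels g (g 0 • y))).symm

/-- Positive faces keep the endpoint `x₀` and transport by a unit, so only the labels change. -/
theorem δ_succ_extendLabels (j : Fin (n + 1)) (g : Fin (n + 1) → G)
    (c : S.Γc (ContinuousMap.id X)) :
    S.δ n j.succ (S.extendLabels g c) = S.extendLabels (j.contractNth (· * ·) g) c := by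
  refine (S.δ_extendLabels j.succ g (j.contractNth (· * ·) g) 1 (fun σ hσ => ⟨?_, ?_⟩) id
    (fun σ hσ => ?_) (fun y => ?_) c).trans ?_
  · rw [labels_face_succ, hσ]
  · unfold carrier
    rw [if_neg (Fin.succ_ne_zero j)]
    rfl
  · exact τ_face_succ j σ
  · exact (τ_face_succ j _).symm
  · rw [map_one]
    rfl

theorem barD_extendLabels (g : Fin (n + 1) → G) (c : S.Γc (ContinuousMap.id X)) :
    S.barD n (S.extendLabels g c) = S.extendLabels (fun i => g i.succ) (S.rep (g 0)⁻¹ c) +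
      ∑ j : Fin (n + 1), (-1 : ℤ) ^ ((j : ℕ) + 1) • S.extendLabels (j.contractNth (· * ·) g) c := by
  rw [barD, Fin.sum_univ_succ]
  simp only [AddMonoidHom.add_apply, AddMonoidHom.finsetSum_apply, AddMonoidHom.coe_smul,
    Pi.smul_apply, δ_zero_extendLabels, δ_succ_extendLabels, Fin.val_zero, pow_zero, one_smul,
    Fin.val_succ]

end EtaleGroupoid.Sheaf

end TransformationStrings

/-! ### The isomorphism of double complexes. -/

section Comparison

open EtaleGroupoid

variable {G X : Type u} [Group G] [TopologicalSpace G] [DiscreteTopology G] [TopologicalSpace X]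
  [MulAction G X] [ContinuousConstSMul G X]

namespace EtaleGroupoid.Sheaf

variable (S : (transformationGroupoid G X).Sheaf)

/-- The decomposition of sections over the space of strings by labels, as a linear equivalence. -/
noncomputable def sumLabelsEquiv (p : ℕ) :
    ((Fin p → G) →₀ Rep.of S.rep) ≃ₗ[ℤ] S.Γc (Strings.τ (transformationGroupoid G X) p) :=
  LinearEquiv.ofBijective
    { toFun := S.sumLabels
      map_add' := map_add S.sumLabels
      map_smul' := fun m f => map_intCast_smul S.sumLabels ℤ ℤ m f }
    S.bijective_sumLabels

theorem sumLabelsEquiv_single {p : ℕ} (g : Fin p → G) (c : S.Γc (ContinuousMap.id X)) :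
    S.sumLabelsEquiv p (Finsupp.single g c) = S.extendLabels g c :=
  S.sumLabels_single g c

/-- The identification `Γ_c(𝒢^(p); τ_p^*S) = B_p ⊗_{ℤG} Γ_c(X; S)`, where `B` is the bar
resolution. -/
noncomputable def barIso (p : ℕ) :
    ModuleCat.of ℤ (S.Γc (Strings.τ (transformationGroupoid G X) p)) ≅
      ((tensorG ℤ G).obj (Rep.free ℤ G (Fin p → G))).obj (Rep.of S.rep) :=
  ((S.sumLabelsEquiv p).symm ≪≫ₗ tensorFreeEquiv (Fin p → G) (Rep.of S.rep)).toModuleIso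

theorem barIso_hom_extendLabels {p : ℕ} (g : Fin p → G) (c : S.Γc (ContinuousMap.id X)) :
    (S.barIso p).hom.hom (S.extendLabels g c) =
      Representation.Coinvariants.mk
        ((Rep.free ℤ G (Fin p → G)).ρ.tprod (Rep.of S.rep).ρ)
          (Finsupp.single g (.single 1 1) ⊗ₜ c) := by
  change tensorFreeEquiv (Fin p → G) (Rep.of S.rep)
    ((S.sumLabelsEquiv p).symm (S.extendLabels g c)) = _
  rw [← sumLabelsEquiv_single, LinearEquiv.symm_apply_apply]
  exact tensorFreeEquiv_single _ (Rep.of S.rep) g c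

/-- Sections supported on a single sheet generate all sections. -/
theorem hom_ext_extendLabels {p : ℕ} {M : ModuleCat.{u} ℤ}
    {f f' : ModuleCat.of ℤ (S.Γc (Strings.τ (transformationGroupoid G X) p)) ⟶ M}
    (h : ∀ g c, f.hom (S.extendLabels g c) = f'.hom (S.extendLabels g c)) : f = f' := by
  refine ModuleCat.hom_ext (LinearMap.ext fun s => ?_)
  obtain ⟨s, rfl⟩ := S.bijective_sumLabels.2 s
  induction s using Finsupp.induction_linear with
  | zero => simp only [map_zero]
  | add s s' hs hs' => simp only [map_add, hs, hs']
  | single g c =>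
    rw [sumLabels_single]
    exact h g c

/-- On a section supported on one sheet, both sides consist of a leading term and signed
contractions. The contractions match term by term, and the leading terms match by moving `g₀` across
the tensor sign. -/
theorem barIso_hom_d [T2Space X] (p : ℕ) :
    (S.barIso (p + 1)).hom ≫ ((tensorG ℤ G).map (GroupBar.d ℤ G p)).app (Rep.of S.rep) =
      ModuleCat.ofHom (S.barD p).toIntLinearMap ≫ (S.barIso p).hom := by
  refine S.hom_ext_extendLabels fun g c => ?_
  change (((tensorG ℤ G).map (GroupBar.d ℤ G p)).app (Rep.of S.rep)).hom
      ((S.barIso (p + 1)).hom.hom (S.extendLabels g c)) =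
    (S.barIso p).hom.hom (S.barD p (S.extendLabels g c))
  rw [barIso_hom_extendLabels, tensorG_map_app_mk, barD_extendLabels, map_add, map_sum]
  -- The sign of a face is absorbed into the coefficient in `ℤG`, where the bar differential keeps
  -- it.
  have h1 : ∀ (m : ℕ) (g' : Fin p → G) , (S.barIso p).hom.hom ((-1 : ℤ) ^ m • S.extendLabels g' c) =
      Representation.Coinvariants.mk ((Rep.free ℤ G (Fin p → G)).ρ.tprod (Rep.of S.rep).ρ)
          (Finsupp.single g' (.single 1 ((-1) ^ m)) ⊗ₜ c) := by
    intro m g'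
    rw [← map_zsmul, barIso_hom_extendLabels]
    refine Eq.trans ?_ (mk_single_tmul (Fin p → G) (Rep.of S.rep) g' 1 _ c).symm
    rw [inv_one, map_one]
    rfl
  simp only [h1]
  rw [barIso_hom_extendLabels, GroupBar.d_single, TensorProduct.add_tmul, TensorProduct.sum_tmul,
    map_add, map_sum]
  simp only [one_mul]
  refine congrArg (· + _) ?_
  -- The leading term: `g₀[g₁|⋯] ⊗ c` and `[g₁|⋯] ⊗ g₀⁻¹c` have the same class.
  refine (mk_single_tmul (Fin p → G) (Rep.of S.rep) _ (g 0) 1 c).trans ?_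
  rw [one_smul]

theorem Hom.barIso_naturality {S T : (transformationGroupoid G X).Sheaf} (f : S.Hom T) (p : ℕ) :
    (S.barIso p).hom ≫ ((tensorG ℤ G).obj (Rep.free ℤ G (Fin p → G))).map f.mapRep =
      ModuleCat.ofHom (f.mapΓc _).toIntLinearMap ≫ (T.barIso p).hom := by
  refine S.hom_ext_extendLabels fun g c => ?_
  change (((tensorG ℤ G).obj (Rep.free ℤ G (Fin p → G))).map f.mapRep).hom
      ((S.barIso p).hom.hom (S.extendLabels g c)) =
    (T.barIso p).hom.hom (f.mapΓc _ (S.extendLabels g c))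
  rw [barIso_hom_extendLabels, mapΓc_extendLabels, barIso_hom_extendLabels]
  exact tensorG_obj_map_mk _ _ _ _

end EtaleGroupoid.Sheaf

namespace EtaleGroupoid.SheafComplex

variable (S T : (transformationGroupoid G X).SheafComplex) (f : S.Hom T)

/-- The components of the identification of the two double complexes. -/
noncomputable def bidegreeIso (p q : ℕ) :
    ModuleCat.of ℤ ((S.obj q).Γc (Strings.τ (transformationGroupoid G X) p)) ≅
      ((tensorG ℤ G).obj ((GroupBar.complex ℤ G).X p)).obj (S.repComplex.X q) :=
  (S.obj q).barIso p

variable {S T} in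
theorem bidegreeIso_naturality (p q : ℕ) :
    bidegreeMap f p q ≫ (T.bidegreeIso p q).hom = (S.bidegreeIso p q).hom ≫
      ((tensorG ℤ G).map ((𝟙 (GroupBar.complex ℤ G) : _ ⟶ _).f p)).app (S.repComplex.X q) ≫
        ((tensorG ℤ G).obj ((GroupBar.complex ℤ G).X p)).map ((repMap f).f q) := by
  refine ((f.f q).barIso_naturality p).symm.trans (congrArg ((S.bidegreeIso p q).hom ≫ ·) ?_)
  exact tensorG_hom_ext fun m c => rfl

variable [T2Space X]

/-- The double complex `B_p ⊗_{ℤG} Γ_c(X; S^q)`, where `B` is the bar resolution. -/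
noncomputable abbrev hyperBicomplex :
    HomologicalComplex₂ (ModuleCat.{u} ℤ) (ComplexShape.down ℕ) (ComplexShape.up ℕ) :=
  (((tensorG ℤ G).mapBifunctorHomologicalComplex (ComplexShape.down ℕ) (ComplexShape.up ℕ)).obj
    (GroupBar.complex ℤ G)).obj S.repComplex

/-- The identification of the columns of the two double complexes. -/
noncomputable def columnIso (p : ℕ) : S.column p ≅ S.hyperBicomplex.X p :=
  HomologicalComplex.Hom.isoOfComponents (fun q => (S.obj q).barIso p) (by
    rintro q _ rfl
    rw [column_d]
    refine Eq.trans ?_ ((S.d q).barIso_naturality p)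
    change _ ≫ ((tensorG ℤ G).obj (Rep.free ℤ G (Fin p → G))).map (S.repComplex.d q (q + 1)) = _
    rw [repComplex_d]
    rfl)

/-- The double complex `Γ_c(𝒢^(p); τ_p^*S^q)` of the transformation groupoid is
`B_p ⊗_{ℤG} Γ_c(X; S^q)`, where `B` is the bar resolution. -/
noncomputable def bicomplexIso : S.barBicomplex ≅ S.hyperBicomplex :=
  HomologicalComplex.Hom.isoOfComponents S.columnIso (by
    rintro _ p rfl
    rw [barBicomplex_d]
    refine HomologicalComplex.hom_ext _ _ fun q => ?_
    refine Eq.trans ?_ ((S.obj q).barIso_hom_d p)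
    change _ ≫ ((tensorG ℤ G).map ((GroupBar.complex ℤ G).d (p + 1) p)).app (S.repComplex.X q) = _
    rw [GroupBar.complex_d]
    rfl)

/-- The chain complex of the transformation groupoid is isomorphic to the hyperhomology chains
that are formed with the bar resolution. -/
noncomputable def chainsIso : S.chains ≅ hyperChains (GroupBar.complex ℤ G) S.repComplex :=
  HomologicalComplex₂.total.mapIso S.bicomplexIso (ComplexShape.down ℤ)

/-- The inclusion of a summand of the Crainic–Moerdijk chains. -/
noncomputable def ιChains (p q : ℕ) (n : ℤ) (h : (p : ℤ) - q = n) :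
    ModuleCat.of ℤ ((S.obj q).Γc (Strings.τ (transformationGroupoid G X) p)) ⟶ S.chains.X n :=
  S.barBicomplex.ιTotal (ComplexShape.down ℤ) p q n h

variable {S} in
theorem chains_hom_ext {n : ℤ} {M : ModuleCat.{u} ℤ} {f g : S.chains.X n ⟶ M}
    (h : ∀ (p q : ℕ) (hpq : (p : ℤ) - q = n), S.ιChains p q n hpq ≫ f = S.ιChains p q n hpq ≫ g) :
    f = g :=
  HomologicalComplex₂.total.hom_ext (ComplexShape.down ℤ) h

theorem ι_chainsIso_hom (p q : ℕ) (n : ℤ) (h : (p : ℤ) - q = n) :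
    S.ιChains p q n h ≫ S.chainsIso.hom.f n =
      (S.bidegreeIso p q).hom ≫ ιHyper (GroupBar.complex ℤ G) S.repComplex p q n h :=
  HomologicalComplex₂.ιTotal_map _ _ S.bicomplexIso.hom (ComplexShape.down ℤ) p q n h

variable {S T}

theorem ι_chainsMap (p q : ℕ) (n : ℤ) (h : (p : ℤ) - q = n) :
    S.ιChains p q n h ≫ (chainsMap f).f n = bidegreeMap f p q ≫ T.ιChains p q n h :=
  HomologicalComplex₂.ιTotal_map _ _ (barMap f) (ComplexShape.down ℤ) p q n h

theorem chainsIso_hom_naturality :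
    chainsMap f ≫ T.chainsIso.hom =
      S.chainsIso.hom ≫ hyperChainsMap (𝟙 (GroupBar.complex ℤ G)) (repMap f) := by
  refine HomologicalComplex.hom_ext _ _ fun n => chains_hom_ext fun p q h => ?_
  rw [HomologicalComplex.comp_f, HomologicalComplex.comp_f, ← Category.assoc, ← Category.assoc,
    ι_chainsMap, ι_chainsIso_hom, Category.assoc, Category.assoc, ι_chainsIso_hom,
    ι_hyperChainsMap, ← Category.assoc, ← Category.assoc, bidegreeIso_naturality]

end EtaleGroupoid.SheafComplex

end Comparison

/-! ### The component in bidegree `(0, 0)` on each summand. -/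

section TotalProj

variable {k : Type} [CommRing k]
  (K : HomologicalComplex₂ (ModuleCat.{u} k) (ComplexShape.down ℕ) (ComplexShape.up ℕ))

theorem ι_totalProj_zero (h : ((0 : ℕ) : ℤ) - (0 : ℕ) = 0) :
    K.ιTotal (ComplexShape.down ℤ) 0 0 0 h ≫ totalProj K = 𝟙 _ := by
  unfold totalProj
  rw [HomologicalComplex₂.ι_totalDesc, dif_pos ⟨rfl, rfl⟩]
  simp [HomologicalComplex₂.XXIsoOfEq]

theorem ι_totalProj_of_ne (p q : ℕ) (h : (p : ℤ) - q = 0) (hpq : ¬(p = 0 ∧ q = 0)) :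
    K.ιTotal (ComplexShape.down ℤ) p q 0 h ≫ totalProj K = 0 := by
  unfold totalProj
  rw [HomologicalComplex₂.ι_totalDesc, dif_neg hpq]

end TotalProj

/-! ### Functionals on hyperhomology induced by invariant functionals on coefficients. -/

section Hyper

open HomologicalComplex Representation

variable {k : Type} [CommRing k] {G : Type u} [Group G] {P P' : ChainComplex (Rep.{u} k G) ℕ}
  {C C' : CochainComplex (Rep.{u} k G) ℕ}

/-- The total differential on one summand, with its horizontal and its signed vertical part. The
first index is positive, as there is no horizontal part at index zero. -/
theorem ι_hyperChains_d_succ (p q : ℕ) (n m : ℤ) (h : ((p + 1 : ℕ) : ℤ) - q = n)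
    (hm : m + 1 = n) :
    ιHyper P C (p + 1) q n h ≫ (hyperChains P C).d n m =
      ((tensorG k G).map (P.d (p + 1) p)).app (C.X q) ≫
        ιHyper P C p q m (by push_cast at h; omega) +
      (-1 : ℤˣ) ^ (p + 1) • ((tensorG k G).obj (P.X (p + 1))).map (C.d q (q + 1)) ≫
        ιHyper P C (p + 1) (q + 1) m (by push_cast at h ⊢; omega) := by
  have h1 : mapBifunctor.d₁ P C (tensorG k G) (ComplexShape.down ℤ) (p + 1) q m =
      (1 : ℤˣ) • ((tensorG k G).map (P.d (p + 1) p)).app (C.X q) ≫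
        ιHyper P C p q m (by push_cast at h; omega) :=
    mapBifunctor.d₁_eq P C (tensorG k G) (ComplexShape.down ℤ) rfl q m _
  have h2 : mapBifunctor.d₂ P C (tensorG k G) (ComplexShape.down ℤ) (p + 1) q m =
      (-1 : ℤˣ) ^ (p + 1) • ((tensorG k G).obj (P.X (p + 1))).map (C.d q (q + 1)) ≫
        ιHyper P C (p + 1) (q + 1) m (by push_cast at h ⊢; omega) :=
    mapBifunctor.d₂_eq P C (tensorG k G) (ComplexShape.down ℤ) (p + 1) rfl m _
  rw [one_smul] at h1
  rw [← h1, ← h2]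
  refine (congrArg (_ ≫ ·) (mapBifunctor.d_eq P C (tensorG k G) (ComplexShape.down ℤ) n m)).trans ?_
  refine (Preadditive.comp_add _ _ _ _ _ _).trans ?_
  exact congrArg₂ (· + ·) (mapBifunctor.ι_D₁ ..) (mapBifunctor.ι_D₂ ..)

/-- The homomorphism on `k ⊗_{kG} N` that is induced by a `G`-invariant map on `N`. -/
noncomputable def trivialTensorDesc {N : Rep.{u} k G} {A : ModuleCat.{u} k} (I : N →ₗ[k] A)
    (hI : ∀ g n, I (N.ρ g n) = I n) :
    ((tensorG k G).obj (trivialRep k G)).obj N ⟶ A :=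
  ModuleCat.ofHom (Coinvariants.lift _ (TensorProduct.lift
    ((LinearMap.toSpanSingleton k _ I) ∘ₗ ULift.moduleEquiv.toLinearMap)) fun g =>
      TensorProduct.ext' fun r n => by
        change r.down • I (N.ρ g n) = r.down • I n
        rw [hI])

theorem trivialTensorDesc_mk {N : Rep.{u} k G} {A : ModuleCat.{u} k} (I : N →ₗ[k] A)
    (hI : ∀ g n, I (N.ρ g n) = I n) (r : ULift.{u} k) (n : N) :
    (trivialTensorDesc I hI).hom
      (Coinvariants.mk ((trivialRep k G).ρ.tprod N.ρ) (r ⊗ₜ n)) = r.down • I n := rfl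

/-- The augmentation of a resolution of the trivial module. -/
noncomputable abbrev aug (P : ProjectiveResolution (trivialRep.{u} k G)) :
    P.complex.X 0 ⟶ trivialRep k G :=
  (ChainComplex.toSingle₀Equiv P.complex (trivialRep k G) P.π).1

theorem d_aug (P : ProjectiveResolution (trivialRep.{u} k G)) : P.complex.d 1 0 ≫ aug P = 0 :=
  (ChainComplex.toSingle₀Equiv P.complex (trivialRep k G) P.π).2

theorem f_aug {P P' : ProjectiveResolution (trivialRep.{u} k G)} (f : P.complex ⟶ P'.complex)
    (h : f ≫ P'.π = P.π) : f.f 0 ≫ aug P' = aug P :=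
  HomologicalComplex.congr_hom h 0

/-- Exactness of the resolution at `P₀`, on elements. -/
theorem exists_d_of_aug_eq {P : ProjectiveResolution (trivialRep.{u} k G)} (x : P.complex.X 0)
    (h : (aug P).hom x = 0) : ∃ y, (P.complex.d 1 0).hom y = x := by
  have hex := P.exact₀
  rw [← ShortComplex.exact_map_iff_of_faithful _ (forget₂ (Rep.{u} k G) (ModuleCat.{u} k)),
    ShortComplex.moduleCat_exact_iff] at hex
  exact hex x h

/-- The projection of a hyperhomology chain to its component in bidegree `(0, 0)`. -/
noncomputable def hyperProj (P : ChainComplex (Rep.{u} k G) ℕ)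
    (C : CochainComplex (Rep.{u} k G) ℕ) :
    (hyperChains P C).X 0 ⟶ ((tensorG k G).obj (P.X 0)).obj (C.X 0) :=
  totalProj ((((tensorG k G).mapBifunctorHomologicalComplex _ _).obj P).obj C)

/-- The functional on hyperhomology chains of degree zero that is induced by a `G`-invariant map
on `C^0`. -/
noncomputable def hyperDesc (P : ProjectiveResolution (trivialRep.{u} k G))
    (C : CochainComplex (Rep.{u} k G) ℕ) {A : ModuleCat.{u} k} (I : C.X 0 →ₗ[k] A)
    (hI : ∀ g n, I ((C.X 0).ρ g n) = I n) : (hyperChains P.complex C).X 0 ⟶ A :=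
  hyperProj P.complex C ≫ ((tensorG k G).map (aug P)).app (C.X 0) ≫ trivialTensorDesc I hI

variable (P P' : ProjectiveResolution (trivialRep.{u} k G)) (f : P.complex ⟶ P'.complex)
  {A : ModuleCat.{u} k} (I : C.X 0 →ₗ[k] A) (hI : ∀ g n, I ((C.X 0).ρ g n) = I n)

theorem ι_hyperDesc_zero (h : ((0 : ℕ) : ℤ) - (0 : ℕ) = 0) :
    ιHyper P.complex C 0 0 0 h ≫ hyperDesc P C I hI =
      ((tensorG k G).map (aug P)).app (C.X 0) ≫ trivialTensorDesc I hI := by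
  refine (Category.assoc _ _ _).symm.trans ?_
  refine (congrArg (· ≫ _) (ι_totalProj_zero _ h)).trans ?_
  exact Category.id_comp _

theorem ι_hyperDesc_of_ne (p q : ℕ) (h : (p : ℤ) - q = 0) (hpq : ¬(p = 0 ∧ q = 0)) :
    ιHyper P.complex C p q 0 h ≫ hyperDesc P C I hI = 0 := by
  refine (Category.assoc _ _ _).symm.trans ?_
  refine (congrArg (· ≫ _) (ι_totalProj_of_ne _ p q h hpq)).trans ?_
  exact Limits.zero_comp

/-- Chains of degree `1` sit in bidegrees `(q + 1, q)`. Vertical differentials from there never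
reach `(0, 0)`, and the only horizontal one that does is `P₁ → P₀`, which the augmentation kills. -/
theorem d_hyperDesc : (hyperChains P.complex C).d 1 0 ≫ hyperDesc P C I hI = 0 := by
  refine hyperChains_hom_ext fun p q h => ?_
  obtain _ | p := p
  · exfalso
    push_cast at h
    omega
  rw [Limits.comp_zero, ← Category.assoc, ι_hyperChains_d_succ _ _ _ _ h (zero_add 1),
    Preadditive.add_comp, Linear.units_smul_comp, Category.assoc, Category.assoc,
    ι_hyperDesc_of_ne _ _ _ (p + 1), Limits.comp_zero, smul_zero, add_zero]
  · obtain _ | p := p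
    · obtain rfl : q = 0 := by push_cast at h; omega
      rw [ι_hyperDesc_zero, ← Category.assoc, ← NatTrans.comp_app, ← Functor.map_comp, d_aug,
        Functor.map_zero, Limits.zero_app, Limits.zero_comp]
    · rw [ι_hyperDesc_of_ne, Limits.comp_zero]
      simp
  · simp

/-- The functional sees `P` only through the augmentation, which `f` preserves. -/
theorem hyperChainsMap_hyperDesc (h : f ≫ P'.π = P.π) :
    (hyperChainsMap f (𝟙 C)).f 0 ≫ hyperDesc P' C I hI = hyperDesc P C I hI := by
  refine hyperChains_hom_ext fun p q hpq => ?_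
  rw [← Category.assoc, ι_hyperChainsMap, Category.assoc]
  by_cases h0 : p = 0 ∧ q = 0
  · obtain ⟨rfl, rfl⟩ := h0
    rw [ι_hyperDesc_zero, ι_hyperDesc_zero, ← f_aug f h]
    exact tensorG_hom_ext fun m c => rfl
  · rw [ι_hyperDesc_of_ne _ _ _ _ _ _ h0, ι_hyperDesc_of_ne _ _ _ _ _ _ h0, Limits.comp_zero]

/-- On `g ⊗ c` the augmentation gives `I c`, while the identification `ℤG ⊗_{ℤG} N = N` gives `I
(g⁻¹c)`; these agree because `I` is invariant. -/
theorem hyperDesc_eq_hyperComponent (e : P.complex.X 0 ≅ Rep.leftRegular k G)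
    (h : aug P = e.hom ≫ augmentation k G) :
    hyperDesc P C I hI = hyperComponent e C ≫ ModuleCat.ofHom I := by
  have hc : hyperComponent e C = hyperProj P.complex C ≫ ((tensorG k G).map e.hom).app (C.X 0) ≫
    leftRegularTensor (C.X 0) := rfl
  rw [hc, Category.assoc, Category.assoc]
  unfold hyperDesc
  rw [h, Functor.map_comp, NatTrans.comp_app, Category.assoc]
  refine congrArg (hyperProj _ _ ≫ ·) (congrArg (((tensorG k G).map e.hom).app (C.X 0) ≫ ·) ?_)
  refine ModuleCat.hom_ext (Coinvariants.hom_ext (TensorProduct.ext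
    (MonoidAlgebra.lhom_ext' fun g => LinearMap.ext_ring (LinearMap.ext fun c => ?_))))
  change (trivialTensorDesc I hI).hom (Coinvariants.mk ((trivialRep k G).ρ.tprod (C.X 0).ρ)
      ((augmentation k G).hom (.single g 1) ⊗ₜ c)) = I ((leftRegularTensor (C.X 0)).hom
        (Coinvariants.mk ((Rep.leftRegular k G).ρ.tprod (C.X 0).ρ) (.single g 1 ⊗ₜ c)))
  rw [leftRegularTensor_apply, augmentation_apply, trivialTensorDesc_mk, hI, one_smul]

end Hyper

/-! ### Homology classes and functionals in terms of cycles. -/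

section HomologyElements

open HomologicalComplex

variable {k : Type} [CommRing k] (K : ChainComplex (ModuleCat.{u} k) ℤ)

theorem homologyπ_eq_of_sub_eq_d {n m : ℤ} (z w : K.cycles n) (y : K.X m)
    (h : (K.iCycles n).hom z - (K.iCycles n).hom w = (K.d m n).hom y) :
    (K.homologyπ n).hom z = (K.homologyπ n).hom w := by
  -- The relation is known only between chains; it lifts to cycles because the inclusion of cycles
  -- is injective.
  have h1 : z - w = (K.toCycles m n).hom y := by
    refine (ModuleCat.mono_iff_injective (K.iCycles n)).1 inferInstance ?_
    refine (map_sub (K.iCycles n).hom z w).trans (h.trans ?_)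
    rw [← K.toCycles_i m n]
    rfl
  rw [← sub_eq_zero, ← map_sub, h1]
  have := K.toCycles_comp_homologyπ m n
  exact congrArg (fun f => f.hom y) this

/-- A functional on chains that vanishes on boundaries induces a functional on homology. -/
noncomputable def homologyDesc (n m : ℤ) (hm : n + 1 = m) {A : ModuleCat.{u} k} (φ : K.X n ⟶ A)
    (h : K.d m n ≫ φ = 0) : K.homology n ⟶ A :=
  (K.homologyIsCokernel m n ((ComplexShape.down ℤ).prev_eq' hm)).desc
    (Limits.CokernelCofork.ofπ (K.iCycles n ≫ φ) (by
      rw [← Category.assoc, toCycles_i, h]))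

theorem homologyπ_homologyDesc (n m : ℤ) (hm : n + 1 = m) {A : ModuleCat.{u} k} (φ : K.X n ⟶ A)
    (h : K.d m n ≫ φ = 0) : K.homologyπ n ≫ homologyDesc K n m hm φ h = K.iCycles n ≫ φ :=
  (K.homologyIsCokernel m n ((ComplexShape.down ℤ).prev_eq' hm)).fac _
    Limits.WalkingParallelPair.one

end HomologyElements

/-! ### Classes of the form `p ⊗ c` in hyperhomology. -/

section EdgeTensor

open Representation

variable {k : Type} [CommRing k] {G : Type u} [Group G]
  (P : ProjectiveResolution (trivialRep.{u} k G))

/-- A comparison map from the bar resolution to a resolution of the trivial module. -/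
noncomputable def GroupBar.lift : GroupBar.complex k G ⟶ P.complex :=
  ProjectiveResolution.lift (𝟙 (trivialRep k G)) (GroupBar.resolution k G) P

theorem GroupBar.lift_π : GroupBar.lift P ≫ P.π = (GroupBar.resolution k G).π := by
  refine (ProjectiveResolution.lift_commutes _ _ _).trans ?_
  rw [CategoryTheory.Functor.map_id, Category.comp_id]

theorem GroupBar.aug_resolution : aug (GroupBar.resolution.{u} k G) = GroupBar.ε k G :=
  ChainComplex.toSingle₀Equiv_symm_apply_f_zero _ _

/-- The empty symbol has augmentation `1` and comparison maps preserve the augmentation, so its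
image is an admissible choice of `p` in the formula for edge classes. -/
theorem GroupBar.aug_lift (x : Fin 0 → G) :
    (aug P).hom (((GroupBar.lift P).f 0).hom (Finsupp.single x (.single 1 1))) = ULift.up 1 := by
  have h := f_aug (P := GroupBar.resolution k G) _ (GroupBar.lift_π P)
  rw [GroupBar.aug_resolution] at h
  exact (congrArg (fun f => f.hom (Finsupp.single x (.single 1 1))) h).trans
    (GroupBar.ε_single _ _ _)

variable {P} {C : CochainComplex (Rep.{u} k G) ℕ}

theorem hyperChains_d_ι_of_map_d_eq_zero {P : ChainComplex (Rep.{u} k G) ℕ} (p q : ℕ) (n m : ℤ)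
    (h : ((p + 1 : ℕ) : ℤ) - q = n) (hm : m + 1 = n)
    (x : ((tensorG k G).obj (P.X (p + 1))).obj (C.X q))
    (hx : (((tensorG k G).obj (P.X (p + 1))).map (C.d q (q + 1))).hom x = 0) :
    ((hyperChains P C).d n m).hom ((ιHyper P C (p + 1) q n h).hom x) =
      (ιHyper P C p q m (by push_cast at h; omega)).hom
        ((((tensorG k G).map (P.d (p + 1) p)).app (C.X q)).hom x) := by
  refine (congrArg (fun f => f.hom x) (ι_hyperChains_d_succ p q n m h hm)).trans ?_
  rw [← Linear.units_smul_comp]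
  -- The vertical part vanishes whichever sign it carries.
  have h0 : ((-1 : ℤˣ) ^ (p + 1) • ((tensorG k G).obj (P.X (p + 1))).map (C.d q (q + 1))).hom x =
      0 := by
    obtain h | h := Int.units_eq_one_or ((-1 : ℤˣ) ^ (p + 1))
    · rw [h, one_smul, hx]
    · rw [h, Units.neg_smul, one_smul, ModuleCat.hom_neg, LinearMap.neg_apply, hx, neg_zero]
  refine (congrArg (_ + ·) ((congrArg (ModuleCat.Hom.hom (ιHyper P C (p + 1) (q + 1) m _))
    h0).trans (map_zero _))).trans ?_
  exact add_zero _

/-- The class of `p ⊗ c`, for a cocycle `c`, depends only on `c` and on the augmentation of `p`. -/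
theorem exists_edgeTensor_sub_eq_d {q : ℕ} (p p' : P.complex.X 0) (c : C.X q)
    (hc : (C.d q (q + 1)).hom c = 0) (hp : (aug P).hom p = (aug P).hom p') :
    ∃ y, edgeTensor (C := C) p c - edgeTensor (C := C) p' c =
      ((hyperChains P.complex C).d (-(q : ℤ) + 1) (-(q : ℤ))).hom y := by
  -- Equal augmentations make `p - p'` a boundary `dy`. The element `y ⊗ c` then has boundary `(p -
  -- p') ⊗ c`, its vertical part being killed by `dc = 0`.
  obtain ⟨y, hy⟩ := exists_d_of_aug_eq (P := P) (p - p') (by rw [map_sub, hp, sub_self])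
  have hn : ((0 + 1 : ℕ) : ℤ) - q = -(q : ℤ) + 1 := by push_cast; ring
  refine ⟨(ιHyper P.complex C 1 q _ hn).hom
    (Coinvariants.mk ((P.complex.X 1).ρ.tprod (C.X q).ρ) (y ⊗ₜ c)), ?_⟩
  have h2 : (((tensorG k G).obj (P.complex.X 1)).map (C.d q (q + 1))).hom
      (Coinvariants.mk ((P.complex.X 1).ρ.tprod (C.X q).ρ) (y ⊗ₜ c)) = 0 := by
    rw [tensorG_obj_map_mk, hc, TensorProduct.tmul_zero]
    exact map_zero _
  have h3 : (((tensorG k G).map (P.complex.d 1 0)).app (C.X q)).hom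
      (Coinvariants.mk ((P.complex.X 1).ρ.tprod (C.X q).ρ) (y ⊗ₜ c)) =
      Coinvariants.mk ((P.complex.X 0).ρ.tprod (C.X q).ρ) (p ⊗ₜ c) -
      Coinvariants.mk ((P.complex.X 0).ρ.tprod (C.X q).ρ) (p' ⊗ₜ c) := by
    rw [tensorG_map_app_mk, hy, TensorProduct.sub_tmul, map_sub]
  refine Eq.trans ?_ (hyperChains_d_ι_of_map_d_eq_zero 0 q _ _ hn rfl _ h2).symm
  refine Eq.trans ?_ (congrArg (ιHyper P.complex C 0 q (-(q : ℤ)) (zero_sub _)).hom h3).symm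
  exact (map_sub (ιHyper P.complex C 0 q (-(q : ℤ)) (zero_sub _)).hom _ _).symm

end EdgeTensor

/-! ### Invariant integration and the comparison map. -/

section Transformation

open MeasureTheory EtaleGroupoid HomologicalComplex

variable {G X : Type u} [Group G] [TopologicalSpace G] [DiscreteTopology G] [TopologicalSpace X]
  [MulAction G X] [ContinuousConstSMul G X]

/-- For open `U`, the arrows with group element `g` and range in `U` form an open bisection with
source `g⁻¹U` and range `U`. Invariance under bisections thus gives invariance under `g` on open
sets. -/
theorem EtaleGroupoid.IsInvariant.map_smul [MeasurableSpace X] [BorelSpace X] {μ : Measure X}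
    [IsFiniteMeasure μ] (hμ : (transformationGroupoid G X).IsInvariant μ) (g : G) :
    μ.map (fun x => g • x) = μ := by
  have hm : Measurable fun x : X => g • x := (continuous_const_smul g).measurable
  have hU : ∀ U : Set X, IsOpen U → μ.map (fun x => g • x) U = μ U := by
    intro U hU
    rw [Measure.map_apply hm hU.measurableSet]
    have h := hμ ({p : G × X | p.1 = g ∧ g • p.2 ∈ U})
      (((isOpen_discrete {g}).preimage continuous_fst).inter
        (hU.preimage ((continuous_const_smul g).comp continuous_snd)))
      (fun p hp q hq h => Prod.ext (hp.1.trans hq.1.symm) h) (fun p hp q hq h => by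
        change p.1 • p.2 = q.1 • q.2 at h
        refine Prod.ext (hp.1.trans hq.1.symm) ?_
        rw [hp.1, hq.1] at h
        exact smul_left_cancel g h)
    have h1 : (transformationGroupoid G X).src '' {p : G × X | p.1 = g ∧ g • p.2 ∈ U} =
        (fun x => g • x) ⁻¹' U := by
      ext x
      constructor
      · rintro ⟨p, hp, rfl⟩
        exact hp.2
      · exact fun hx => ⟨(g, x), ⟨rfl, hx⟩, rfl⟩
    have h2 : (transformationGroupoid G X).rng '' {p : G × X | p.1 = g ∧ g • p.2 ∈ U} = U := by
      ext x
      constructor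
      · rintro ⟨p, hp, rfl⟩
        change p.1 • p.2 ∈ U
        rw [hp.1]
        exact hp.2
      · intro hx
        refine ⟨(g, g⁻¹ • x), ⟨rfl, ?_⟩, smul_inv_smul g x⟩
        change g • g⁻¹ • x ∈ U
        rwa [smul_inv_smul]
    rwa [h1, h2] at h
  -- Open sets form a π-system generating the Borel σ-algebra, and the total masses agree;
  -- finiteness of `μ` makes this sufficient.
  exact ext_of_generate_finite _ (BorelSpace.measurable_eq (α := X)) isPiSystem_isOpen
    (fun U => hU U) (hU _ isOpen_univ)

namespace EtaleGroupoid.BorelRealization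

variable [MeasurableSpace X] {S : (transformationGroupoid G X).Sheaf} (β : BorelRealization S)
  (μ : Measure X)

/-- On a compact space the Borel function of a global section is measurable and bounded. -/
theorem integrable_ev [CompactSpace X] [IsFiniteMeasure μ] (c : S.Γc (ContinuousMap.id X)) :
    Integrable (fun x => β.ev x (c.1 x)) μ := by
  have hs : S.IsSectionOn Set.univ c.1 := c.2.1.continuousOn
  obtain ⟨b, hb⟩ := β.bounded Set.univ c.1 isOpen_univ hs Set.univ subset_rfl isCompact_univ
  have hm : Measurable fun x => β.ev x (c.1 x) :=
    (β.measurable Set.univ c.1 isOpen_univ hs).comp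
      (measurable_id.subtype_mk (h := fun x => Set.mem_univ x))
  exact Integrable.of_bound hm.aestronglyMeasurable b
    (Filter.Eventually.of_forall fun x => hb x (Set.mem_univ x))

/-- Integration of sections, as a homomorphism. -/
noncomputable def integral [CompactSpace X] [IsFiniteMeasure μ] :
    S.Γc (ContinuousMap.id X) →+ ULift.{u} ℂ where
  toFun c := ULift.up (∫ x, β.ev x (c.1 x) ∂μ)
  map_zero' := ULift.ext _ _ (by
    refine (integral_congr_ae (Filter.Eventually.of_forall fun x => ?_)).trans
      (MeasureTheory.integral_zero X ℂ)
    exact map_zero (β.ev x))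
  map_add' c c' := ULift.ext _ _ (by
    refine (integral_congr_ae (Filter.Eventually.of_forall fun x => ?_)).trans
      (integral_add (β.integrable_ev μ c) (β.integrable_ev μ c'))
    exact map_add (β.ev x) _ _)

/-- Equivariance of the realization turns a translated section into the function composed with
`g⁻¹`; the claim is then a change of variables for an invariant measure. -/
theorem integral_rep [BorelSpace X] [CompactSpace X] [IsFiniteMeasure μ]
    (hμ : (transformationGroupoid G X).IsInvariant μ) (g : G) (c : S.Γc (ContinuousMap.id X)) :
    β.integral μ (S.rep g c) = β.integral μ c := by
  refine ULift.ext _ _ ?_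
  change ∫ x, β.ev x ((S.rep g c).1 x) ∂μ = ∫ x, β.ev x (c.1 x) ∂μ
  have h1 : ∀ x, β.ev x ((S.rep g c).1 x) = β.ev (g⁻¹ • x) (c.1 (g⁻¹ • x)) := fun x =>
    β.equivariant _ _ _ _
  simp only [h1]
  have hm : Measurable fun x : X => g⁻¹ • x := (continuous_const_smul g⁻¹).measurable
  -- Only the measure on the right is replaced by its pushforward.
  conv_rhs => rw [← hμ.map_smul g⁻¹]
  rw [integral_map hm.aemeasurable]
  rw [hμ.map_smul]
  exact (β.integrable_ev μ c).aestronglyMeasurable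

end EtaleGroupoid.BorelRealization

variable [T2Space X] (S T : (transformationGroupoid G X).SheafComplex)
  (P : ProjectiveResolution (trivialRep.{u} ℤ G))

/-- The chain map from the Crainic–Moerdijk chains to the hyperhomology chains. -/
noncomputable def comparison : S.chains ⟶ hyperChains P.complex S.repComplex :=
  S.chainsIso.hom ≫ hyperChainsMap (GroupBar.lift P) (𝟙 S.repComplex)

/-- The comparison isomorphism between the Crainic–Moerdijk homology of the transformation groupoid
and group hyperhomology. -/
noncomputable def comparisonIso (n : ℤ) : S.homology n ≅ hyperhomology P S.repComplex n :=
  (homologyFunctor _ _ n).mapIso S.chainsIso ≪≫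
    hyperhomologyIso (GroupBar.resolution ℤ G) P S.repComplex n

theorem comparisonIso_hom (n : ℤ) :
    (comparisonIso S P n).hom = homologyMap (comparison S P) n :=
  (homologyMap_comp _ _ n).symm

variable {S T} in
theorem comparison_naturality (f : S.Hom T) :
    SheafComplex.chainsMap f ≫ comparison T P =
      comparison S P ≫ hyperChainsMap (𝟙 P.complex) (SheafComplex.repMap f) := by
  unfold comparison
  rw [← Category.assoc, SheafComplex.chainsIso_hom_naturality, Category.assoc, Category.assoc,
    ← hyperChainsMap_comp, ← hyperChainsMap_comp, Category.id_comp, Category.comp_id,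
    Category.comp_id, Category.id_comp]

/-- The lift to `P` followed by `f` and the chosen lift to `P'` both cover the identity of `ℤ`, so
they agree on homology. -/
theorem homologyMap_comparison_comp {P P' : ProjectiveResolution (trivialRep.{u} ℤ G)}
    (f : P.complex ⟶ P'.complex) (hf : f ≫ P'.π = P.π) (n : ℤ) :
    homologyMap (comparison S P) n ≫ homologyMap (hyperChainsMap f (𝟙 S.repComplex)) n =
      homologyMap (comparison S P') n := by
  unfold comparison
  rw [← homologyMap_comp, Category.assoc, ← hyperChainsMap_comp, Category.comp_id,
    homologyMap_comp, homologyMap_comp]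
  refine congrArg (_ ≫ ·) ?_
  have h1 : (GroupBar.lift P ≫ f) ≫ P'.π = (GroupBar.resolution ℤ G).π := by
    rw [Category.assoc, hf, GroupBar.lift_π]
  exact homologyMap_hyperChainsMap_eq (P := GroupBar.resolution ℤ G) _ _
    (h1.trans (GroupBar.lift_π P').symm) _ h1 n

/-- In bidegree `(0, q)` the bar identification sends `a` to `[] ⊗ a`, and the comparison map acts
on the first factor only. -/
theorem comparison_edge (q : ℕ) (a : (S.obj q).Γc (Strings.τ (transformationGroupoid G X) 0))
    (a' : (S.obj q).Γc (ContinuousMap.id X))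
    (ha : ∀ x, a'.1 x = a.1 (Strings.ofObj (transformationGroupoid G X) x)) :
    ((comparison S P).f (-(q : ℤ))).hom ((edge S.barBicomplex q).hom a) =
      edgeTensor (C := S.repComplex) (q := q)
        (((GroupBar.lift P).f 0).hom (Finsupp.single ![] (.single 1 1))) a' := by
  -- Strings of length zero have empty labels, so there is a single sheet and `a` is the extension
  -- of `a'` from it.
  have h : a = (S.obj q).extendLabels ![] a' := by
    refine Subtype.ext (funext fun σ => ?_)
    obtain ⟨x, rfl⟩ : ∃ x, Strings.ofObj _ x = σ :=
      ⟨Strings.τ _ 0 σ, Strings.ext_labels rfl (Subsingleton.elim _ _)⟩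
    exact (ha x).symm.trans (Sheaf.extendLabels_of_eq (S := S.obj q)
      (σ := Strings.ofObj (transformationGroupoid G X) x) a' (Subsingleton.elim _ _)).symm
  subst h
  have h1 : S.ιChains 0 q _ (zero_sub (q : ℤ)) ≫ (comparison S P).f (-(q : ℤ)) =
      (S.bidegreeIso 0 q).hom ≫ (((tensorG ℤ G).map ((GroupBar.lift P).f 0)).app _ ≫
        ((tensorG ℤ G).obj (P.complex.X 0)).map (𝟙 _)) ≫
          ιHyper P.complex S.repComplex 0 q _ (zero_sub (q : ℤ)) := by
    unfold comparison
    rw [HomologicalComplex.comp_f, ← Category.assoc, SheafComplex.ι_chainsIso_hom, Category.assoc,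
      ι_hyperChainsMap]
    rfl
  refine (congrArg (fun f => f.hom ((S.obj q).extendLabels ![] a')) h1).trans ?_
  rw [CategoryTheory.Functor.map_id, Category.comp_id]
  change (ιHyper P.complex S.repComplex 0 q _ (zero_sub (q : ℤ))).hom
    ((((tensorG ℤ G).map ((GroupBar.lift P).f 0)).app (S.repComplex.X q)).hom
      (((S.obj q).barIso 0).hom.hom ((S.obj q).extendLabels ![] a'))) = _
  rw [Sheaf.barIso_hom_extendLabels]
  rfl

end Transformation

/-! ### Compatibility of the comparison with invariant functionals. -/

section Pairing

open MeasureTheory EtaleGroupoid HomologicalComplex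

variable {G X : Type u} [Group G] [TopologicalSpace G] [DiscreteTopology G] [TopologicalSpace X]
  [MulAction G X] [ContinuousConstSMul G X] [T2Space X]

/-- The functional on the Crainic–Moerdijk chains of degree zero that is induced by a functional
on sections. -/
noncomputable def EtaleGroupoid.SheafComplex.chainsDesc
    (S : (transformationGroupoid G X).SheafComplex) {A : Type u} [AddCommGroup A]
    (I : (S.obj 0).Γc (ContinuousMap.id X) →+ A) : S.chains.X 0 ⟶ ModuleCat.of ℤ A :=
  totalProj S.barBicomplex ≫
    ModuleCat.ofHom (I.comp ((S.obj 0).restrictLabels (![] : Fin 0 → G))).toIntLinearMap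

/-- Only bidegree `(0, 0)` matters. There a section `c` becomes `[] ⊗ c`, and `[]` has augmentation
`1`, so the value is `I c`. -/
theorem EtaleGroupoid.SheafComplex.chainsIso_hom_hyperDesc
    (S : (transformationGroupoid G X).SheafComplex) {A : Type u} [AddCommGroup A]
    (I : (S.obj 0).Γc (ContinuousMap.id X) →+ A)
    (hI : ∀ g c, I ((S.obj 0).rep g c) = I c) :
    S.chainsIso.hom.f 0 ≫
      hyperDesc (GroupBar.resolution ℤ G) S.repComplex (A := ModuleCat.of ℤ A) I.toIntLinearMap hI =
        S.chainsDesc I := by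
  refine chains_hom_ext fun p q h => ?_
  refine (Category.assoc _ _ _).symm.trans ?_
  refine (congrArg (· ≫ _) (S.ι_chainsIso_hom p q 0 h)).trans ((Category.assoc _ _ _).trans ?_)
  by_cases h0 : p = 0 ∧ q = 0
  · obtain ⟨rfl, rfl⟩ := h0
    refine (congrArg (_ ≫ ·) (ι_hyperDesc_zero (GroupBar.resolution ℤ G) _ hI h)).trans ?_
    refine Eq.trans ?_ ((congrArg (· ≫ _) (ι_totalProj_zero S.barBicomplex h)).symm.trans
      (Category.assoc _ _ _))
    refine Eq.trans ?_ (Category.id_comp _).symm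
    refine (S.obj 0).hom_ext_extendLabels fun g c => ?_
    obtain rfl := Subsingleton.elim ![] g
    let t := trivialTensorDesc (N := S.repComplex.X 0) (A := ModuleCat.of ℤ A) I.toIntLinearMap hI
    -- The value is regarded as a function of the augmentation, so that the one extracted from the
    -- resolution can be replaced by the explicit `ε`.
    let F (η : Rep.free ℤ G (Fin 0 → G) ⟶ trivialRep ℤ G) : A :=
      t.hom ((((tensorG ℤ G).map η).app (S.repComplex.X 0)).hom
        (((S.obj 0).barIso 0).hom.hom ((S.obj 0).extendLabels ![] c)))
    refine (congrArg F GroupBar.aug_resolution).trans ?_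
    change F _ = I ((S.obj 0).restrictLabels ![] ((S.obj 0).extendLabels ![] c))
    simp only [F]
    rw [Sheaf.barIso_hom_extendLabels, Sheaf.restrictLabels_extendLabels_self]
    refine (congrArg t.hom (tensorG_map_app_mk (GroupBar.ε ℤ G) (S.repComplex.X 0) _ _)).trans ?_
    rw [GroupBar.ε_single]
    exact one_smul ℤ (I c)
  · refine (congrArg (_ ≫ ·)
      (ι_hyperDesc_of_ne (GroupBar.resolution ℤ G) _ hI p q h h0)).trans ?_
    refine Limits.comp_zero.trans ?_
    refine Eq.trans ?_ ((congrArg (· ≫ _) (ι_totalProj_of_ne S.barBicomplex p q h h0)).symm.trans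
      (Category.assoc _ _ _))
    exact Limits.zero_comp.symm

theorem comparison_hyperDesc (S : (transformationGroupoid G X).SheafComplex)
    (P : ProjectiveResolution (trivialRep.{u} ℤ G)) {A : Type u} [AddCommGroup A]
    (I : (S.obj 0).Γc (ContinuousMap.id X) →+ A) (hI : ∀ g c, I ((S.obj 0).rep g c) = I c) :
    (comparison S P).f 0 ≫ hyperDesc P S.repComplex (A := ModuleCat.of ℤ A) I.toIntLinearMap hI =
      S.chainsDesc I := by
  unfold comparison
  rw [HomologicalComplex.comp_f, Category.assoc]
  refine (congrArg (_ ≫ ·) (hyperChainsMap_hyperDesc (GroupBar.resolution ℤ G) P (GroupBar.lift P)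
    _ hI (GroupBar.lift_π P))).trans ?_
  exact S.chainsIso_hom_hyperDesc I hI

/-- A single functional on hyperhomology yields both pairings: directly, and by composition with the
comparison isomorphism. The second condition evaluates the composite on groupoid cycles. -/
theorem exists_hyperhomology_functional (S : (transformationGroupoid G X).SheafComplex)
    (P : ProjectiveResolution (trivialRep.{u} ℤ G)) {A : Type u} [AddCommGroup A]
    (I : (S.obj 0).Γc (ContinuousMap.id X) →+ A) (hI : ∀ g c, I ((S.obj 0).rep g c) = I c) :
    ∃ ρ : hyperhomology P S.repComplex 0 →+ A,
      (∀ w, ρ (((hyperChains P.complex S.repComplex).homologyπ 0).hom w) =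
        (hyperDesc P S.repComplex (A := ModuleCat.of ℤ A) I.toIntLinearMap hI).hom
          (((hyperChains P.complex S.repComplex).iCycles 0).hom w)) ∧
      ∀ z, ρ ((comparisonIso S P 0).hom.hom ((S.chains.homologyπ 0).hom z)) =
        (S.chainsDesc I).hom ((S.chains.iCycles 0).hom z) := by
  let φ : (hyperChains P.complex S.repComplex).X 0 ⟶ ModuleCat.of ℤ A :=
    hyperDesc P S.repComplex (A := ModuleCat.of ℤ A) I.toIntLinearMap hI
  have hφ : (hyperChains P.complex S.repComplex).d 1 0 ≫ φ = 0 :=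
    d_hyperDesc P (C := S.repComplex) (A := ModuleCat.of ℤ A) I.toIntLinearMap hI
  have hπ := homologyπ_homologyDesc (hyperChains P.complex S.repComplex) 0 1 (zero_add 1) φ hφ
  refine ⟨(homologyDesc (hyperChains P.complex S.repComplex) 0 1 (zero_add 1) φ
    hφ).hom.toAddMonoidHom, fun w => congrArg (fun f => f.hom w) hπ, fun z => ?_⟩
  have h : S.chains.homologyπ 0 ≫ (comparisonIso S P 0).hom ≫
      homologyDesc (hyperChains P.complex S.repComplex) 0 1 (zero_add 1) φ hφ =
        S.chains.iCycles 0 ≫ S.chainsDesc I := by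
    rw [comparisonIso_hom, homologyπ_naturality_assoc, hπ, cyclesMap_i_assoc,
      ← comparison_hyperDesc S P I hI]
  exact congrArg (fun f => f.hom z) h

end Pairing

end CrainicMoerdijk

/-! ### Assembly of the main theorem. -/

theorem mainTheorem5 {G X : Type u} [Group G] [TopologicalSpace G] [DiscreteTopology G]
    [TopologicalSpace X] [T2Space X] [LocallyCompactSpace X] [MulAction G X]
    [ContinuousConstSMul G X] [MeasurableSpace X] [BorelSpace X] :
    ∃ Φ : ∀ (S : (transformationGroupoid G X).CSoftResolution
          (transformationGroupoid G X).constSheaf)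
        (P : ProjectiveResolution (trivialRep ℤ G)) (n : ℤ),
        S.toSheafComplex.homology n ≅ hyperhomology P S.repComplex n,
      -- `Φ` is natural for morphisms of resolutions of the constant sheaf
      (∀ (S S' : (transformationGroupoid G X).CSoftResolution
            (transformationGroupoid G X).constSheaf)
          (f : S.toSheafComplex.Hom S'.toSheafComplex)
          (P : ProjectiveResolution (trivialRep ℤ G)) (n : ℤ),
        HomologicalComplex.homologyMap (EtaleGroupoid.SheafComplex.chainsMap f) n ≫
            (Φ S' P n).hom =
          (Φ S P n).hom ≫ HomologicalComplex.homologyMap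
            (hyperChainsMap (𝟙 P.complex) (EtaleGroupoid.SheafComplex.repMap f)) n) ∧
      -- `Φ` is natural for morphisms of projective resolutions of the trivial module
      (∀ (S : (transformationGroupoid G X).CSoftResolution
            (transformationGroupoid G X).constSheaf)
          (P P' : ProjectiveResolution (trivialRep ℤ G)) (f : P.complex ⟶ P'.complex),
        f ≫ P'.π = P.π → ∀ n : ℤ,
          (Φ S P n).hom ≫ HomologicalComplex.homologyMap
            (hyperChainsMap f (𝟙 S.repComplex)) n = (Φ S P' n).hom) ∧
      -- `Φ` sends the class of a vertical cocycle `a ∈ Γ_c(𝒢^(0); S^q)` to the class of `p ⊗ a`,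
      -- for every `p ∈ P_0` that is mapped to `1` by the augmentation `P_0 → ℤ`
      (∀ (S : (transformationGroupoid G X).CSoftResolution
            (transformationGroupoid G X).constSheaf)
          (P : ProjectiveResolution (trivialRep ℤ G)) (q : ℕ)
          (a : (S.obj q).Γc (EtaleGroupoid.Strings.τ (transformationGroupoid G X) 0))
          (a' : (S.obj q).Γc (ContinuousMap.id X)) (p : P.complex.X 0)
          (z : S.chains.cycles (-(q : ℤ)))
          (w : (hyperChains P.complex S.repComplex).cycles (-(q : ℤ))),
        (∀ x, a'.1 x = a.1 (EtaleGroupoid.Strings.ofObj (transformationGroupoid G X) x)) →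
        (S.d q).mapΓc _ a = 0 →
        (ChainComplex.toSingle₀Equiv P.complex (trivialRep ℤ G) P.π).1.hom p = ULift.up 1 →
        (S.chains.iCycles _).hom z = (edge S.barBicomplex q).hom a →
        ((hyperChains P.complex S.repComplex).iCycles _).hom w =
          edgeTensor (C := S.repComplex) (q := q) p a' →
        (Φ S P _).hom.hom ((S.chains.homologyπ _).hom z) =
          ((hyperChains P.complex S.repComplex).homologyπ _).hom w) ∧
      -- if `X` is compact, then the pairings with invariant probability measures are well defined
      -- on homology, and `Φ` is compatible with them
      (∀ (S : (transformationGroupoid G X).CSoftResolution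
            (transformationGroupoid G X).constSheaf)
          (β : EtaleGroupoid.BorelStructure S) (P : ProjectiveResolution (trivialRep ℤ G))
          (e : P.complex.X 0 ≅ Rep.leftRegular ℤ G) (μ : MeasureTheory.Measure X),
        CompactSpace X → MeasureTheory.IsProbabilityMeasure μ →
        (transformationGroupoid G X).IsInvariant μ →
        (ChainComplex.toSingle₀Equiv P.complex (trivialRep ℤ G) P.π).1 =
          e.hom ≫ augmentation ℤ G →
        ∃ (ρ : S.toSheafComplex.homology 0 →+ ℂ) (ρ' : hyperhomology P S.repComplex 0 →+ ℂ),
          (∀ z : S.chains.cycles 0, ρ ((S.chains.homologyπ 0).hom z) =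
            β.pairing μ ((S.chains.iCycles 0).hom z)) ∧
          (∀ w : (hyperChains P.complex S.repComplex).cycles 0,
            ρ' (((hyperChains P.complex S.repComplex).homologyπ 0).hom w) =
              hyperPairing β e μ (((hyperChains P.complex S.repComplex).iCycles 0).hom w)) ∧
          ∀ h, ρ' ((Φ S P 0).hom.hom h) = ρ h) := by
  refine ⟨fun S P n => comparisonIso S.toSheafComplex P n, ?_, ?_, ?_, ?_⟩
  · intro S S' f P n
    rw [comparisonIso_hom, comparisonIso_hom, ← HomologicalComplex.homologyMap_comp,
      ← HomologicalComplex.homologyMap_comp, comparison_naturality]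
  · intro S P P' f hf n
    rw [comparisonIso_hom, comparisonIso_hom]
    exact homologyMap_comparison_comp S.toSheafComplex f hf n
  · intro S P q a a' p z w ha hda hp hz hw
    rw [comparisonIso_hom]
    have hda' : (S.d q).mapΓc (ContinuousMap.id X) a' = 0 := by
      refine Subtype.ext (funext fun x => ?_)
      refine (congrArg ((S.d q).app x) (ha x)).trans ?_
      exact congrFun (congrArg Subtype.val hda) (EtaleGroupoid.Strings.ofObj _ x)
    have hc : (S.repComplex.d q (q + 1)).hom a' = 0 := by
      rw [EtaleGroupoid.SheafComplex.repComplex_d]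
      exact hda'
    -- The comparison produces the image of the empty symbol in place of the given `p`; both have
    -- augmentation `1`, so the two chains differ by a boundary.
    obtain ⟨y, hy⟩ := exists_edgeTensor_sub_eq_d (P := P) (C := S.repComplex)
      (((GroupBar.lift P).f 0).hom (Finsupp.single ![] (.single 1 1))) p a' hc
      ((GroupBar.aug_lift P _).trans hp.symm)
    refine Eq.trans ?_ (homologyπ_eq_of_sub_eq_d (hyperChains P.complex S.repComplex)
      ((HomologicalComplex.cyclesMap (comparison S.toSheafComplex P) (-(q : ℤ))).hom z) w y ?_)
    · exact congrArg (fun f => f.hom z)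
        (HomologicalComplex.homologyπ_naturality (comparison S.toSheafComplex P) (-(q : ℤ)))
    · rw [← hy, hw, ← comparison_edge S.toSheafComplex P q a a' ha, ← hz]
      refine congrArg (· - _) ?_
      exact congrArg (fun f => f.hom z)
        (HomologicalComplex.cyclesMap_i (comparison S.toSheafComplex P) (-(q : ℤ)))
  · intro S β P e μ _ _ hμ he
    have hI := β.integral_rep μ hμ
    obtain ⟨ρ, hρ, hρ'⟩ := exists_hyperhomology_functional S.toSheafComplex P (β.integral μ) hI
    -- Integrals were lifted to the universe of the modules and are brought back to `ℂ` here. The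
    -- functional on groupoid homology is then taken as the composite with `Φ`, so compatibility is
    -- immediate and the content lies in the two formulas on cycles.
    let ρ' : hyperhomology P S.repComplex 0 →+ ℂ := AddEquiv.ulift.toAddMonoidHom.comp ρ
    refine ⟨ρ'.comp (comparisonIso S.toSheafComplex P 0).hom.hom.toAddMonoidHom, ρ',
      fun z => ?_, fun w => ?_, fun _ => rfl⟩
    · refine (congrArg ULift.down (hρ' z)).trans ?_
      refine MeasureTheory.integral_congr_ae (Filter.Eventually.of_forall fun x => ?_)
      let a₀ : (S.obj 0).Γc (EtaleGroupoid.Strings.τ (transformationGroupoid G X) 0) :=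
        (totalProj S.barBicomplex).hom ((S.chains.iCycles 0).hom z)
      -- The empty-label string at `x` and `x` viewed as a string of length zero coincide; the germ
      -- types depend on the string, hence the heterogeneous equality.
      exact congrArg (β.ev x) (eq_of_heq (congr_arg_heq a₀.1
        (EtaleGroupoid.Strings.ext_labels rfl (Subsingleton.elim _ _))))
    · refine (congrArg ULift.down (hρ w)).trans ?_
      have h := hyperDesc_eq_hyperComponent P (C := S.repComplex)
        (A := ModuleCat.of ℤ (ULift.{u} ℂ)) (β.integral μ).toIntLinearMap hI e he
      rw [h]
      rfl
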